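/- Let $m\ge 0$ and let $\omega(\mathbf p)=\sqrt{|\mathbf p|^2+m^2}$ and $d\Omega_m(\mathbf p)=d^3p/\omega(\mathbf p)$. Let $\mathcal H=\bigoplus_{N\ge0}\mathcal H_N$ be the Fock space of the free neutral scalar field $\phi$ of mass $m$ on $\mathbb R^4$, where $\mathcal H_N$ is the space of symmetric functions in $L^2((\mathbb R^3)^N,\prod d\Omega_m)$, with vacuum $\Phi_0=(1,0,0,\dots)$. For $z\in\mathbb C^4$ with $-\operatorname{Im} z$ in the open forward light cone let $$D_m^{(-)}(z)=\frac1{2(2\pi)^3}\int_{\mathbb R^3}\omega(\mathbf p)^{-1}e^{-i\omega(\mathbf p)z^0+i\mathbf p\cdot\mathbf z}\,d^3p ,$$ the two-point function $(\Phi_0,\phi(x)\phi(y)\Phi_0)=D_m^{(-)}(x-y)$. Let $\mathcal T(T(\mathbb R^{d}))$ be the space of entire functions on $\mathbb C^d$ that are rapidly decreasing in every tube $\mathbb R^d+iK$, $K$ compact; its continuous linear functionals are the tempered ultra-hyperfunctions. For $f\in\mathcal T(T(\mathbb R^4))$ let $:\!\phi^k\!:\!(f)$ be the smeared Wick powers of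 $\phi$, as operators in $\mathcal H$, and for $g\in\mathbb C$ put $$:\!e^{g\phi^2}\!:\!(f)\,\Phi=\sum_{k=0}^\infty \frac{g^k}{k!}\,:\!\phi^{2k}\!:\!(f)\,\Phi$$ whenever all terms are defined and the series converges in the norm of $\mathcal H$. Let $n\in\mathbb N$, $l\in\mathbb R$, $r_1,\dots,r_n\in\{1,-1\}$, and $\rho^{(j)}(x)=\,:\!e^{-r_j i l^2\phi(x)^2}\!:$. For $z=(z_1,\dots,z_n)\in\mathbb C^{4n}$ let $A(z)$ be the symmetric $n\times n$ matrix with entries $a_{jj}=1$ and $$a_{jk}=a_{kj}=2h_{r_j}h_{r_k}l^2D_m^{(-)}(z_j-z_k)\quad(j<k),\qquad h_{\pm1}=e^{\pm i\pi/4}.$$ Then, in the sense of tempered ultra-hyperfunctions, $$(\Phi_0,\rho^{(1)}(x_1)\cdots\rho^{(n)}(x_n)\Phi_0)=(\det A)^{-1/2}.$$ Precisely: (a) For all $f_1,\dots,f_n\in\mathcal T(T(\mathbb R^4))$ the vector $\rho^{(1)}(f_1)\cdots\rho^{(n)}(f_n)\Phi_0\in\mathcal H$ is well defined. (b) There is $L>0$,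 depending only on $n$ and $l$, such that for all $y_1,\dots,y_n\in\mathbb R$ with $y_k-y_j>L$ for $j<k$, with $\Gamma_j=\mathbb R^4+i(y_j,0,0,0)$: on $\prod_j\Gamma_j$ one has $|\det A(z)-1|<1$; with the principal branch of the square root, $$F\mapsto\int_{\prod_j\Gamma_j}(\det A(z))^{-1/2}F(z)\,dz$$ is an absolutely convergent integral for $F\in\mathcal T(T(\mathbb R^{4n}))$ and defines a tempered ultra-hyperfunction; and for all $f_1,\dots,f_n\in\mathcal T(T(\mathbb R^4))$ $$(\Phi_0,\rho^{(1)}(f_1)\cdots\rho^{(n)}(f_n)\Phi_0)=\int_{\prod_j\Gamma_j}(\det A(z))^{-1/2}\prod_{j=1}^n f_j(z_j)\,dz .$$ -/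

import Mathlib

open MeasureTheory Filter Topology

noncomputable section

namespace WickField

/-! ### Kinematics -/

/-- Three-momentum (or position) space `ℝ³` with its Euclidean norm. -/
abbrev R3 : Type := EuclideanSpace ℝ (Fin 3)

/-- The energy `ω(p) = √(|p|² + m²)`. -/
def energy (m : ℝ) (p : R3) : ℝ := Real.sqrt (‖p‖ ^ 2 + m ^ 2)

/-- The point `(ω(p), p)` of the mass hyperboloid `ξ² = m²`, `ξ⁰ ≥ 0`, with spatial part `p`. -/
def onShell (m : ℝ) (p : R3) : Fin 4 → ℝ := Fin.cons (energy m p) (fun i : Fin 3 => p i)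

/-- The Minkowski product `p⁰ z⁰ - p¹ z¹ - p² z² - p³ z³` of a real and a complex four-vector. -/
def minkowski (p : Fin 4 → ℝ) (z : Fin 4 → ℂ) : ℂ :=
  (p 0 : ℂ) * z 0 - ∑ i : Fin 3, (p i.succ : ℂ) * z i.succ

/-- The two-point function
`D_m^{(-)}(z) = [2 (2π)³]⁻¹ ∫ ω(p)⁻¹ exp(-i ω(p) z⁰ + i p · z) dp`
(absolutely convergent if `-Im z` lies in the open forward light cone). -/
def twoPoint (m : ℝ) (z : Fin 4 → ℂ) : ℂ :=
  (2 * (2 * (Real.pi : ℂ)) ^ 3)⁻¹ *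
    ∫ p : R3, ((energy m p)⁻¹ : ℂ) * Complex.exp (-Complex.I * minkowski (onShell m p) z)

/-! ### Test functions and tempered ultra-hyperfunctions -/

/-- `SeminormLE k C F`: the seminorm `sup (1 + |z|)^k |F(z)|` of `F` over the closed tube
`|Im z_a| ≤ k` is at most `C`. -/
def SeminormLE {ι : Type} [Fintype ι] (k : ℕ) (C : ℝ) (F : (ι → ℂ) → ℂ) : Prop :=
  ∀ z : ι → ℂ, (∀ a, |(z a).im| ≤ k) → (1 + ‖z‖) ^ k * ‖F z‖ ≤ C

/-- The space `𝒯(T(ℝ^ι))` of entire functions on `ℂ^ι` that are rapidly decreasing in every tube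
`ℝ^ι + iK`, `K` compact. -/
def testSpace (ι : Type) [Fintype ι] : Submodule ℂ ((ι → ℂ) → ℂ) where
  carrier := {F | Differentiable ℂ F ∧ ∀ k : ℕ, ∃ C : ℝ, SeminormLE k C F}
  add_mem' := by
    rintro F G ⟨hF, hF'⟩ ⟨hG, hG'⟩
    refine ⟨hF.add hG, fun k => ?_⟩
    obtain ⟨C, hC⟩ := hF' k
    obtain ⟨D, hD⟩ := hG' k
    refine ⟨C + D, fun z hz => ?_⟩
    have h1 := hC z hz
    have h2 := hD z hz
    have h3 : ‖(F + G) z‖ ≤ ‖F z‖ + ‖G z‖ := norm_add_le _ _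
    have h4 : (0 : ℝ) ≤ (1 + ‖z‖) ^ k := by positivity
    nlinarith [mul_le_mul_of_nonneg_left h3 h4]
  zero_mem' := by
    refine ⟨differentiable_const 0, fun k => ⟨0, fun z _ => ?_⟩⟩
    simp
  smul_mem' := by
    rintro c F ⟨hF, hF'⟩
    refine ⟨hF.const_smul c, fun k => ?_⟩
    obtain ⟨C, hC⟩ := hF' k
    refine ⟨‖c‖ * C, fun z hz => ?_⟩
    have h1 := mul_le_mul_of_nonneg_left (hC z hz) (norm_nonneg c)
    have h2 : ‖(c • F) z‖ = ‖c‖ * ‖F z‖ := by simp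
    rw [h2]
    linarith

/-- `W` restricts to a continuous linear functional on `testSpace ι`, i.e. to a tempered
ultra-hyperfunction (the seminorms above are increasing in `k` and define the topology). -/
def IsTemperedUltrahyperfunction {ι : Type} [Fintype ι] (W : ((ι → ℂ) → ℂ) → ℂ) : Prop :=
  IsLinearMap ℂ (fun F : testSpace ι => W F) ∧
    ∃ (k : ℕ) (C : ℝ), ∀ F ∈ testSpace ι, ∀ B : ℝ, SeminormLE k B F → ‖W F‖ ≤ C * B

/-- The Fourier transform `f̃(p) = (2π)⁻² ∫ f(x) exp(-i p·x) dx` over real Minkowski space. -/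
def fourier4 (f : (Fin 4 → ℂ) → ℂ) (p : Fin 4 → ℝ) : ℂ :=
  ((2 * (Real.pi : ℂ)) ^ 2)⁻¹ *
    ∫ x : Fin 4 → ℝ, f (fun μ => (x μ : ℂ)) *
      Complex.exp (-Complex.I * minkowski p (fun μ => (x μ : ℂ)))

/-! ### Fock space -/

/-- The Lorentz invariant measure `dΩ_m(ξ) = dξ¹ dξ² dξ³ / √(|ξ|² + m²)`, with the hyperboloid
parametrized by the spatial momentum. -/
def shellMeasure (m : ℝ) : Measure R3 :=
  volume.withDensity (fun p => ENNReal.ofReal (energy m p)⁻¹)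

instance (m : ℝ) : SigmaFinite (shellMeasure m) := by
  unfold shellMeasure
  infer_instance

/-- The product measure `∏ dΩ_m(ξ_k)` on `n` copies of the hyperboloid. -/
abbrev shellMeasures (m : ℝ) (n : ℕ) : Measure (Fin n → R3) :=
  Measure.pi (fun _ => shellMeasure m)

theorem measurePreserving_perm (m : ℝ) {n : ℕ} (σ : Equiv.Perm (Fin n)) :
    MeasurePreserving (fun ξ : Fin n → R3 => ξ ∘ σ) (shellMeasures m n) (shellMeasures m n) := by
  have h := measurePreserving_piCongrLeft (α := fun _ : Fin n => R3)
    (fun _ : Fin n => shellMeasure m) σ.symm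
  have e : (fun ξ : Fin n → R3 => ξ ∘ σ) =
      (MeasurableEquiv.piCongrLeft (fun _ : Fin n => R3) σ.symm) := by
    funext ξ i
    have := Equiv.piCongrLeft_apply_apply (P := fun _ : Fin n => R3) σ.symm ξ (σ i)
    rw [Equiv.symm_apply_apply] at this
    rw [MeasurableEquiv.coe_piCongrLeft, this]
    rfl
  rw [e]
  exact h

/-- The `n`-particle space `ℋ_n`: symmetric square-integrable functions of `n` momenta. -/
def particleSpace (m : ℝ) (n : ℕ) : Submodule ℂ (Lp ℂ 2 (shellMeasures m n)) where
  carrier := {g | ∀ σ : Equiv.Perm (Fin n),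
    (fun ξ : Fin n → R3 => g (ξ ∘ σ)) =ᵐ[shellMeasures m n] g}
  add_mem' := by
    intro g h hg hh σ
    have q := (measurePreserving_perm m σ).quasiMeasurePreserving.ae (Lp.coeFn_add g h)
    filter_upwards [hg σ, hh σ, q, Lp.coeFn_add g h] with ξ h1 h2 h3 h4
    rw [h3, h4, Pi.add_apply, Pi.add_apply, h1, h2]
  zero_mem' := by
    intro σ
    have z := Lp.coeFn_zero ℂ 2 (shellMeasures m n)
    have q := (measurePreserving_perm m σ).quasiMeasurePreserving.ae z
    filter_upwards [q, z] with ξ h1 h2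
    rw [h1, h2]
    rfl
  smul_mem' := by
    intro c g hg σ
    have q := (measurePreserving_perm m σ).quasiMeasurePreserving.ae (Lp.coeFn_smul c g)
    filter_upwards [hg σ, q, Lp.coeFn_smul c g] with ξ h1 h2 h3
    rw [h2, h3, Pi.smul_apply, Pi.smul_apply, h1]

/-- The Fock space `ℋ = ⊕ ℋ_n` (Hilbert space direct sum). -/
abbrev Fock (m : ℝ) : Type := lp (fun n : ℕ => particleSpace m n) 2

/-- The `n`-particle component `Φ⁽ⁿ⁾` of a Fock vector, as a function of `n` momenta. -/
def component {m : ℝ} (Φ : Fock m) (n : ℕ) : (Fin n → R3) → ℂ :=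
  ((Φ n : particleSpace m n) : Lp ℂ 2 (shellMeasures m n))

theorem memLp_one_zero (m : ℝ) :
    MemLp (fun _ : Fin 0 → R3 => (1 : ℂ)) 2 (shellMeasures m 0) := by
  have : IsFiniteMeasure (shellMeasures m 0) := by
    rw [shellMeasures, Measure.pi_of_empty]
    infer_instance
  exact memLp_const 1

/-- The vacuum `Φ₀ = (1, 0, 0, …)`. -/
def vacuum (m : ℝ) : Fock m :=
  lp.single 2 0 ⟨(memLp_one_zero m).toLp, by
    intro σ
    have : ∀ ξ : Fin 0 → R3, ξ ∘ σ = ξ := fun ξ => Subsingleton.elim _ _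
    simp only [this]
    exact Filter.EventuallyEq.rfl⟩

/-! ### Wick powers of the free field -/

/-- The integrand in the contribution to `(:φ^l:(f) Φ)⁽ⁿ⁾(ξ)` in which the particles with label in
`S` are created and `j = l - #S` particles, with momenta `η`, are annihilated. -/
def wickIntegrand (m : ℝ) (l : ℕ) (f : (Fin 4 → ℂ) → ℂ) (Φ : Fock m) {n : ℕ}
    (S : Finset (Fin n)) (ξ : Fin n → R3) (η : Fin (l - S.card) → R3) : ℂ :=
  fourier4 f (∑ r, onShell m (η r) - ∑ k ∈ S, onShell m (ξ k)) *
    component Φ ((l - S.card) + Sᶜ.card) (Fin.append η (fun i => ξ (Sᶜ.orderEmbOfFin rfl i)))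

/-- The right-hand side of the Wightman–Gårding formula for `(:φ^l:(f) Φ)⁽ⁿ⁾(ξ)`. With `j = l - #S`,
```
π^{l/2} / (2π)^{2(l-1)} ∑_S √((n - l + 2j)! / n!) (l! / j!)
  ∫ f̃(∑ η_r - ∑_{k ∈ S} ξ_k) Φ⁽ⁿ⁻ˡ⁺²ʲ⁾(η, ξ without S) ∏ dΩ_m(η_r),
```
the sum being over all `S ⊆ {1, …, n}` with at most `l` elements; the factor `l!` is the number of
(equal) terms of the sum over permutations of the `l` momenta. -/
def wickFormula (m : ℝ) (l : ℕ) (f : (Fin 4 → ℂ) → ℂ) (Φ : Fock m) (n : ℕ)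
    (ξ : Fin n → R3) : ℂ :=
  ((Real.sqrt Real.pi ^ l * (2 * Real.pi) ^ 2 / (2 * Real.pi) ^ (2 * l) : ℝ) : ℂ) *
    ∑ S : Finset (Fin n) with S.card ≤ l,
      ((Real.sqrt ((((l - S.card) + Sᶜ.card).factorial : ℝ) / (n.factorial : ℝ)) *
          ((l.factorial : ℝ) / ((l - S.card).factorial : ℝ)) : ℝ) : ℂ) *
        ∫ η, wickIntegrand m l f Φ S ξ η ∂(shellMeasures m (l - S.card))

/-- The graph of the operator `:φ^l:(f)` in Fock space: `Φ` is in its domain and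
`:φ^l:(f) Φ = Ψ`. -/
def IsWickPowerApply (m : ℝ) (l : ℕ) (f : (Fin 4 → ℂ) → ℂ) (Φ Ψ : Fock m) : Prop :=
  ∀ n : ℕ, ∀ᵐ ξ ∂(shellMeasures m n),
    (∀ S : Finset (Fin n), S.card ≤ l →
      Integrable (wickIntegrand m l f Φ S ξ) (shellMeasures m (l - S.card))) ∧
    component Ψ n ξ = wickFormula m l f Φ n ξ

/-- The graph of the operator `:exp(g φ²):(f) = ∑_k g^k :φ^{2k}:(f) / k!`, the series being
strongly convergent: `:exp(g φ²):(f) Φ = Ψ`. -/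
def IsWickExpSqApply (m : ℝ) (g : ℂ) (f : (Fin 4 → ℂ) → ℂ) (Φ Ψ : Fock m) : Prop :=
  ∃ χ : ℕ → Fock m, (∀ k, IsWickPowerApply m (2 * k) f Φ (χ k)) ∧
    Tendsto (fun N : ℕ => ∑ k ∈ Finset.range N, (g ^ k / (k.factorial : ℂ)) • χ k)
      atTop (𝓝 Ψ)

/-- `Ψ = ρ⁽¹⁾(f₁) ⋯ ρ⁽ⁿ⁾(f_n) Φ₀`, where `ρ⁽ʲ⁾ = :exp(g_j φ²):`; the operators are applied one
after the other, the last one first. -/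
def IsWickExpSqProduct (m : ℝ) {n : ℕ} (g : Fin n → ℂ) (f : Fin n → (Fin 4 → ℂ) → ℂ)
    (Ψ : Fock m) : Prop :=
  ∃ V : Fin (n + 1) → Fock m, V (Fin.last n) = vacuum m ∧ V 0 = Ψ ∧
    ∀ j : Fin n, IsWickExpSqApply m (g j) (f j) (V j.succ) (V j.castSucc)

/-! ### The determinant -/

/-- `h_r = exp(i r π / 4)` for `r = ±1`. -/
def phase (r : ℤ) : ℂ := Complex.exp (Complex.I * r * Real.pi / 4)

/-- The symmetric matrix `A` with `a_{jj} = 1` and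
`a_{jk} = a_{kj} = 2 h_{r_j} h_{r_k} l² D_m^{(-)}(z_j - z_k)` for `j < k`. -/
def vevMatrix (m l : ℝ) {n : ℕ} (r : Fin n → ℤ) (z : Fin n → Fin 4 → ℂ) :
    Matrix (Fin n) (Fin n) ℂ :=
  Matrix.of fun j k => if j = k then 1 else
    2 * phase (r j) * phase (r k) * (l : ℂ) ^ 2 * twoPoint m (z (min j k) - z (max j k))

/-- The point with components `x_j + i (y_j, 0, 0, 0)` of the contour `∏ Γ_j`,
`Γ_j = ℝ⁴ + i (y_j, 0, 0, 0)`. -/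
def contour {n : ℕ} (y : Fin n → ℝ) (x : Fin n → Fin 4 → ℝ) : Fin n → Fin 4 → ℂ :=
  fun j μ => (x j μ : ℂ) + if μ = 0 then (y j : ℂ) * Complex.I else 0

/-- The integrand `(det A(z))^{-1/2} F(z)` (principal branch) at a point of the contour. -/
def detIntegrand (m l : ℝ) {n : ℕ} (r : Fin n → ℤ) (y : Fin n → ℝ)
    (F : (Fin n × Fin 4 → ℂ) → ℂ) (x : Fin n → Fin 4 → ℝ) : ℂ :=
  (vevMatrix m l r (contour y x)).det ^ (-(1 / 2) : ℂ) * F (fun a => contour y x a.1 a.2)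

/-- The generalized function `(det A)^{-1/2}`:
`F ↦ ∫_{∏ Γ_j} (det A(z))^{-1/2} F(z) dz`. -/
def detFunctional (m l : ℝ) {n : ℕ} (r : Fin n → ℤ) (y : Fin n → ℝ)
    (F : (Fin n × Fin 4 → ℂ) → ℂ) : ℂ :=
  ∫ x : Fin n → Fin 4 → ℝ, detIntegrand m l r y F x

/-- The test function `f₁ ⊗ ⋯ ⊗ f_n`. -/
def tensorFun {n : ℕ} (f : Fin n → (Fin 4 → ℂ) → ℂ) : (Fin n × Fin 4 → ℂ) → ℂ :=
  fun w => ∏ j, f j (fun μ => w (j, μ))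

end WickField

end

/-!
Write `g_j = c_j² / 2`. Since `exp(c² φ² / 2)` is the expectation of `exp(t c φ)` over a standard
Gaussian variable `t`, a product of Wick exponentials of `φ²` applied to the vacuum is a Gaussian
superposition of products of Wick exponentials `:exp(t_j c_j φ(z_j)):` applied to the vacuum. Such
a product is a coherent vector times the exponential of the sum over `j < k` of the contractions
`t_j t_k c_j c_k D_m^{(-)}(z_j - z_k)`. Moving the contours to well-separated imaginary times makes
the two-point functions so small that this exponential is dominated by the Gaussian weight, and
the remaining decay of the coherent vectors in the energy makes the exponential series converge in
norm. The vacuum component of the superposition is the Gaussian integral of the exponential of a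
quadratic form, which is a determinant to the power `-1/2`; connecting the matrix to the identity
shows that the branch of the square root is the principal one.
-/

noncomputable section

namespace WickField

/-! ### The mass shell -/

lemma energy_nonneg (m : ℝ) (p : R3) : 0 ≤ energy m p := Real.sqrt_nonneg _

lemma norm_le_energy (m : ℝ) (p : R3) : ‖p‖ ≤ energy m p :=
  Real.le_sqrt_of_sq_le (le_add_of_nonneg_right (sq_nonneg m))

@[fun_prop]
lemma continuous_energy (m : ℝ) : Continuous (energy m) := by
  unfold energy
  fun_prop

@[fun_prop]
lemma measurable_energy (m : ℝ) : Measurable (energy m) := (continuous_energy m).measurable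

lemma minkowski_sub_right (p : Fin 4 → ℝ) (z w : Fin 4 → ℂ) :
    minkowski p (z - w) = minkowski p z - minkowski p w := by
  simp only [minkowski, Pi.sub_apply, mul_sub, Finset.sum_sub_distrib]
  ring

lemma minkowski_sub_left (p q : Fin 4 → ℝ) (z : Fin 4 → ℂ) :
    minkowski (p - q) z = minkowski p z - minkowski q z := by
  simp only [minkowski, Pi.sub_apply, Complex.ofReal_sub, sub_mul, Finset.sum_sub_distrib]
  ring

lemma minkowski_sum_left {ι : Type*} (s : Finset ι) (p : ι → Fin 4 → ℝ) (z : Fin 4 → ℂ) :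
    minkowski (∑ i ∈ s, p i) z = ∑ i ∈ s, minkowski (p i) z := by
  simp only [minkowski, Finset.sum_apply, Complex.ofReal_sum, Finset.sum_mul,
    Finset.sum_sub_distrib]
  rw [Finset.sum_comm]

/-- The plane wave `exp(i p·z)` with momentum on the mass shell over `p`: the one-particle wave
function of `φ(z) Φ₀`, up to normalization. -/
def planeWave (m : ℝ) (p : R3) (z : Fin 4 → ℂ) : ℂ :=
  Complex.exp (Complex.I * minkowski (onShell m p) z)

lemma exp_neg_minkowski_sub {ι κ : Type*} (m : ℝ) (s : Finset ι) (t : Finset κ) (η : ι → R3)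
    (ξ : κ → R3) (z : Fin 4 → ℂ) :
    Complex.exp (-Complex.I *
        minkowski (∑ r ∈ s, onShell m (η r) - ∑ k ∈ t, onShell m (ξ k)) z) =
      (∏ r ∈ s, (planeWave m (η r) z)⁻¹) * ∏ k ∈ t, planeWave m (ξ k) z := by
  simp only [planeWave, ← Complex.exp_neg, ← Complex.exp_sum, ← Complex.exp_add,
    minkowski_sub_left, minkowski_sum_left, Finset.sum_neg_distrib, ← Finset.mul_sum]
  congr 1
  ring

/-- The point `x + i (y, 0, 0, 0)` of the contour `ℝ⁴ + i (y, 0, 0, 0)`. -/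
def timeShift (y : ℝ) (x : Fin 4 → ℝ) : Fin 4 → ℂ :=
  fun μ => (x μ : ℂ) + if μ = 0 then (y : ℂ) * Complex.I else 0

lemma norm_planeWave_timeShift (m : ℝ) (p : R3) (y : ℝ) (x : Fin 4 → ℝ) :
    ‖planeWave m p (timeShift y x)‖ = Real.exp (-(y * energy m p)) := by
  rw [planeWave, Complex.norm_exp]
  congr 1
  simp [minkowski, timeShift, onShell, Fin.sum_univ_succ, Complex.mul_re, Complex.mul_im,
    Fin.succ_ne_zero]
  ring

@[fun_prop]
lemma measurable_planeWave {α : Type*} [MeasurableSpace α] {m : ℝ} {p : α → R3}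
    {z : α → Fin 4 → ℂ} (hp : Measurable p) (hz : Measurable z) :
    Measurable (fun a => planeWave m (p a) (z a)) := by
  unfold planeWave minkowski onShell
  simp only [Fin.cons_zero, Fin.cons_succ]
  fun_prop

@[fun_prop]
lemma continuous_timeShift (y : ℝ) : Continuous (timeShift y) := by
  unfold timeShift
  fun_prop

@[fun_prop]
lemma measurable_timeShift (y : ℝ) : Measurable (timeShift y) :=
  (continuous_timeShift y).measurable

/-! ### Integrals over the mass shell -/

/-- `∫ |p|⁻¹ exp(-|p|) dp`; divided by `L²` it bounds `∫ exp(-L ω) dΩ_m` for every mass `m`. -/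
def shellConst : ℝ := ∫ p : R3, ‖p‖⁻¹ * Real.exp (-‖p‖)

lemma shellConst_nonneg : 0 ≤ shellConst :=
  integral_nonneg fun _ => by positivity

lemma integrable_inv_norm_mul_exp {L : ℝ} (hL : 0 < L) :
    Integrable (fun p : R3 => ‖p‖⁻¹ * Real.exp (-(L * ‖p‖))) := by
  refine (integrable_fun_norm_addHaar (volume : Measure R3)
    (f := fun r : ℝ => r⁻¹ * Real.exp (-(L * r)))).2 ?_
  have h := integrableOn_rpow_mul_exp_neg_mul_rpow (p := 1) (s := 1) (b := L) (by norm_num)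
    one_pos hL
  refine h.congr_fun (fun r (hr : 0 < r) => ?_) measurableSet_Ioi
  simp only [finrank_euclideanSpace, Fintype.card_fin, Real.rpow_one, smul_eq_mul]
  field_simp

lemma integral_inv_norm_mul_exp {L : ℝ} (hL : 0 < L) :
    ∫ p : R3, ‖p‖⁻¹ * Real.exp (-(L * ‖p‖)) = shellConst / L ^ 2 := by
  have scaling := Measure.integral_comp_smul volume (fun p : R3 => ‖p‖⁻¹ * Real.exp (-‖p‖)) L
  simp only [norm_smul, Real.norm_of_nonneg hL.le, mul_inv, mul_assoc, integral_const_mul,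
    finrank_euclideanSpace, Fintype.card_fin, smul_eq_mul, abs_of_pos (inv_pos.2 (pow_pos hL 3))]
    at scaling
  rw [shellConst]
  field_simp at scaling ⊢
  linarith

lemma integral_shellMeasure {E : Type*} [NormedAddCommGroup E] [NormedSpace ℝ E] (m : ℝ)
    (g : R3 → E) : ∫ p, g p ∂(shellMeasure m) = ∫ p, (energy m p)⁻¹ • g p := by
  unfold shellMeasure
  rw [integral_withDensity_eq_integral_toReal_smul (by fun_prop)
    (ae_of_all _ fun p => ENNReal.ofReal_lt_top)]
  simp only [ENNReal.toReal_ofReal (inv_nonneg.2 (energy_nonneg m _))]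

lemma integrable_shellMeasure_iff {E : Type*} [NormedAddCommGroup E] [NormedSpace ℝ E] (m : ℝ)
    (g : R3 → E) : Integrable g (shellMeasure m) ↔ Integrable (fun p => (energy m p)⁻¹ • g p) := by
  unfold shellMeasure
  rw [integrable_withDensity_iff_integrable_smul' (by fun_prop)
    (ae_of_all _ fun p => ENNReal.ofReal_lt_top)]
  simp only [ENNReal.toReal_ofReal (inv_nonneg.2 (energy_nonneg m _))]

lemma inv_energy_mul_exp_ae_le (m : ℝ) {L : ℝ} (hL : 0 < L) :
    ∀ᵐ p : R3, (energy m p)⁻¹ * Real.exp (-(L * energy m p)) ≤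
      ‖p‖⁻¹ * Real.exp (-(L * ‖p‖)) := by
  filter_upwards [Measure.ae_ne volume (0 : R3)] with p hp
  have := norm_pos_iff.2 hp
  have := norm_le_energy m p
  gcongr

lemma integrable_exp_neg_energy (m : ℝ) {L : ℝ} (hL : 0 < L) :
    Integrable (fun p => Real.exp (-(L * energy m p))) (shellMeasure m) := by
  rw [integrable_shellMeasure_iff]
  refine (integrable_inv_norm_mul_exp hL).mono' (Measurable.aestronglyMeasurable (by fun_prop)) ?_
  filter_upwards [inv_energy_mul_exp_ae_le m hL] with p hp
  rwa [smul_eq_mul, Real.norm_of_nonneg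
    (mul_nonneg (inv_nonneg.2 (energy_nonneg m p)) (Real.exp_pos _).le)]

lemma integral_exp_neg_energy_le (m : ℝ) {L : ℝ} (hL : 0 < L) :
    ∫ p, Real.exp (-(L * energy m p)) ∂(shellMeasure m) ≤ shellConst / L ^ 2 := by
  rw [← integral_inv_norm_mul_exp hL, integral_shellMeasure]
  exact integral_mono_ae
    ((integrable_shellMeasure_iff m _).1 (integrable_exp_neg_energy m hL))
    (integrable_inv_norm_mul_exp hL) (inv_energy_mul_exp_ae_le m hL)

/-! ### The two-point function -/

/-- The constant `√π / (2π)²` to whose `l`-th power the prefactor of `:φ^l:` is proportional; its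
square normalizes the two-point function. -/
def fieldConst : ℝ := Real.sqrt Real.pi / (2 * Real.pi) ^ 2

lemma fieldConst_nonneg : 0 ≤ fieldConst := by
  unfold fieldConst
  positivity

lemma fieldConst_sq : fieldConst ^ 2 = (2 * (2 * Real.pi) ^ 3)⁻¹ := by
  rw [fieldConst, div_pow, Real.sq_sqrt Real.pi_pos.le]
  field_simp

lemma twoPoint_sub_eq (m : ℝ) (z w : Fin 4 → ℂ) :
    twoPoint m (z - w) = (fieldConst : ℂ) ^ 2 *
      ∫ p, (planeWave m p z)⁻¹ * planeWave m p w ∂(shellMeasure m) := by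
  rw [integral_shellMeasure, twoPoint, ← Complex.ofReal_pow, fieldConst_sq]
  push_cast
  congr 2
  funext p
  rw [minkowski_sub_right, planeWave, planeWave, ← Complex.exp_neg, ← Complex.exp_add,
    Complex.real_smul]
  push_cast
  congr 2
  ring

lemma norm_inv_planeWave_mul (m : ℝ) (p : R3) (y y' : ℝ) (x x' : Fin 4 → ℝ) :
    ‖(planeWave m p (timeShift y x))⁻¹ * planeWave m p (timeShift y' x')‖ =
      Real.exp (-((y' - y) * energy m p)) := by
  rw [norm_mul, norm_inv, norm_planeWave_timeShift, norm_planeWave_timeShift, ← Real.exp_neg,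
    ← Real.exp_add]
  congr 1
  ring

lemma integrable_inv_planeWave_mul (m : ℝ) {y y' : ℝ} (h : y < y') (x x' : Fin 4 → ℝ) :
    Integrable (fun p => (planeWave m p (timeShift y x))⁻¹ * planeWave m p (timeShift y' x'))
      (shellMeasure m) :=
  (integrable_exp_neg_energy m (sub_pos.2 h)).mono'
    (Measurable.aestronglyMeasurable (by fun_prop))
    (ae_of_all _ fun p => (norm_inv_planeWave_mul m p y y' x x').le)

lemma norm_twoPoint_le (m : ℝ) {L y y' : ℝ} (hL : 0 < L) (h : L ≤ y' - y) (x x' : Fin 4 → ℝ) :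
    ‖twoPoint m (timeShift y x - timeShift y' x')‖ ≤ fieldConst ^ 2 * (shellConst / L ^ 2) := by
  rw [twoPoint_sub_eq, norm_mul, norm_pow, Complex.norm_real, Real.norm_of_nonneg fieldConst_nonneg]
  gcongr
  refine (norm_integral_le_of_norm_le (integrable_exp_neg_energy m hL)
    (ae_of_all _ fun p => ?_)).trans (integral_exp_neg_energy_le m hL)
  rw [norm_inv_planeWave_mul]
  have := energy_nonneg m p
  gcongr

@[fun_prop]
lemma measurable_twoPoint (m : ℝ) : Measurable (twoPoint m) := by
  unfold twoPoint
  refine Measurable.const_mul ?_ _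
  have : Measurable (fun q : (Fin 4 → ℂ) × R3 => ((energy m q.2)⁻¹ : ℂ) *
      Complex.exp (-Complex.I * minkowski (onShell m q.2) q.1)) := by
    unfold minkowski onShell
    simp only [Fin.cons_zero, Fin.cons_succ]
    fun_prop
  exact this.stronglyMeasurable.integral_prod_right.measurable

/-! ### The polynomials of a Wick power acting on a coherent vector -/

section WickPoly

variable {𝕜 ι : Type*} [Fintype ι] [DecidableEq ι]

/-- The part of degree `l` in `(X, a)` of `exp X * ∏ k, (a k + b k)`. This is the effect of
`:φ^l: / l!` on a coherent vector: `X` is the contraction with its source, `a` the particles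
created, `b` the particles left alone. -/
def wickPoly [Field 𝕜] (l : ℕ) (X : 𝕜) (a b : ι → 𝕜) : 𝕜 :=
  ∑ S : Finset ι with S.card ≤ l,
    X ^ (l - S.card) / ((l - S.card).factorial : 𝕜) * ((∏ k ∈ S, a k) * ∏ k ∈ Sᶜ, b k)

lemma hasSum_pow_sub_div_factorial [RCLike 𝕜] (X : 𝕜) (s : ℕ) :
    HasSum (fun l : ℕ => if s ≤ l then X ^ (l - s) / ((l - s).factorial : 𝕜) else 0)
      (NormedSpace.exp X) := by
  rw [← (add_left_injective s).hasSum_iff]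
  · simpa [Function.comp_def] using NormedSpace.expSeries_div_hasSum_exp X
  · exact fun l hl => if_neg fun hsl => hl ⟨l - s, Nat.sub_add_cancel hsl⟩

lemma hasSum_wickPoly [RCLike 𝕜] (X : 𝕜) (a b : ι → 𝕜) :
    HasSum (fun l => wickPoly l X a b) (NormedSpace.exp X * ∏ k, (a k + b k)) := by
  have h := hasSum_sum (s := (Finset.univ : Finset (Finset ι))) fun S _ =>
    (hasSum_pow_sub_div_factorial X S.card).mul_right ((∏ k ∈ S, a k) * ∏ k ∈ Sᶜ, b k)
  simpa only [wickPoly, Finset.sum_filter, ite_mul, zero_mul, ← Finset.mul_sum, Finset.prod_add,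
    Finset.powerset_univ, ← Finset.compl_eq_univ_sdiff] using h

lemma wickPoly_mul [Field 𝕜] (l : ℕ) (s X : 𝕜) (a b : ι → 𝕜) :
    wickPoly l (s * X) (fun k => s * a k) b = s ^ l * wickPoly l X a b := by
  unfold wickPoly
  rw [Finset.mul_sum]
  refine Finset.sum_congr rfl fun S hS => ?_
  have degree : s ^ l = s ^ (l - S.card) * s ^ S.card := by
    rw [← pow_add, Nat.sub_add_cancel (Finset.mem_filter.1 hS).2]
  rw [Finset.prod_mul_distrib, Finset.prod_const, mul_pow, degree]
  ring

lemma wickPoly_prod_mul [Field 𝕜] (l : ℕ) (X : 𝕜) (d a b : ι → 𝕜) :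
    wickPoly l X (fun k => d k * a k) (fun k => d k * b k) = (∏ k, d k) * wickPoly l X a b := by
  unfold wickPoly
  rw [Finset.mul_sum]
  refine Finset.sum_congr rfl fun S _ => ?_
  rw [Finset.prod_mul_distrib, Finset.prod_mul_distrib, ← Finset.prod_mul_prod_compl S d]
  ring

lemma wickPoly_nonneg (l : ℕ) {X : ℝ} {a b : ι → ℝ} (hX : 0 ≤ X)
    (ha : ∀ k, 0 ≤ a k) (hb : ∀ k, 0 ≤ b k) : 0 ≤ wickPoly l X a b :=
  Finset.sum_nonneg fun _ _ => mul_nonneg (by positivity)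
    (mul_nonneg (Finset.prod_nonneg fun k _ => ha k) (Finset.prod_nonneg fun k _ => hb k))

lemma norm_wickPoly_le [RCLike 𝕜] (l : ℕ) {X : 𝕜} {a b : ι → 𝕜} {X' : ℝ} {a' b' : ι → ℝ}
    (hX : ‖X‖ ≤ X') (ha : ∀ k, ‖a k‖ ≤ a' k) (hb : ∀ k, ‖b k‖ ≤ b' k) :
    ‖wickPoly l X a b‖ ≤ wickPoly l X' a' b' := by
  have prod_le (S : Finset ι) {u : ι → 𝕜} {v : ι → ℝ} (h : ∀ k, ‖u k‖ ≤ v k) :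
      ∏ k ∈ S, ‖u k‖ ≤ ∏ k ∈ S, v k :=
    Finset.prod_le_prod (fun _ _ => norm_nonneg _) fun k _ => h k
  refine (norm_sum_le _ _).trans (Finset.sum_le_sum fun S _ => ?_)
  simp only [norm_mul, norm_div, norm_pow, norm_prod, RCLike.norm_natCast]
  have := (norm_nonneg _).trans hX
  exact mul_le_mul (by gcongr) (mul_le_mul (prod_le S ha) (prod_le Sᶜ hb) (by positivity)
    (Finset.prod_nonneg fun k _ => (norm_nonneg _).trans (ha k))) (by positivity) (by positivity)

lemma wickPoly_comp_perm [Field 𝕜] (l : ℕ) (X : 𝕜) (a b : ι → 𝕜) (σ : Equiv.Perm ι) :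
    wickPoly l X (a ∘ σ) (b ∘ σ) = wickPoly l X a b := by
  unfold wickPoly
  simp only [Finset.sum_filter]
  refine Fintype.sum_equiv σ.finsetCongr _ _ fun S => ?_
  have compl_map : (S.map σ.toEmbedding)ᶜ = Sᶜ.map σ.toEmbedding := by
    ext x
    simp
  simp only [Equiv.finsetCongr_apply, Finset.card_map, compl_map, Finset.prod_map,
    Equiv.coe_toEmbedding, Function.comp_apply]

end WickPoly

/-! ### Gaussian integrals -/

/-- The standard Gaussian measure on the line, the law of the auxiliary variables that linearize
the exponents `φ²`. -/
abbrev stdGauss : Measure ℝ := ProbabilityTheory.gaussianReal 0 1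

lemma integral_stdGauss {E : Type*} [NormedAddCommGroup E] [NormedSpace ℝ E] (g : ℝ → E) :
    ∫ t, g t ∂stdGauss =
      (Real.sqrt (2 * Real.pi))⁻¹ • ∫ t : ℝ, Real.exp (-t ^ 2 / 2) • g t := by
  rw [ProbabilityTheory.integral_gaussianReal_eq_integral_smul one_ne_zero, ← integral_smul]
  simp [ProbabilityTheory.gaussianPDFReal, smul_smul]

lemma integrable_stdGauss_iff {E : Type*} [NormedAddCommGroup E] [NormedSpace ℝ E] (g : ℝ → E) :
    Integrable g stdGauss ↔ Integrable (fun t : ℝ => Real.exp (-t ^ 2 / 2) • g t) := by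
  rw [stdGauss, ProbabilityTheory.gaussianReal_of_var_ne_zero _ one_ne_zero,
    integrable_withDensity_iff_integrable_smul' (by fun_prop)
      (ae_of_all _ fun p => by simp [ProbabilityTheory.gaussianPDF]),
    ← integrable_smul_iff (c := (Real.sqrt (2 * Real.pi))⁻¹) (by positivity)
      (fun t : ℝ => Real.exp (-t ^ 2 / 2) • g t)]
  refine iff_of_eq (congrArg (Integrable · volume) ?_)
  funext t
  simp [ProbabilityTheory.toReal_gaussianPDF, ProbabilityTheory.gaussianPDFReal, smul_smul]

lemma integrable_exp_mul_sq_stdGauss {θ : ℝ} (hθ : θ < 1 / 2) :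
    Integrable (fun t : ℝ => Real.exp (θ * t ^ 2)) stdGauss := by
  rw [integrable_stdGauss_iff]
  convert integrable_exp_neg_mul_sq (b := 1 / 2 - θ) (by linarith) using 2 with t
  rw [smul_eq_mul, ← Real.exp_add]
  ring_nf

lemma integral_pow_odd_stdGauss {k : ℕ} (hk : Odd k) : ∫ t : ℝ, (t : ℂ) ^ k ∂stdGauss = 0 := by
  have reflection : ∫ t : ℝ, (t : ℂ) ^ k ∂stdGauss = -∫ t : ℝ, (t : ℂ) ^ k ∂stdGauss := by
    conv_lhs => rw [stdGauss, ← neg_zero, ← ProbabilityTheory.gaussianReal_map_neg,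
      integral_map (by fun_prop) (by fun_prop)]
    simp only [Complex.ofReal_neg, hk.neg_pow, integral_neg]
  exact CharZero.eq_neg_self_iff.1 reflection

lemma integral_pow_mul_exp_neg_sq (k : ℕ) :
    ∫ t in Set.Ioi (0 : ℝ), t ^ (2 * k) * Real.exp (-(1 / 2) * t ^ 2) =
      2 ^ k * (Real.sqrt 2 / 2) * Real.Gamma (k + 1 / 2) := by
  have h := integral_rpow_mul_exp_neg_mul_rpow (p := 2) (q := ((2 * k : ℕ) : ℝ)) (b := 1 / 2)
    two_pos (neg_one_lt_zero.trans_le (Nat.cast_nonneg _)) one_half_pos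
  have exponent : ((2 * k : ℕ) + 1 : ℝ) / 2 = k + 1 / 2 := by
    push_cast
    ring
  have power : ((1 : ℝ) / 2) ^ (-((2 * k : ℕ) + 1 : ℝ) / 2) = 2 ^ k * Real.sqrt 2 := by
    rw [neg_div, exponent, one_div, Real.inv_rpow two_pos.le, Real.rpow_neg two_pos.le, inv_inv,
      Real.rpow_add two_pos, Real.rpow_natCast, Real.sqrt_eq_rpow, one_div]
  simp only [Real.rpow_natCast, Real.rpow_two, exponent, power] at h
  rw [h]
  ring

lemma factorial_two_mul (k : ℕ) :
    (2 * k).factorial = 2 ^ k * k.factorial * (2 * k - 1).doubleFactorial := by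
  rw [← Nat.doubleFactorial_two_mul]
  cases k with
  | zero => rfl
  | succ k => exact Nat.factorial_eq_mul_doubleFactorial (2 * k + 1)

lemma integral_pow_two_mul_stdGauss (k : ℕ) :
    ∫ t : ℝ, t ^ (2 * k) ∂stdGauss = ((2 * k).factorial : ℝ) / (2 ^ k * (k.factorial : ℝ)) := by
  have half_line : ∫ t : ℝ, Real.exp (-t ^ 2 / 2) • t ^ (2 * k) =
      2 * ∫ t in Set.Ioi (0 : ℝ), t ^ (2 * k) * Real.exp (-(1 / 2) * t ^ 2) := by
    rw [← integral_comp_abs (f := fun t : ℝ => t ^ (2 * k) * Real.exp (-(1 / 2) * t ^ 2))]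
    refine integral_congr_ae (ae_of_all _ fun t => ?_)
    simp only [pow_mul, sq_abs, smul_eq_mul]
    ring_nf
  rw [integral_stdGauss, half_line, integral_pow_mul_exp_neg_sq, Real.Gamma_nat_add_half,
    factorial_two_mul, Real.sqrt_mul two_pos.le]
  push_cast
  rw [smul_eq_mul]
  have := Real.sqrt_pos.2 two_pos
  have := Real.sqrt_pos.2 Real.pi_pos
  field_simp

lemma integral_ofReal_pow_two_mul_stdGauss (k : ℕ) :
    ∫ t : ℝ, (t : ℂ) ^ (2 * k) ∂stdGauss =
      ((2 * k).factorial : ℂ) / (2 ^ k * (k.factorial : ℂ)) := by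
  simp only [← Complex.ofReal_pow, integral_complex_ofReal, integral_pow_two_mul_stdGauss]
  push_cast
  rfl

lemma sqrt_two_pi_inv_mul_cpow {a : ℂ} (ha : 0 < a.re) :
    ((Real.sqrt (2 * Real.pi))⁻¹ : ℂ) * (Real.pi / (a / 2)) ^ (1 / 2 : ℂ) =
      a ^ (-(1 / 2) : ℂ) := by
  have ha0 : a ≠ 0 := fun h => by simp [h] at ha
  have hpi : (0 : ℝ) < 2 * Real.pi := Real.two_pi_pos
  have split : (Real.pi / (a / 2) : ℂ) = ((2 * Real.pi : ℝ) : ℂ) * a⁻¹ := by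
    push_cast
    field_simp
  have arg_ne : a.arg ≠ Real.pi := fun h => by
    have := Complex.arg_eq_pi_iff.1 h
    linarith [this.1]
  have sqrt_eq : ((Real.sqrt (2 * Real.pi) : ℝ) : ℂ) =
      Complex.exp (Real.log (2 * Real.pi) * (1 / 2)) := by
    rw [Real.sqrt_eq_rpow, Real.rpow_def_of_pos hpi]
    push_cast
    rfl
  rw [split, Complex.cpow_def_of_ne_zero (mul_ne_zero (by exact_mod_cast hpi.ne')
    (inv_ne_zero ha0)), Complex.log_ofReal_mul hpi (inv_ne_zero ha0), Complex.log_inv _ arg_ne,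
    Complex.cpow_def_of_ne_zero ha0, sqrt_eq, ← Complex.exp_neg, ← Complex.exp_add]
  congr 1
  ring

lemma integral_cexp_quadratic_stdGauss {b : ℂ} (hb : b.re < 1) (β : ℂ) :
    ∫ t : ℝ, Complex.exp ((b * (t : ℂ) ^ 2 + 2 * β * t) / 2) ∂stdGauss =
      (1 - b) ^ (-(1 / 2) : ℂ) * Complex.exp (β ^ 2 / (1 - b) / 2) := by
  have re_pos : 0 < (1 - b).re := by
    rw [Complex.sub_re, Complex.one_re]
    linarith
  have one_sub_ne : 1 - b ≠ 0 := fun h => by simp [h] at re_pos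
  have complete : ∀ t : ℝ, Real.exp (-t ^ 2 / 2) •
      Complex.exp ((b * (t : ℂ) ^ 2 + 2 * β * t) / 2) =
        Complex.exp (-((1 - b) / 2) * (t : ℂ) ^ 2 + β * t + 0) := fun t => by
    rw [Complex.real_smul, Complex.ofReal_exp, ← Complex.exp_add]
    push_cast
    ring_nf
  rw [integral_stdGauss]
  simp only [complete]
  rw [integral_cexp_quadratic (by rw [Complex.neg_re, Complex.div_ofNat_re]; linarith),
    neg_neg, Complex.real_smul, Complex.ofReal_inv, ← mul_assoc, sqrt_two_pi_inv_mul_cpow re_pos]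
  congr 2
  field_simp
  ring

lemma integrable_exp_mul_sum_sq {ι : Type*} [Fintype ι] {θ : ℝ} (hθ : θ < 1 / 2) :
    Integrable (fun t : ι → ℝ => Real.exp (θ * ∑ i, t i ^ 2))
      (Measure.pi fun _ : ι => stdGauss) := by
  simpa only [Finset.mul_sum, Real.exp_sum] using
    Integrable.fintype_prod (μ := fun _ : ι => stdGauss)
      fun _ => integrable_exp_mul_sq_stdGauss hθ

lemma piFinSuccAbove_zero_symm_apply {α : Type*} [MeasurableSpace α] {n : ℕ}
    (p : α × (Fin n → α)) :
    (MeasurableEquiv.piFinSuccAbove (fun _ : Fin (n + 1) => α) 0).symm p = Fin.cons p.1 p.2 :=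
  Fin.insertNth_zero' _ _

lemma integral_pi_fin_succ {α E : Type*} [MeasurableSpace α] [NormedAddCommGroup E]
    [NormedSpace ℝ E] (μ : Measure α) [SigmaFinite μ] (n : ℕ) (F : (Fin (n + 1) → α) → E) :
    ∫ w, F w ∂(Measure.pi fun _ : Fin (n + 1) => μ) =
      ∫ p : α × (Fin n → α), F (Fin.cons p.1 p.2) ∂(μ.prod (Measure.pi fun _ : Fin n => μ)) := by
  rw [← (measurePreserving_piFinSuccAbove (fun _ : Fin (n + 1) => μ) 0).symm.integral_comp']
  simp only [piFinSuccAbove_zero_symm_apply]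

lemma integrable_pi_fin_succ_iff {α E : Type*} [MeasurableSpace α] [NormedAddCommGroup E]
    (μ : Measure α) [SigmaFinite μ] (n : ℕ) (F : (Fin (n + 1) → α) → E) :
    Integrable F (Measure.pi fun _ : Fin (n + 1) => μ) ↔
      Integrable (fun p : α × (Fin n → α) => F (Fin.cons p.1 p.2))
        (μ.prod (Measure.pi fun _ : Fin n => μ)) := by
  rw [← (measurePreserving_piFinSuccAbove (fun _ : Fin (n + 1) => μ) 0).symm.integrable_comp_emb
    (MeasurableEquiv.measurableEmbedding _)]
  simp only [Function.comp_def, piFinSuccAbove_zero_symm_apply]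

/-! ### Gaussian integrals of complex quadratic forms -/

/-- The quadratic form `∑ B_ij t_i t_j` of a complex matrix, on real vectors. -/
def quadForm {ι : Type*} [Fintype ι] (B : Matrix ι ι ℂ) (t : ι → ℝ) : ℂ :=
  ∑ i, ∑ j, B i j * t i * t j

lemma quadForm_smul {ι : Type*} [Fintype ι] (s : ℂ) (B : Matrix ι ι ℂ) (t : ι → ℝ) :
    quadForm (s • B) t = s * quadForm B t := by
  simp only [quadForm, Matrix.smul_apply, smul_eq_mul, mul_assoc, Finset.mul_sum]

lemma continuous_quadForm {ι : Type*} [Fintype ι] (B : Matrix ι ι ℂ) :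
    Continuous (quadForm B) := by
  unfold quadForm
  fun_prop

lemma quadForm_cons {n : ℕ} {B : Matrix (Fin (n + 1)) (Fin (n + 1)) ℂ} (hB : B.IsSymm)
    (x : ℝ) (t : Fin n → ℝ) :
    quadForm B (Fin.cons x t) = B 0 0 * x ^ 2 + 2 * (∑ i, B 0 i.succ * t i) * x +
      quadForm (B.submatrix Fin.succ Fin.succ) t := by
  have column : ∑ i : Fin n, B i.succ 0 * t i * x = (∑ i, B 0 i.succ * t i) * x := by
    simp only [hB.apply, Finset.sum_mul]
  have row : ∑ i : Fin n, B 0 i.succ * x * t i = (∑ i, B 0 i.succ * t i) * x := by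
    simp only [mul_right_comm _ (x : ℂ), Finset.sum_mul]
  simp only [quadForm, Fin.sum_univ_succ, Fin.cons_zero, Fin.cons_succ, Finset.sum_add_distrib,
    column, row, Matrix.submatrix_apply]
  ring

/-- The matrix `B'` for which integrating `exp(quadForm B / 2)` over the zeroth variable leaves a
multiple of `exp(quadForm B' / 2)`; `1 - B'` is the Schur complement of the corner of `1 - B`. -/
def eliminate {n : ℕ} (B : Matrix (Fin (n + 1)) (Fin (n + 1)) ℂ) : Matrix (Fin n) (Fin n) ℂ :=
  Matrix.of fun i j => B i.succ j.succ + B i.succ 0 * B 0 j.succ / (1 - B 0 0)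

section Eliminate

variable {n : ℕ} {B : Matrix (Fin (n + 1)) (Fin (n + 1)) ℂ}

lemma isSymm_eliminate (hB : B.IsSymm) : (eliminate B).IsSymm := by
  refine Matrix.IsSymm.ext fun i j => ?_
  simp only [eliminate, Matrix.of_apply, hB.apply i.succ j.succ, hB.apply 0 j.succ,
    hB.apply i.succ 0, mul_comm]

lemma quadForm_eliminate (hB : B.IsSymm) (t : Fin n → ℝ) :
    quadForm (eliminate B) t = quadForm (B.submatrix Fin.succ Fin.succ) t +
      (∑ i, B 0 i.succ * t i) ^ 2 / (1 - B 0 0) := by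
  simp only [quadForm, eliminate, Matrix.of_apply, Matrix.submatrix_apply, hB.apply 0 (Fin.succ _),
    add_mul, Finset.sum_add_distrib, sq, Finset.sum_mul_sum, Finset.sum_div]
  congr 1
  refine Finset.sum_congr rfl fun i _ => Finset.sum_congr rfl fun j _ => ?_
  ring

lemma det_one_sub_eq_mul_det_eliminate (hB : 1 - B 0 0 ≠ 0) :
    (1 - B).det = (1 - B 0 0) * (1 - eliminate B).det := by
  set c : Fin (n + 1) → ℂ := Fin.cons 0 fun i => -B i.succ 0 / (1 - B 0 0) with hc
  have row_zero : c 0 = 0 := rfl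
  set R : Matrix (Fin (n + 1)) (Fin (n + 1)) ℂ :=
    Matrix.of fun i j => (1 - B) i j - c i * (1 - B) 0 j with hR
  have corner : R 0 0 = 1 - B 0 0 := by simp [hR, row_zero]
  have column : ∀ i : Fin n, R i.succ 0 = 0 := fun i => by
    simp only [hR, hc, Matrix.of_apply, Matrix.sub_apply, Matrix.one_apply_eq, Fin.cons_succ,
      Matrix.one_apply_ne (Fin.succ_ne_zero i)]
    field_simp
    ring
  have minor : R.submatrix Fin.succ Fin.succ = 1 - eliminate B := by
    ext i j
    simp only [hR, hc, eliminate, Matrix.submatrix_apply, Matrix.of_apply, Matrix.sub_apply,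
      Fin.cons_succ, Matrix.one_apply, (Fin.succ_ne_zero j).symm, if_false, Fin.succ_inj]
    ring
  calc (1 - B).det = R.det := Matrix.det_eq_of_forall_row_eq_smul_add_const c 0 row_zero
        fun i j => by simp [hR, row_zero]
    _ = R 0 0 * (R.submatrix Fin.succ Fin.succ).det := by
        rw [Matrix.det_succ_column_zero, Fin.sum_univ_succ]
        simp [column, Fin.succAbove_zero]
    _ = (1 - B 0 0) * (1 - eliminate B).det := by rw [corner, minor]

variable {θ : ℝ}

lemma re_corner_le_of_re_quadForm_le (hB : ∀ t, (quadForm B t).re ≤ θ * ∑ i, t i ^ 2) :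
    (B 0 0).re ≤ θ := by
  simpa [quadForm, Fin.sum_univ_succ] using hB (Fin.cons 1 0)

lemma re_quadForm_eliminate_le (hB : B.IsSymm) (hθ : θ < 1)
    (hre : ∀ t, (quadForm B t).re ≤ θ * ∑ i, t i ^ 2) (t : Fin n → ℝ) :
    (quadForm (eliminate B) t).re ≤ θ * ∑ i, t i ^ 2 := by
  have corner : 0 < (1 - B 0 0).re := by
    rw [Complex.sub_re, Complex.one_re]
    linarith [re_corner_le_of_re_quadForm_le hre]
  have corner_ne : 1 - B 0 0 ≠ 0 := fun h => by simp [h] at corner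
  set q : ℂ := (∑ i, B 0 i.succ * t i) / (1 - B 0 0)
  have hβ : ∑ i, B 0 i.succ * (t i : ℂ) = q * (1 - B 0 0) := (div_mul_cancel₀ _ corner_ne).symm
  -- the stationary point of the quadratic polynomial in the eliminated variable is `q`
  have square : quadForm (eliminate B) t =
      quadForm B (Fin.cons q.re t) - ((q.re ^ 2 : ℝ) : ℂ) -
        ((q.im ^ 2 : ℝ) : ℂ) * (1 - B 0 0) := by
    have im_sq : (q - q.re) ^ 2 = -(q.im : ℂ) ^ 2 := by
      nth_rewrite 1 [← Complex.re_add_im q]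
      linear_combination (q.im : ℂ) ^ 2 * Complex.I_sq
    rw [quadForm_eliminate hB, quadForm_cons hB, hβ]
    push_cast
    field_simp
    linear_combination (1 - B 0 0) * im_sq
  have h := hre (Fin.cons q.re t)
  simp only [Fin.sum_univ_succ, Fin.cons_zero, Fin.cons_succ] at h
  rw [square, Complex.sub_re, Complex.sub_re, Complex.ofReal_re, Complex.re_ofReal_mul]
  nlinarith [mul_nonneg (sq_nonneg q.im) corner.le, mul_nonneg (sub_pos.2 hθ).le (sq_nonneg q.re)]

end Eliminate

lemma integrable_cexp_quadForm {ι : Type*} [Fintype ι] {B : Matrix ι ι ℂ} {θ : ℝ} (hθ : θ < 1)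
    (hre : ∀ t, (quadForm B t).re ≤ θ * ∑ i, t i ^ 2) :
    Integrable (fun t : ι → ℝ => Complex.exp (quadForm B t / 2))
      (Measure.pi fun _ : ι => stdGauss) := by
  refine (integrable_exp_mul_sum_sq (θ := θ / 2) (by linarith)).mono'
    (Continuous.aestronglyMeasurable (by have := continuous_quadForm B; fun_prop))
    (ae_of_all _ fun t => ?_)
  rw [Complex.norm_exp, Real.exp_le_exp, Complex.div_ofNat_re]
  linarith [hre t]

lemma integral_cexp_quadForm_succ {n : ℕ} {B : Matrix (Fin (n + 1)) (Fin (n + 1)) ℂ}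
    (hB : B.IsSymm) {θ : ℝ} (hθ : θ < 1) (hre : ∀ t, (quadForm B t).re ≤ θ * ∑ i, t i ^ 2) :
    ∫ t, Complex.exp (quadForm B t / 2) ∂(Measure.pi fun _ : Fin (n + 1) => stdGauss) =
      (1 - B 0 0) ^ (-(1 / 2) : ℂ) *
        ∫ t, Complex.exp (quadForm (eliminate B) t / 2)
          ∂(Measure.pi fun _ : Fin n => stdGauss) := by
  rw [integral_pi_fin_succ, integral_prod_symm _
    ((integrable_pi_fin_succ_iff _ _ _).1 (integrable_cexp_quadForm hθ hre)),
    ← integral_const_mul]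
  congr 1
  funext t
  simp only [quadForm_cons hB, add_div _ (quadForm _ t), Complex.exp_add]
  rw [integral_mul_const,
    integral_cexp_quadratic_stdGauss ((re_corner_le_of_re_quadForm_le hre).trans_lt hθ), mul_assoc,
    ← Complex.exp_add, quadForm_eliminate hB, add_div, add_comm (_ / 2)]

lemma sq_integral_cexp_quadForm_mul_det {n : ℕ} {B : Matrix (Fin n) (Fin n) ℂ} (hB : B.IsSymm)
    {θ : ℝ} (hθ : θ < 1) (hre : ∀ t, (quadForm B t).re ≤ θ * ∑ i, t i ^ 2) :
    (∫ t, Complex.exp (quadForm B t / 2) ∂(Measure.pi fun _ : Fin n => stdGauss)) ^ 2 *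
      (1 - B).det = 1 := by
  induction n with
  | zero => simp [quadForm]
  | succ n ih =>
    have corner_ne : 1 - B 0 0 ≠ 0 := fun h => by
      have := (re_corner_le_of_re_quadForm_le hre).trans_lt hθ
      rw [← sub_eq_zero.1 h, Complex.one_re] at this
      exact lt_irrefl _ this
    have cpow_sq : ((1 - B 0 0) ^ (-(1 / 2) : ℂ)) ^ 2 * (1 - B 0 0) = 1 := by
      rw [← Complex.cpow_nat_mul]
      norm_num [Complex.cpow_neg_one, inv_mul_cancel₀ corner_ne]
    rw [integral_cexp_quadForm_succ hB hθ hre, det_one_sub_eq_mul_det_eliminate corner_ne, mul_pow,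
      mul_mul_mul_comm, cpow_sq, one_mul,
      ih (isSymm_eliminate hB) (re_quadForm_eliminate_le hB hθ hre)]

/-- The branch of the square root is found by following `s ↦ det (1 - s B)` from `s = 0`. -/
lemma integral_cexp_quadForm {n : ℕ} {B : Matrix (Fin n) (Fin n) ℂ} (hB : B.IsSymm) {θ : ℝ}
    (hθ : θ < 1) (hquad : ∀ t, ‖quadForm B t‖ ≤ θ * ∑ i, t i ^ 2)
    (hslit : ∀ s ∈ Set.Icc (0 : ℝ) 1, (1 - (s : ℂ) • B).det ∈ Complex.slitPlane) :
    ∫ t, Complex.exp (quadForm B t / 2) ∂(Measure.pi fun _ : Fin n => stdGauss) =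
      (1 - B).det ^ (-(1 / 2) : ℂ) := by
  have re_le : ∀ s ∈ Set.Icc (0 : ℝ) 1, ∀ t,
      (quadForm ((s : ℂ) • B) t).re ≤ θ * ∑ i, t i ^ 2 := fun s hs t =>
    calc (quadForm ((s : ℂ) • B) t).re ≤ s * ‖quadForm B t‖ := by
          rw [quadForm_smul, Complex.re_ofReal_mul]
          exact mul_le_mul_of_nonneg_left (Complex.re_le_norm _) hs.1
      _ ≤ θ * ∑ i, t i ^ 2 := (mul_le_of_le_one_left (norm_nonneg _) hs.2).trans (hquad t)
  have integral_continuous : ContinuousOn (fun s : ℝ => ∫ t, Complex.exp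
      (quadForm ((s : ℂ) • B) t / 2) ∂(Measure.pi fun _ : Fin n => stdGauss)) (Set.Icc 0 1) := by
    refine continuousOn_of_dominated
      (bound := fun t => Real.exp (θ / 2 * ∑ i, t i ^ 2))
      (fun s hs => (integrable_cexp_quadForm hθ (re_le s hs)).aestronglyMeasurable)
      (fun s hs => ae_of_all _ fun t => ?_)
      (integrable_exp_mul_sum_sq (θ := θ / 2) (by linarith))
      (ae_of_all _ fun t => ?_)
    · rw [Complex.norm_exp, Real.exp_le_exp, Complex.div_ofNat_re]
      linarith [re_le s hs t]
    · simp only [quadForm_smul]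
      fun_prop
  have det_continuous : ContinuousOn (fun s : ℝ => (1 - (s : ℂ) • B).det ^ (-(1 / 2) : ℂ))
      (Set.Icc 0 1) :=
    (Continuous.matrix_det (by fun_prop)).continuousOn.cpow_const hslit
  have key := isPreconnected_Icc.eq_of_sq_eq integral_continuous det_continuous
    (fun s hs => ?_) (fun {s} hs h => ?_) (y := 0) (by simp) (by simp [quadForm])
  · simpa using key (Set.right_mem_Icc.2 zero_le_one)
  · have hsymm : ((s : ℂ) • B).IsSymm := by
      rw [Matrix.IsSymm, Matrix.transpose_smul, hB]
    simp only [Pi.pow_apply]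
    rw [← Complex.cpow_nat_mul, eq_div_of_mul_eq (Complex.slitPlane_ne_zero (hslit s hs))
      (sq_integral_cexp_quadForm_mul_det hsymm hθ (re_le s hs))]
    norm_num [Complex.cpow_neg_one]
  · exact Complex.slitPlane_ne_zero (hslit s hs) (Complex.cpow_eq_zero_iff _ _ |>.1 h).1

/-! ### Matrices close to the identity -/

section SmallMatrix

variable {ι : Type*} [Fintype ι] {B : Matrix ι ι ℂ} {δ : ℝ}

lemma norm_quadForm_le (hδ : 0 ≤ δ) (hB : ∀ i j, ‖B i j‖ ≤ δ) (t : ι → ℝ) :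
    ‖quadForm B t‖ ≤ Fintype.card ι * δ * ∑ i, t i ^ 2 :=
  calc ‖quadForm B t‖ ≤ ∑ i, ∑ j, δ * (|t i| * |t j|) := by
        refine norm_sum_le_of_le _ fun i _ => norm_sum_le_of_le _ fun j _ => ?_
        rw [norm_mul, norm_mul, Complex.norm_real, Complex.norm_real, mul_assoc]
        exact mul_le_mul_of_nonneg_right (hB i j) (by positivity)
    _ = δ * (∑ i, |t i|) ^ 2 := by
        rw [sq, Finset.sum_mul_sum]
        simp only [Finset.mul_sum]
    _ ≤ δ * (Fintype.card ι * ∑ i, t i ^ 2) := by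
        gcongr
        simpa using sq_sum_le_card_mul_sum_sq (s := Finset.univ) (f := fun i => |t i|)
    _ = Fintype.card ι * δ * ∑ i, t i ^ 2 := by ring

variable [DecidableEq ι]

omit [Fintype ι] in
lemma norm_one_sub_apply_le_one (hδ : δ ≤ 1) (hdiag : ∀ i, B i i = 0) (hB : ∀ i j, ‖B i j‖ ≤ δ)
    (i j : ι) : ‖(1 - B) i j‖ ≤ 1 := by
  rcases eq_or_ne i j with rfl | h
  · simp [hdiag]
  · simpa [Matrix.one_apply_ne h] using (hB i j).trans hδ

lemma norm_det_one_sub_sub_one_le (hδ₀ : 0 ≤ δ) (hδ₁ : δ ≤ 1) (hdiag : ∀ i, B i i = 0)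
    (hB : ∀ i j, ‖B i j‖ ≤ δ) : ‖(1 - B).det - 1‖ ≤ (Fintype.card ι).factorial * δ := by
  have leibniz : (1 - B).det - 1 = ∑ σ ∈ (Finset.univ : Finset (Equiv.Perm ι)).erase 1,
      Equiv.Perm.sign σ • ∏ i, (1 - B) (σ i) i := by
    rw [Matrix.det_apply, ← Finset.add_sum_erase _ _ (Finset.mem_univ 1)]
    simp [hdiag]
  have term_le : ∀ σ ∈ (Finset.univ : Finset (Equiv.Perm ι)).erase 1,
      ‖Equiv.Perm.sign σ • ∏ i, (1 - B) (σ i) i‖ ≤ δ := fun σ hσ => by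
    obtain ⟨i, hi⟩ : ∃ i, σ i ≠ i := by
      by_contra! h
      exact (Finset.mem_erase.1 hσ).1 (Equiv.ext h)
    have off_diag : ‖(1 - B) (σ i) i‖ ≤ δ := by
      simpa [Matrix.one_apply_ne hi] using hB (σ i) i
    calc ‖Equiv.Perm.sign σ • ∏ i, (1 - B) (σ i) i‖ = ∏ i, ‖(1 - B) (σ i) i‖ := by
          rcases Int.units_eq_one_or (Equiv.Perm.sign σ) with h | h <;> simp only [h, one_smul,
            Units.neg_smul, norm_neg, norm_prod]
      _ = ‖(1 - B) (σ i) i‖ * ∏ k ∈ Finset.univ.erase i, ‖(1 - B) (σ k) k‖ :=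
          (Finset.mul_prod_erase _ _ (Finset.mem_univ i)).symm
      _ ≤ δ * 1 := mul_le_mul off_diag (Finset.prod_le_one (fun _ _ => norm_nonneg _) fun k _ =>
          norm_one_sub_apply_le_one hδ₁ hdiag hB _ _) (by positivity) hδ₀
      _ = δ := mul_one δ
  calc ‖(1 - B).det - 1‖ ≤ ∑ _σ ∈ (Finset.univ : Finset (Equiv.Perm ι)).erase 1, δ :=
        leibniz ▸ norm_sum_le_of_le _ term_le
    _ ≤ ∑ _σ : Equiv.Perm ι, δ :=
        Finset.sum_le_sum_of_subset_of_nonneg (Finset.erase_subset _ _) fun _ _ _ => hδ₀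
    _ = (Fintype.card ι).factorial * δ := by
        rw [Finset.sum_const, nsmul_eq_mul, Finset.card_univ, Fintype.card_perm]

end SmallMatrix

lemma integral_cexp_quadForm_of_small {n : ℕ} {B : Matrix (Fin n) (Fin n) ℂ} {δ : ℝ}
    (hB : B.IsSymm) (hdiag : ∀ i, B i i = 0) (hδ₀ : 0 ≤ δ) (hδ₁ : δ ≤ 1) (hδn : n * δ < 1)
    (hδf : n.factorial * δ < 1) (hle : ∀ i j, ‖B i j‖ ≤ δ) :
    ∫ t, Complex.exp (quadForm B t / 2) ∂(Measure.pi fun _ : Fin n => stdGauss) =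
      (1 - B).det ^ (-(1 / 2) : ℂ) := by
  refine integral_cexp_quadForm hB hδn
    (by simpa only [Fintype.card_fin] using norm_quadForm_le hδ₀ hle) fun s hs => Or.inl ?_
  have smul_le : ∀ i j, ‖((s : ℂ) • B) i j‖ ≤ δ := fun i j => by
    rw [Matrix.smul_apply, norm_smul, Complex.norm_real, Real.norm_of_nonneg hs.1]
    exact (mul_le_of_le_one_left (norm_nonneg _) hs.2).trans (hle i j)
  have det_near := norm_det_one_sub_sub_one_le hδ₀ hδ₁ (fun i => by simp [hdiag]) smul_le
  rw [Fintype.card_fin] at det_near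
  have re_near := (Complex.abs_re_le_norm _).trans_lt (det_near.trans_lt hδf)
  rw [Complex.sub_re, Complex.one_re] at re_near
  linarith [(abs_lt.1 re_near).1]

/-! ### Test functions on shifted contours -/

section TestFunctions

variable {ι : Type} [Fintype ι] {F : (ι → ℂ) → ℂ} {k : ℕ} {B : ℝ}

lemma SeminormLE.nonneg (hF : SeminormLE k B F) : 0 ≤ B :=
  le_trans (by positivity) (hF 0 (by simp))

lemma SeminormLE.norm_le (hF : SeminormLE k B F) {z : ι → ℂ} (hz : ∀ a, |(z a).im| ≤ k) {r : ℝ}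
    (hr₀ : 0 ≤ r) (hr : r ≤ ‖z‖) : ‖F z‖ ≤ B * ((1 + r) ^ k)⁻¹ := by
  rw [← div_eq_mul_inv, le_div_iff₀' (by positivity)]
  exact le_trans (by gcongr) (hF z hz)

end TestFunctions

lemma integrable_inv_one_add_norm_pow {E : Type*} [NormedAddCommGroup E] [NormedSpace ℝ E]
    [FiniteDimensional ℝ E] [MeasurableSpace E] [BorelSpace E] (μ : Measure E)
    [μ.IsAddHaarMeasure] {k : ℕ} (hk : Module.finrank ℝ E < k) :
    Integrable (fun x : E => ((1 + ‖x‖) ^ k)⁻¹) μ := by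
  convert integrable_one_add_norm (μ := μ) (r := k) (by exact_mod_cast hk) using 2 with x
  rw [Real.rpow_neg (by positivity), Real.rpow_natCast]

lemma re_timeShift (y : ℝ) (x : Fin 4 → ℝ) (μ : Fin 4) : (timeShift y x μ).re = x μ := by
  unfold timeShift
  split_ifs <;> simp

lemma abs_im_timeShift_le (y : ℝ) (x : Fin 4 → ℝ) (μ : Fin 4) : |(timeShift y x μ).im| ≤ |y| := by
  unfold timeShift
  split_ifs <;> simp

lemma norm_le_norm_timeShift (y : ℝ) (x : Fin 4 → ℝ) : ‖x‖ ≤ ‖timeShift y x‖ :=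
  (pi_norm_le_iff_of_nonneg (norm_nonneg _)).2 fun μ =>
    calc ‖x μ‖ = |(timeShift y x μ).re| := by rw [re_timeShift, Real.norm_eq_abs]
      _ ≤ ‖timeShift y x‖ := (Complex.abs_re_le_norm _).trans (norm_le_pi_norm _ μ)

lemma timeShift_cons (y s : ℝ) (x : Fin 3 → ℝ) :
    timeShift y (Fin.cons s x) = Fin.cons ((s : ℂ) + y * Complex.I) (fun i => (x i : ℂ)) := by
  funext μ
  refine Fin.cases ?_ (fun i => ?_) μ
  · simp [timeShift]
  · simp [timeShift, Fin.succ_ne_zero]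

lemma integrable_comp_timeShift {f : (Fin 4 → ℂ) → ℂ} (hf : f ∈ testSpace (Fin 4)) (y : ℝ) :
    Integrable (fun x : Fin 4 → ℝ => f (timeShift y x)) := by
  obtain ⟨k, hk⟩ := exists_nat_ge (max |y| 5)
  obtain ⟨B, hB⟩ := hf.2 k
  have dim_lt : 4 < k := by exact_mod_cast (le_max_right _ _).trans hk
  refine ((integrable_inv_one_add_norm_pow volume (k := k) (by simpa)).const_mul B).mono'
    (hf.1.continuous.comp (continuous_timeShift y)).aestronglyMeasurable
    (ae_of_all _ fun x => hB.norm_le (fun μ => ?_) (norm_nonneg x) (norm_le_norm_timeShift y x))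
  exact (abs_im_timeShift_le y x μ).trans ((le_max_left _ _).trans hk)

lemma tendsto_integral_vertical_segment {h : ℂ → ℂ} {y C : ℝ}
    (hb : ∀ x v : ℝ, |v| ≤ |y| → ‖h (x + v * Complex.I)‖ ≤ C * (1 + x ^ 2)⁻¹) {s : ℝ}
    (hs : s ^ 2 = 1) :
    Tendsto (fun T : ℝ => ∫ v in (0 : ℝ)..y, h ((s * T : ℝ) + v * Complex.I)) atTop (𝓝 0) := by
  have decay : Tendsto (fun T : ℝ => (1 + T ^ 2)⁻¹) atTop (𝓝 0) :=
    tendsto_inv_atTop_zero.comp (tendsto_atTop_add_const_left _ _ (tendsto_pow_atTop two_ne_zero))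
  refine squeeze_zero_norm (fun T => ?_)
    (by simpa only [mul_zero, zero_mul] using (decay.const_mul C).mul_const |y - 0|)
  refine intervalIntegral.norm_integral_le_of_norm_le_const fun v hv => ?_
  have hv' : |v| ≤ |y| := by
    simpa using Set.abs_sub_left_of_mem_uIcc (Set.uIoc_subset_uIcc hv)
  simpa only [mul_pow, hs, one_mul] using hb (s * T) v hv'

lemma integral_eq_integral_add_mul_I {h : ℂ → ℂ} (hd : Differentiable ℂ h) (y C : ℝ)
    (hb : ∀ x v : ℝ, |v| ≤ |y| → ‖h (x + v * Complex.I)‖ ≤ C * (1 + x ^ 2)⁻¹) :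
    ∫ x : ℝ, h x = ∫ x : ℝ, h (x + y * Complex.I) := by
  have horizontal : ∀ v : ℝ, |v| ≤ |y| → Tendsto (fun T : ℝ =>
      ∫ x in (-T)..T, h (x + v * Complex.I)) atTop (𝓝 (∫ x : ℝ, h (x + v * Complex.I))) :=
    fun v hv => intervalIntegral_tendsto_integral
      ((integrable_inv_one_add_sq.const_mul C).mono'
        (hd.continuous.comp (by fun_prop)).aestronglyMeasurable (ae_of_all _ fun x => hb x v hv))
      tendsto_neg_atTop_atBot tendsto_id
  have cauchy : ∀ T : ℝ, (∫ x in (-T)..T, h (x + (0 : ℝ) * Complex.I)) -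
      (∫ x in (-T)..T, h (x + y * Complex.I)) +
      Complex.I • (∫ v in (0 : ℝ)..y, h ((1 * T : ℝ) + v * Complex.I)) -
      Complex.I • (∫ v in (0 : ℝ)..y, h ((-1 * T : ℝ) + v * Complex.I)) = 0 := fun T => by
    simpa using Complex.integral_boundary_rect_eq_zero_of_differentiableOn h (-T : ℂ)
      (T + y * Complex.I) hd.differentiableOn
  have limit := (((horizontal 0 (by simp)).sub (horizontal y le_rfl)).add
    ((tendsto_integral_vertical_segment hb (one_pow 2)).const_smul Complex.I)).sub
    ((tendsto_integral_vertical_segment hb (neg_one_sq (R := ℝ))).const_smul Complex.I)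
  simp only [cauchy, smul_zero, add_zero, sub_zero] at limit
  simpa using sub_eq_zero.1 (tendsto_nhds_unique limit tendsto_const_nhds)

lemma norm_exp_minkowski_timeShift (p : Fin 4 → ℝ) (y : ℝ) (x : Fin 4 → ℝ) :
    ‖Complex.exp (-Complex.I * minkowski p (timeShift y x))‖ = Real.exp (p 0 * y) := by
  rw [Complex.norm_exp]
  congr 1
  simp [minkowski, timeShift, Fin.sum_univ_succ, Complex.mul_re, Complex.mul_im,
    Fin.succ_ne_zero]

section FourierTransform

variable {f : (Fin 4 → ℂ) → ℂ} (p : Fin 4 → ℝ)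

lemma integrable_comp_timeShift_mul_exp (hf : f ∈ testSpace (Fin 4)) (y : ℝ) :
    Integrable (fun x : Fin 4 → ℝ =>
      f (timeShift y x) * Complex.exp (-Complex.I * minkowski p (timeShift y x))) := by
  refine (integrable_comp_timeShift hf y).mul_bdd (c := Real.exp (p 0 * y)) ?_
    (ae_of_all _ fun x => (norm_exp_minkowski_timeShift p y x).le)
  unfold minkowski
  exact Measurable.aestronglyMeasurable (by fun_prop)

lemma differentiable_cons_mul_exp (hf : Differentiable ℂ f) (x : Fin 3 → ℂ) :
    Differentiable ℂ fun ζ : ℂ =>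
      f (Fin.cons ζ x) * Complex.exp (-Complex.I * minkowski p (Fin.cons ζ x)) := by
  have cons : Differentiable ℂ fun ζ : ℂ => (Fin.cons ζ x : Fin 4 → ℂ) :=
    differentiable_pi.2 (Fin.cases differentiable_id fun i => differentiable_const (x i))
  refine (hf.comp cons).mul (Differentiable.cexp ?_)
  simp only [minkowski, Fin.cons_zero, Fin.cons_succ]
  fun_prop

lemma norm_comp_timeShift_cons_mul_exp_le {k : ℕ} {B : ℝ} (hB : SeminormLE k B f) (hk : 2 ≤ k)
    {y v : ℝ} (hy : |y| ≤ k) (hv : |v| ≤ |y|) (s : ℝ) (x : Fin 3 → ℝ) :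
    ‖f (timeShift v (Fin.cons s x)) *
        Complex.exp (-Complex.I * minkowski p (timeShift v (Fin.cons s x)))‖ ≤
      B * Real.exp (|p 0| * |y|) * (1 + s ^ 2)⁻¹ := by
  have wave_le : Real.exp (p 0 * v) ≤ Real.exp (|p 0| * |y|) :=
    Real.exp_le_exp.2 ((le_abs_self _).trans (by rw [abs_mul]; gcongr))
  have test_le : ‖f (timeShift v (Fin.cons s x))‖ ≤ B * ((1 + |s|) ^ k)⁻¹ :=
    hB.norm_le (fun μ => (abs_im_timeShift_le _ _ μ).trans (hv.trans hy)) (abs_nonneg s)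
      ((norm_le_pi_norm (Fin.cons s x : Fin 4 → ℝ) 0).trans (norm_le_norm_timeShift _ _))
  have decay : 1 + s ^ 2 ≤ (1 + |s|) ^ k :=
    calc 1 + s ^ 2 ≤ (1 + |s|) ^ 2 := by nlinarith [sq_abs s, abs_nonneg s]
      _ ≤ (1 + |s|) ^ k := pow_le_pow_right₀ (by linarith [abs_nonneg s]) hk
  have := hB.nonneg
  rw [norm_mul, norm_exp_minkowski_timeShift, mul_right_comm]
  exact mul_le_mul (test_le.trans (by gcongr)) wave_le (Real.exp_pos _).le (by positivity)

lemma fourier4_eq_integral_timeShift (hf : f ∈ testSpace (Fin 4)) (y : ℝ) :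
    fourier4 f p = ((2 * (Real.pi : ℂ)) ^ 2)⁻¹ * ∫ x : Fin 4 → ℝ,
      f (timeShift y x) * Complex.exp (-Complex.I * minkowski p (timeShift y x)) := by
  have real_points : ∀ x : Fin 4 → ℝ, (fun μ => (x μ : ℂ)) = timeShift 0 x := fun x => by
    funext μ
    simp [timeShift]
  have integrable_cons := fun v => (integrable_pi_fin_succ_iff (volume : Measure ℝ) 3 _).1
    (integrable_comp_timeShift_mul_exp p hf v)
  obtain ⟨k, hk⟩ := exists_nat_ge (max |y| 2)
  obtain ⟨B, hB⟩ := hf.2 k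
  have hk2 : 2 ≤ k := by exact_mod_cast (le_max_right _ _).trans hk
  simp only [fourier4, real_points]
  rw [volume_pi, integral_pi_fin_succ, integral_pi_fin_succ,
    integral_prod_symm _ (integrable_cons 0), integral_prod_symm _ (integrable_cons y)]
  congr 2
  funext x
  have shift := integral_eq_integral_add_mul_I
    (differentiable_cons_mul_exp p hf.1 fun i => (x i : ℂ)) y (B * Real.exp (|p 0| * |y|))
    fun s v hv => by
      simpa only [timeShift_cons] using
        norm_comp_timeShift_cons_mul_exp_le p hB hk2 ((le_max_left _ _).trans hk) hv s x
  simpa only [timeShift_cons, Complex.ofReal_zero, zero_mul, add_zero] using shift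

end FourierTransform

/-! ### Gaussian superpositions of coherent vectors -/

/-- A classical source of the field, concentrated at one point: its real amplitude, which will be
a Gaussian variable, and the real part of its position. -/
abbrev Source : Type := ℝ × (Fin 4 → ℝ)

/-- The standard Gaussian measure in the amplitude times Lebesgue measure in the position. -/
def sourceMeasure : Measure Source := stdGauss.prod volume

instance : SigmaFinite sourceMeasure := by
  unfold sourceMeasure
  infer_instance

/-- The law of `n` independent sources. -/
abbrev sourceMeasures (n : ℕ) : Measure (Fin n → Source) := Measure.pi fun _ => sourceMeasure

section Sources

variable {ι : Type*} [Fintype ι]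

/-- The one-particle function of the coherent vector created by the sources `w`, where the source
`i` is coupled with strength `c i` and moved to the imaginary time `y i`. -/
def sourceField (m : ℝ) (c : ι → ℂ) (y : ι → ℝ) (w : ι → Source) (ξ : R3) : ℂ :=
  fieldConst * ∑ i, c i * (w i).1 * planeWave m ξ (timeShift (y i) (w i).2)

/-- The contraction of the field at `z` with the sources `w`. -/
def contraction (m : ℝ) (c : ι → ℂ) (y : ι → ℝ) (w : ι → Source) (z : Fin 4 → ℂ) : ℂ :=
  ∑ i, c i * (w i).1 * twoPoint m (z - timeShift (y i) (w i).2)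

/-- The sum of the contractions of all pairs of sources. -/
def interaction [LinearOrder ι] (m : ℝ) (c : ι → ℂ) (y : ι → ℝ) (w : ι → Source) : ℂ :=
  ∑ i, ∑ k, if i < k then c i * (w i).1 * (c k * (w k).1 *
    twoPoint m (timeShift (y i) (w i).2 - timeShift (y k) (w k).2)) else 0

/-- The weight with which the coherent vector of the sources `w` enters the superposition: the
product of the test functions with the exponential of the interaction. -/
def sourceWeight [LinearOrder ι] (m : ℝ) (c : ι → ℂ) (f : ι → (Fin 4 → ℂ) → ℂ) (y : ι → ℝ)
    (w : ι → Source) : ℂ :=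
  (∏ i, f i (timeShift (y i) (w i).2)) * Complex.exp (interaction m c y w)

/-- The `N`-particle function of the Gaussian superposition of coherent vectors that represents
a product of Wick exponentials applied to the vacuum. -/
def sourceState (m : ℝ) {n : ℕ} (c : Fin n → ℂ) (f : Fin n → (Fin 4 → ℂ) → ℂ) (y : Fin n → ℝ)
    (N : ℕ) (ξ : Fin N → R3) : ℂ :=
  ∫ w, sourceWeight m c f y w *
    (((Real.sqrt N.factorial)⁻¹ : ℝ) * ∏ a, sourceField m c y w (ξ a)) ∂(sourceMeasures n)

/-- The sum of the absolute values of the amplitudes. -/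
def totalAmp (w : ι → Source) : ℝ := ∑ i, |(w i).1|

/-- The product of the absolute values of the test functions on the contours. -/
def testBound (f : ι → (Fin 4 → ℂ) → ℂ) (y : ι → ℝ) (w : ι → Source) : ℝ :=
  ∏ i, ‖f i (timeShift (y i) (w i).2)‖

/-- A bound of the interaction of two sources of unit amplitude: `C` bounds the couplings and `L`
is a lower bound of the separation in imaginary time. -/
def pairBound (C L : ℝ) : ℝ := C ^ 2 * (fieldConst ^ 2 * (shellConst / L ^ 2))

@[fun_prop]
lemma measurable_sourceField {α : Type*} [MeasurableSpace α] {m : ℝ} {c : ι → ℂ} {y : ι → ℝ}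
    {w : α → ι → Source} {ξ : α → R3} (hw : Measurable w) (hξ : Measurable ξ) :
    Measurable (fun a => sourceField m c y (w a) (ξ a)) := by
  unfold sourceField
  fun_prop

@[fun_prop]
lemma measurable_contraction {α : Type*} [MeasurableSpace α] {m : ℝ} {c : ι → ℂ} {y : ι → ℝ}
    {w : α → ι → Source} {z : α → Fin 4 → ℂ} (hw : Measurable w) (hz : Measurable z) :
    Measurable (fun a => contraction m c y (w a) (z a)) := by
  unfold contraction
  fun_prop

lemma measurable_sourceWeight [LinearOrder ι] (m : ℝ) (c : ι → ℂ) {f : ι → (Fin 4 → ℂ) → ℂ}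
    (hf : ∀ i, f i ∈ testSpace (Fin 4)) (y : ι → ℝ) : Measurable (sourceWeight m c f y) := by
  have measurable_f : ∀ i, Measurable (f i) := fun i => (hf i).1.continuous.measurable
  have measurable_interaction : Measurable (interaction m c y) := by
    unfold interaction
    refine Finset.measurable_sum _ fun i _ => Finset.measurable_sum _ fun k _ => ?_
    split_ifs <;> fun_prop
  unfold sourceWeight
  fun_prop

@[fun_prop]
lemma measurable_totalAmp : Measurable (totalAmp (ι := ι)) := by
  unfold totalAmp
  fun_prop

lemma measurable_testBound {f : ι → (Fin 4 → ℂ) → ℂ} (hf : ∀ i, f i ∈ testSpace (Fin 4))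
    (y : ι → ℝ) : Measurable (testBound f y) :=
  Finset.measurable_prod _ fun i _ => ((hf i).1.continuous.measurable.comp (by fun_prop)).norm

lemma totalAmp_nonneg (w : ι → Source) : 0 ≤ totalAmp w :=
  Finset.sum_nonneg fun _ _ => abs_nonneg _

lemma testBound_nonneg (f : ι → (Fin 4 → ℂ) → ℂ) (y : ι → ℝ) (w : ι → Source) :
    0 ≤ testBound f y w :=
  Finset.prod_nonneg fun _ _ => norm_nonneg _

lemma pairBound_nonneg (C L : ℝ) : 0 ≤ pairBound C L := by
  have := shellConst_nonneg
  unfold pairBound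
  positivity

lemma totalAmp_sq_le (w : ι → Source) : totalAmp w ^ 2 ≤ Fintype.card ι * ∑ i, (w i).1 ^ 2 := by
  simpa [totalAmp] using sq_sum_le_card_mul_sum_sq (s := Finset.univ) (f := fun i => |(w i).1|)

end Sources

section Succ

variable (m : ℝ) {n : ℕ} (c : Fin (n + 1) → ℂ) (f : Fin (n + 1) → (Fin 4 → ℂ) → ℂ)
  (y : Fin (n + 1) → ℝ) (w : Fin (n + 1) → Source)

lemma totalAmp_succ : totalAmp w = |(w 0).1| + totalAmp (Fin.tail w) :=
  Fin.sum_univ_succ _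

lemma testBound_succ :
    testBound f y w =
      ‖f 0 (timeShift (y 0) (w 0).2)‖ * testBound (Fin.tail f) (Fin.tail y) (Fin.tail w) :=
  Fin.prod_univ_succ _

lemma sourceField_succ (ξ : R3) :
    sourceField m c y w ξ =
      c 0 * (w 0).1 * (fieldConst * planeWave m ξ (timeShift (y 0) (w 0).2)) +
        sourceField m (Fin.tail c) (Fin.tail y) (Fin.tail w) ξ := by
  simp only [sourceField, Fin.sum_univ_succ, Fin.tail]
  ring

lemma interaction_succ :
    interaction m c y w =
      c 0 * (w 0).1 *
        contraction m (Fin.tail c) (Fin.tail y) (Fin.tail w) (timeShift (y 0) (w 0).2) +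
        interaction m (Fin.tail c) (Fin.tail y) (Fin.tail w) := by
  simp only [interaction, contraction, Fin.sum_univ_succ, Fin.tail, if_false, Fin.succ_pos,
    if_true, Fin.not_lt_zero, Fin.succ_lt_succ_iff, zero_add, Finset.mul_sum]

lemma sourceWeight_succ :
    sourceWeight m c f y w =
      f 0 (timeShift (y 0) (w 0).2) *
        sourceWeight m (Fin.tail c) (Fin.tail f) (Fin.tail y) (Fin.tail w) *
        Complex.exp (c 0 * (w 0).1 *
          contraction m (Fin.tail c) (Fin.tail y) (Fin.tail w) (timeShift (y 0) (w 0).2)) := by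
  simp only [sourceWeight, interaction_succ, Fin.prod_univ_succ, Fin.tail, Complex.exp_add]
  ring

end Succ

section Bounds

variable {ι : Type*} [Fintype ι] (m : ℝ) {c : ι → ℂ} {y : ι → ℝ} {C L : ℝ}

lemma norm_sourceField_le (hC : ∀ i, ‖c i‖ ≤ C) {y₀ : ℝ} (hy : ∀ i, y₀ ≤ y i) (w : ι → Source)
    (ξ : R3) :
    ‖sourceField m c y w ξ‖ ≤ Real.exp (-(y₀ * energy m ξ)) * (fieldConst * C * totalAmp w) := by
  have term_le : ∀ i, ‖c i * ((w i).1 : ℂ) * planeWave m ξ (timeShift (y i) (w i).2)‖ ≤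
      C * |(w i).1| * Real.exp (-(y₀ * energy m ξ)) := fun i => by
    rw [norm_mul, norm_mul, Complex.norm_real, Real.norm_eq_abs, norm_planeWave_timeShift]
    have := energy_nonneg m ξ
    have := (norm_nonneg _).trans (hC i)
    gcongr
    exacts [hC i, hy i]
  calc ‖sourceField m c y w ξ‖
      ≤ fieldConst * ∑ i, C * |(w i).1| * Real.exp (-(y₀ * energy m ξ)) := by
        rw [sourceField, norm_mul, Complex.norm_real, Real.norm_of_nonneg fieldConst_nonneg]
        exact mul_le_mul_of_nonneg_left (norm_sum_le_of_le _ fun i _ => term_le i)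
          fieldConst_nonneg
    _ = Real.exp (-(y₀ * energy m ξ)) * (fieldConst * C * totalAmp w) := by
        rw [← Finset.sum_mul, ← Finset.mul_sum, totalAmp]
        ring

lemma norm_pair_le {c₁ c₂ : ℂ} (h₁ : ‖c₁‖ ≤ C) (h₂ : ‖c₂‖ ≤ C) (hL : 0 < L) {y₁ y₂ : ℝ}
    (hy : L ≤ y₂ - y₁) (w₁ w₂ : Source) :
    ‖c₁ * w₁.1 * (c₂ * w₂.1 * twoPoint m (timeShift y₁ w₁.2 - timeShift y₂ w₂.2))‖ ≤
      pairBound C L * (|w₁.1| * |w₂.1|) := by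
  have := (norm_nonneg _).trans h₁
  simp only [norm_mul, Complex.norm_real, Real.norm_eq_abs]
  calc _ ≤ C * |w₁.1| * (C * |w₂.1| * (fieldConst ^ 2 * (shellConst / L ^ 2))) := by
        gcongr
        exact norm_twoPoint_le m hL hy w₁.2 w₂.2
    _ = pairBound C L * (|w₁.1| * |w₂.1|) := by
        rw [pairBound]
        ring

lemma norm_mul_contraction_le {c₀ : ℂ} (hc₀ : ‖c₀‖ ≤ C) (hC : ∀ i, ‖c i‖ ≤ C) (hL : 0 < L)
    {y₀ : ℝ} (hy : ∀ i, L ≤ y i - y₀) (w₀ : Source) (w : ι → Source) :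
    ‖c₀ * w₀.1 * contraction m c y w (timeShift y₀ w₀.2)‖ ≤
      pairBound C L * (|w₀.1| * totalAmp w) := by
  rw [contraction, totalAmp, Finset.mul_sum, Finset.mul_sum, Finset.mul_sum]
  exact norm_sum_le_of_le _ fun i _ => norm_pair_le m hc₀ (hC i) hL (hy i) w₀ (w i)

variable [LinearOrder ι]

lemma norm_interaction_le (hC : ∀ i, ‖c i‖ ≤ C) (hL : 0 < L) (hy : ∀ i k, i < k → L ≤ y k - y i)
    (w : ι → Source) : ‖interaction m c y w‖ ≤ pairBound C L * totalAmp w ^ 2 := by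
  rw [totalAmp, sq, Finset.sum_mul_sum]
  simp only [Finset.mul_sum]
  refine norm_sum_le_of_le _ fun i _ => norm_sum_le_of_le _ fun k _ => ?_
  split_ifs with h
  · exact norm_pair_le m (hC i) (hC k) hL (hy i k h) (w i) (w k)
  · rw [norm_zero]
    have := pairBound_nonneg C L
    positivity

lemma norm_sourceWeight_le (hC : ∀ i, ‖c i‖ ≤ C) (hL : 0 < L) (hy : ∀ i k, i < k → L ≤ y k - y i)
    (f : ι → (Fin 4 → ℂ) → ℂ) (w : ι → Source) :
    ‖sourceWeight m c f y w‖ ≤ testBound f y w * Real.exp (pairBound C L * totalAmp w ^ 2) := by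
  rw [sourceWeight, norm_mul, norm_prod, Complex.norm_exp, testBound]
  gcongr
  exact (Complex.re_le_norm _).trans (norm_interaction_le m hC hL hy w)

end Bounds

lemma pow_le_const_mul_exp (M : ℕ) {θ : ℝ} (hθ : 0 < θ) :
    ∃ K : ℝ, ∀ τ : ℝ, 0 ≤ τ → τ ^ M ≤ K * Real.exp (θ * τ ^ 2) := by
  refine ⟨M.factorial * Real.exp ((4 * θ)⁻¹), fun τ hτ => ?_⟩
  have exponent_le : τ ≤ (4 * θ)⁻¹ + θ * τ ^ 2 := by
    have square : (4 * θ)⁻¹ + θ * τ ^ 2 - τ = θ * (τ - (2 * θ)⁻¹) ^ 2 := by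
      field_simp
      ring
    linarith [mul_nonneg hθ.le (sq_nonneg (τ - (2 * θ)⁻¹))]
  calc τ ^ M ≤ M.factorial * Real.exp τ :=
        (div_le_iff₀' (by positivity)).1 (Real.pow_div_factorial_le_exp τ hτ M)
    _ ≤ M.factorial * Real.exp ((4 * θ)⁻¹ + θ * τ ^ 2) := by gcongr
    _ = M.factorial * Real.exp ((4 * θ)⁻¹) * Real.exp (θ * τ ^ 2) := by
        rw [Real.exp_add, mul_assoc]

section Integrability

variable {ι : Type*} [Fintype ι] {f : ι → (Fin 4 → ℂ) → ℂ} {b : ℝ}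

lemma integrable_testBound_mul_exp_sum (hf : ∀ i, f i ∈ testSpace (Fin 4)) (y : ι → ℝ) {θ : ℝ}
    (hθ : θ < 1 / 2) :
    Integrable (fun w => testBound f y w * Real.exp (θ * ∑ i, (w i).1 ^ 2))
      (Measure.pi fun _ : ι => sourceMeasure) := by
  have one_source : ∀ i, Integrable
      (fun s : Source => Real.exp (θ * s.1 ^ 2) * ‖f i (timeShift (y i) s.2)‖) sourceMeasure :=
    fun i => (integrable_exp_mul_sq_stdGauss hθ).mul_prod
      (integrable_comp_timeShift (hf i) (y i)).norm
  refine (Integrable.fintype_prod (μ := fun _ : ι => sourceMeasure) one_source).congr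
    (ae_of_all _ fun w => ?_)
  simp only [testBound, Finset.prod_mul_distrib, Finset.mul_sum, Real.exp_sum, mul_comm]

lemma integrable_testBound_mul_exp (hf : ∀ i, f i ∈ testSpace (Fin 4)) (y : ι → ℝ) (hb₀ : 0 ≤ b)
    (hb : Fintype.card ι * b < 1 / 2) :
    Integrable (fun w => testBound f y w * Real.exp (b * totalAmp w ^ 2))
      (Measure.pi fun _ : ι => sourceMeasure) := by
  have measurable := measurable_testBound hf y
  refine (integrable_testBound_mul_exp_sum hf y hb).mono'
    (Measurable.aestronglyMeasurable (by fun_prop)) (ae_of_all _ fun w => ?_)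
  have nonneg := testBound_nonneg f y w
  rw [Real.norm_of_nonneg (by positivity), mul_comm (Fintype.card ι : ℝ), mul_assoc]
  gcongr
  exact totalAmp_sq_le w

lemma integrable_testBound_mul_exp_mul_pow (hf : ∀ i, f i ∈ testSpace (Fin 4)) (y : ι → ℝ)
    (hb₀ : 0 ≤ b) (hb : Fintype.card ι * b < 1 / 2) (M : ℕ) :
    Integrable (fun w => testBound f y w * Real.exp (b * totalAmp w ^ 2) * totalAmp w ^ M)
      (Measure.pi fun _ : ι => sourceMeasure) := by
  obtain ⟨b', hbb', hb'⟩ : ∃ b' : ℝ, b < b' ∧ Fintype.card ι * b' < 1 / 2 := by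
    have near : ∀ᶠ b' : ℝ in 𝓝[>] b, Fintype.card ι * b' < 1 / 2 :=
      (Continuous.tendsto (by fun_prop) b).mono_left nhdsWithin_le_nhds |>.eventually_lt_const hb
    exact ((eventually_mem_nhdsWithin (s := Set.Ioi b)).and near).exists
  obtain ⟨K, hK⟩ := pow_le_const_mul_exp M (sub_pos.2 hbb')
  have measurable := measurable_testBound hf y
  refine ((integrable_testBound_mul_exp hf y (hb₀.trans hbb'.le) hb').const_mul K).mono'
    (Measurable.aestronglyMeasurable (by fun_prop)) (ae_of_all _ fun w => ?_)
  have nonneg := testBound_nonneg f y w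
  have amp_nonneg := totalAmp_nonneg w
  rw [Real.norm_of_nonneg (by positivity)]
  calc testBound f y w * Real.exp (b * totalAmp w ^ 2) * totalAmp w ^ M
      ≤ testBound f y w * Real.exp (b * totalAmp w ^ 2) *
          (K * Real.exp ((b' - b) * totalAmp w ^ 2)) := by gcongr; exact hK _ amp_nonneg
    _ = K * (testBound f y w * Real.exp (b' * totalAmp w ^ 2)) := by
        rw [show b' * totalAmp w ^ 2 = b * totalAmp w ^ 2 + (b' - b) * totalAmp w ^ 2 by ring,
          Real.exp_add]
        ring

end Integrability

/-! ### Rearranging momenta -/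

section Rearranging

variable {α : Type*} [MeasurableSpace α] (μ : Measure α) [SigmaFinite μ]

lemma measurePreserving_fin_append (j k : ℕ) :
    MeasurePreserving (fun p : (Fin j → α) × (Fin k → α) => Fin.append p.1 p.2)
      ((Measure.pi fun _ => μ).prod (Measure.pi fun _ => μ)) (Measure.pi fun _ => μ) := by
  have measurable_append :
      Measurable (fun p : (Fin j → α) × (Fin k → α) => Fin.append p.1 p.2) := by
    refine measurable_pi_lambda _ fun i => ?_
    refine Fin.addCases (fun a => ?_) (fun a => ?_) i
    · simp only [Fin.append_left]
      fun_prop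
    · simp only [Fin.append_right]
      fun_prop
  refine ⟨measurable_append, (Measure.pi_eq fun s hs => ?_).symm⟩
  have preimage_box : (fun p : (Fin j → α) × (Fin k → α) => Fin.append p.1 p.2) ⁻¹' Set.univ.pi s =
      (Set.univ.pi fun a => s (Fin.castAdd k a)) ×ˢ (Set.univ.pi fun a => s (Fin.natAdd j a)) := by
    ext p
    simp only [Set.mem_preimage, Set.mem_univ_pi, Set.mem_prod, Fin.forall_fin_add,
      Fin.append_left, Fin.append_right]
  rw [Measure.map_apply measurable_append (MeasurableSet.univ_pi hs), preimage_box,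
    Measure.prod_prod, Measure.pi_pi, Measure.pi_pi, Fin.prod_univ_add]

lemma quasiMeasurePreserving_comp_injective {ι κ : Type*} [Fintype ι] [Fintype κ] {e : ι → κ}
    (he : Function.Injective e) :
    Measure.QuasiMeasurePreserving (fun ξ : κ → α => ξ ∘ e)
      (Measure.pi fun _ => μ) (Measure.pi fun _ => μ) := by
  classical
  let inRange : κ → Prop := fun i => ∃ a, e a = i
  let reindex : ι ≃ {i // inRange i} := Equiv.ofInjective e he
  have split := (measurePreserving_piEquivPiSubtypeProd
    (fun _ : κ => μ) inRange).quasiMeasurePreserving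
  have restrict := Measure.quasiMeasurePreserving_fst
    (μ := Measure.pi fun _ : {i // inRange i} => μ)
    (ν := Measure.pi fun _ : {i // ¬ inRange i} => μ)
  have relabel := (measurePreserving_piCongrLeft (α := fun _ : ι => α)
    (fun _ : ι => μ) reindex.symm).quasiMeasurePreserving
  convert (relabel.comp restrict).comp split using 1
  funext ξ i
  have := Equiv.piCongrLeft_apply_apply (P := fun _ : ι => α) reindex.symm
    (fun j : {i // inRange i} => ξ j) (reindex i)
  rw [Equiv.symm_apply_apply] at this
  exact this.symm

lemma ae_ae_append_of_ae {ι : Type*} [Fintype ι] {j k : ℕ} {e : Fin k → ι}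
    (he : Function.Injective e) {P : (Fin (j + k) → α) → Prop}
    (hP : ∀ᵐ ζ ∂(Measure.pi fun _ => μ), P ζ) :
    ∀ᵐ ξ ∂(Measure.pi fun _ : ι => μ), ∀ᵐ η ∂(Measure.pi fun _ => μ),
      P (Fin.append η (fun i => ξ (e i))) := by
  have ae_pair := (measurePreserving_fin_append μ j k).quasiMeasurePreserving.ae hP
  have ae_swap := Measure.measurePreserving_swap.quasiMeasurePreserving.ae ae_pair
  exact (quasiMeasurePreserving_comp_injective μ he).ae (Measure.ae_ae_of_ae_prod ae_swap)

end Rearranging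

lemma prod_comp_orderEmbOfFin {ι M : Type*} [LinearOrder ι] [CommMonoid M] (s : Finset ι)
    (g : ι → M) : ∏ i, g (s.orderEmbOfFin rfl i) = ∏ k ∈ s, g k :=
  ((s.orderIsoOfFin rfl).toEquiv.prod_comp fun k => g k).trans (s.prod_coe_sort g)

/-! ### Wick powers of superpositions of coherent vectors -/

/-- Conditions under which all integrals over Gaussian sources with couplings `c` and imaginary
times `y` converge: the couplings are bounded by `C`, and the times increase in steps of at
least `L`, where `L` is so large that the interaction is dominated by the Gaussian weights. -/
structure Admissible (C L : ℝ) {n : ℕ} (c : Fin n → ℂ) (y : Fin n → ℝ) : Prop where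
  bound_pos : 0 < C
  gap_pos : 0 < L
  norm_le : ∀ i, ‖c i‖ ≤ C
  gap_le : ∀ i k, i < k → L ≤ y k - y i
  small : n * pairBound C L < 1 / 4

section Admissible

variable {C L : ℝ} {n : ℕ}

lemma Admissible.card_mul_lt {c : Fin n → ℂ} {y : Fin n → ℝ} (h : Admissible C L c y) :
    Fintype.card (Fin n) * pairBound C L < 1 / 2 := by
  rw [Fintype.card_fin]
  exact h.small.trans (by norm_num)

lemma Admissible.lt_of_gap_le {c : Fin n → ℂ} {y : Fin n → ℝ} (h : Admissible C L c y) {y₀ : ℝ}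
    (hy : ∀ i, L ≤ y i - y₀) (i : Fin n) : y₀ < y i :=
  sub_pos.1 (h.gap_pos.trans_le (hy i))

lemma Admissible.tail {c : Fin (n + 1) → ℂ} {y : Fin (n + 1) → ℝ} (h : Admissible C L c y) :
    Admissible C L (Fin.tail c) (Fin.tail y) where
  bound_pos := h.bound_pos
  gap_pos := h.gap_pos
  norm_le i := h.norm_le i.succ
  gap_le i k hik := h.gap_le i.succ k.succ (Fin.succ_lt_succ_iff.2 hik)
  small := h.small.trans_le' (by
    have := pairBound_nonneg C L
    gcongr
    exact n.le_succ)

lemma Admissible.gap_le_tail {c : Fin (n + 1) → ℂ} {y : Fin (n + 1) → ℝ}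
    (h : Admissible C L c y) (i : Fin n) : L ≤ Fin.tail y i - y 0 :=
  h.gap_le 0 i.succ i.succ_pos

end Admissible

/-- The common momentum dependence of the bounds for `N`-particle functions at imaginary time at
least `y₀`. -/
def momentumDecay (m y₀ : ℝ) {N : ℕ} (ξ : Fin N → R3) : ℝ :=
  ∏ a, Real.exp (-(y₀ * energy m (ξ a)))

lemma momentumDecay_nonneg (m y₀ : ℝ) {N : ℕ} (ξ : Fin N → R3) : 0 ≤ momentumDecay m y₀ ξ :=
  Finset.prod_nonneg fun _ _ => (Real.exp_pos _).le

lemma integrable_momentumDecay (m : ℝ) {L : ℝ} (hL : 0 < L) (N : ℕ) :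
    Integrable (momentumDecay m L) (shellMeasures m N) :=
  Integrable.fintype_prod (μ := fun _ : Fin N => shellMeasure m)
    fun _ => integrable_exp_neg_energy m hL

section OneMomentum

variable (m : ℝ) {ι : Type*} [Fintype ι] {c : ι → ℂ} {y : ι → ℝ} {y₀ : ℝ} (w : ι → Source)
  (x₀ : Fin 4 → ℝ)

lemma integral_inv_planeWave_mul_sourceField (hy : ∀ i, y₀ < y i) :
    ∫ η, (planeWave m η (timeShift y₀ x₀))⁻¹ * sourceField m c y w η ∂(shellMeasure m) =
      (fieldConst : ℂ)⁻¹ * contraction m c y w (timeShift y₀ x₀) := by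
  have expand : ∀ η, (planeWave m η (timeShift y₀ x₀))⁻¹ * sourceField m c y w η =
      ∑ i, fieldConst * (c i * (w i).1) * ((planeWave m η (timeShift y₀ x₀))⁻¹ *
        planeWave m η (timeShift (y i) (w i).2)) := fun η => by
    rw [sourceField, Finset.mul_sum, Finset.mul_sum]
    exact Finset.sum_congr rfl fun i _ => by ring
  simp only [expand]
  rw [integral_finsetSum _ fun i _ =>
    (integrable_inv_planeWave_mul m (hy i) x₀ (w i).2).const_mul _, contraction, Finset.mul_sum]
  refine Finset.sum_congr rfl fun i _ => ?_
  rw [integral_const_mul, twoPoint_sub_eq]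
  field_simp

lemma norm_inv_planeWave_mul_sourceField_le {C L : ℝ} (hC : ∀ i, ‖c i‖ ≤ C)
    (hy : ∀ i, L ≤ y i - y₀) (η : R3) :
    ‖(planeWave m η (timeShift y₀ x₀))⁻¹ * sourceField m c y w η‖ ≤
      Real.exp (-(L * energy m η)) * (fieldConst * C * totalAmp w) := by
  rw [norm_mul, norm_inv, norm_planeWave_timeShift, ← Real.exp_neg]
  calc _ ≤ Real.exp (-(-(y₀ * energy m η))) *
          (Real.exp (-((y₀ + L) * energy m η)) * (fieldConst * C * totalAmp w)) := by
        gcongr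
        exact norm_sourceField_le m hC (fun i => by linarith [hy i]) w η
    _ = _ := by
        rw [← mul_assoc, ← Real.exp_add]
        ring_nf

end OneMomentum

section WickPower

variable (m : ℝ) {n : ℕ} (c : Fin n → ℂ) (f : Fin n → (Fin 4 → ℂ) → ℂ) (y : Fin n → ℝ)
  (f₀ : (Fin 4 → ℂ) → ℂ) (y₀ : ℝ)

/-- The contribution of the set `S` of created particles: the factor that does not depend on the
momenta of the annihilated particles. -/
def createdPart {N : ℕ} (S : Finset (Fin N)) (ξ : Fin N → R3)
    (q : (Fin 4 → ℝ) × (Fin n → Source)) : ℂ :=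
  f₀ (timeShift y₀ q.1) * sourceWeight m c f y q.2 *
    ((∏ k ∈ S, planeWave m (ξ k) (timeShift y₀ q.1)) * ∏ k ∈ Sᶜ, sourceField m c y q.2 (ξ k))

/-- The factor belonging to the annihilated particles. -/
def annihilatedPart {j : ℕ} (η : Fin j → R3) (q : (Fin 4 → ℝ) × (Fin n → Source)) : ℂ :=
  ∏ r, ((planeWave m (η r) (timeShift y₀ q.1))⁻¹ * sourceField m c y q.2 (η r))

/-- The `N`-particle function of a Wick power, divided by `l!`, applied to a superposition of
coherent vectors. -/
def wickState (l N : ℕ) (ξ : Fin N → R3) : ℂ :=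
  ∫ q : (Fin 4 → ℝ) × (Fin n → Source),
    f₀ (timeShift y₀ q.1) * sourceWeight m c f y q.2 * (((Real.sqrt N.factorial)⁻¹ : ℝ) *
      wickPoly l (contraction m c y q.2 (timeShift y₀ q.1))
        (fun a => fieldConst * planeWave m (ξ a) (timeShift y₀ q.1))
        (fun a => sourceField m c y q.2 (ξ a))) ∂(volume.prod (sourceMeasures n))

end WickPower

section WickPower

variable {m : ℝ} {n : ℕ} {c : Fin n → ℂ} {f : Fin n → (Fin 4 → ℂ) → ℂ} {y : Fin n → ℝ}
  {C L y₀ : ℝ} {f₀ : (Fin 4 → ℂ) → ℂ}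

lemma measurable_createdPart_mul_annihilatedPart (hf : ∀ i, f i ∈ testSpace (Fin 4))
    (hf₀ : f₀ ∈ testSpace (Fin 4)) {N : ℕ} (S : Finset (Fin N)) (ξ : Fin N → R3) (j : ℕ) :
    Measurable (fun p : (Fin j → R3) × ((Fin 4 → ℝ) × (Fin n → Source)) =>
      createdPart m c f y f₀ y₀ S ξ p.2 * annihilatedPart m c y y₀ p.1 p.2) := by
  have measurable_f₀ := hf₀.1.continuous.measurable
  have measurable_weight := measurable_sourceWeight m c hf y
  unfold createdPart annihilatedPart
  fun_prop

lemma norm_createdPart_le (h : Admissible C L c y) (hy : ∀ i, L ≤ y i - y₀) {N : ℕ}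
    (S : Finset (Fin N)) (ξ : Fin N → R3) (q : (Fin 4 → ℝ) × (Fin n → Source)) :
    ‖createdPart m c f y f₀ y₀ S ξ q‖ ≤ momentumDecay m y₀ ξ * (‖f₀ (timeShift y₀ q.1)‖ *
      (testBound f y q.2 * Real.exp (pairBound C L * totalAmp q.2 ^ 2)) *
      (fieldConst * C * totalAmp q.2) ^ Sᶜ.card) := by
  have field_le : ∀ k, ‖sourceField m c y q.2 (ξ k)‖ ≤
      Real.exp (-(y₀ * energy m (ξ k))) * (fieldConst * C * totalAmp q.2) := fun k =>
    norm_sourceField_le m h.norm_le (fun i => (h.lt_of_gap_le hy i).le) q.2 (ξ k)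
  have weight_nonneg := testBound_nonneg f y q.2
  rw [createdPart, norm_mul, norm_mul, norm_mul, norm_prod, norm_prod]
  simp only [norm_planeWave_timeShift]
  calc _ ≤ ‖f₀ (timeShift y₀ q.1)‖ *
        (testBound f y q.2 * Real.exp (pairBound C L * totalAmp q.2 ^ 2)) *
        ((∏ k ∈ S, Real.exp (-(y₀ * energy m (ξ k)))) *
          ∏ k ∈ Sᶜ, (Real.exp (-(y₀ * energy m (ξ k))) * (fieldConst * C * totalAmp q.2))) := by
        gcongr with k
        · exact norm_sourceWeight_le m h.norm_le h.gap_pos h.gap_le f q.2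
        · exact field_le k
    _ = _ := by
        rw [momentumDecay, ← Finset.prod_mul_prod_compl S, Finset.prod_mul_distrib,
          Finset.prod_const]
        ring

lemma norm_annihilatedPart_le (hC : ∀ i, ‖c i‖ ≤ C) (hy : ∀ i, L ≤ y i - y₀) {j : ℕ}
    (η : Fin j → R3) (q : (Fin 4 → ℝ) × (Fin n → Source)) :
    ‖annihilatedPart m c y y₀ η q‖ ≤
      momentumDecay m L η * (fieldConst * C * totalAmp q.2) ^ j := by
  rw [annihilatedPart, norm_prod, momentumDecay, ← Fin.prod_const, ← Finset.prod_mul_distrib]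
  exact Finset.prod_le_prod (fun _ _ => norm_nonneg _) fun r _ =>
    norm_inv_planeWave_mul_sourceField_le m q.2 q.1 hC hy (η r)

lemma integrable_createdPart_mul_annihilatedPart (h : Admissible C L c y)
    (hy : ∀ i, L ≤ y i - y₀) (hf : ∀ i, f i ∈ testSpace (Fin 4)) (hf₀ : f₀ ∈ testSpace (Fin 4))
    {N : ℕ} (S : Finset (Fin N)) (ξ : Fin N → R3) (j : ℕ) :
    Integrable (fun p : (Fin j → R3) × ((Fin 4 → ℝ) × (Fin n → Source)) =>
        createdPart m c f y f₀ y₀ S ξ p.2 * annihilatedPart m c y y₀ p.1 p.2)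
      ((shellMeasures m j).prod (volume.prod (sourceMeasures n))) := by
  have integrable_bound := (integrable_momentumDecay m h.gap_pos j).mul_prod <|
    (integrable_comp_timeShift hf₀ y₀).norm.mul_prod <|
      integrable_testBound_mul_exp_mul_pow hf y (pairBound_nonneg C L) h.card_mul_lt (Sᶜ.card + j)
  refine (integrable_bound.const_mul
    (momentumDecay m y₀ ξ * (fieldConst * C) ^ (Sᶜ.card + j))).mono'
    (measurable_createdPart_mul_annihilatedPart hf hf₀ S ξ j).aestronglyMeasurable
    (ae_of_all _ fun p => ?_)
  calc _ ≤ _ := (norm_mul_le _ _).trans <| mul_le_mul (norm_createdPart_le h hy S ξ p.2)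
        (norm_annihilatedPart_le h.norm_le hy p.1 p.2) (norm_nonneg _)
        ((norm_nonneg _).trans (norm_createdPart_le h hy S ξ p.2))
    _ = _ := by ring

lemma integral_annihilatedPart (hy : ∀ i, y₀ < y i) (j : ℕ)
    (q : (Fin 4 → ℝ) × (Fin n → Source)) :
    ∫ η, annihilatedPart m c y y₀ η q ∂(shellMeasures m j) =
      ((fieldConst : ℂ)⁻¹ * contraction m c y q.2 (timeShift y₀ q.1)) ^ j := by
  rw [← integral_inv_planeWave_mul_sourceField m q.2 q.1 hy]
  simpa only [annihilatedPart, Fintype.card_fin] using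
    integral_fintype_prod_eq_pow (𝕜 := ℂ) (ι := Fin j) (μ := shellMeasure m)
      fun η => (planeWave m η (timeShift y₀ q.1))⁻¹ * sourceField m c y q.2 η

lemma integrable_createdPart_mul_contraction (h : Admissible C L c y)
    (hy : ∀ i, L ≤ y i - y₀) (hf : ∀ i, f i ∈ testSpace (Fin 4)) (hf₀ : f₀ ∈ testSpace (Fin 4))
    {N : ℕ} (S : Finset (Fin N)) (ξ : Fin N → R3) (j : ℕ) :
    Integrable (fun q => createdPart m c f y f₀ y₀ S ξ q *
        ((fieldConst : ℂ)⁻¹ * contraction m c y q.2 (timeShift y₀ q.1)) ^ j)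
      (volume.prod (sourceMeasures n)) := by
  have integrated :=
    (integrable_createdPart_mul_annihilatedPart (m := m) h hy hf hf₀ S ξ j).integral_prod_right
  simpa only [integral_const_mul, integral_annihilatedPart (h.lt_of_gap_le hy)] using integrated

variable {Φ : Fock m} {l N : ℕ} (S : Finset (Fin N)) (ξ : Fin N → R3)

lemma wickIntegrand_eq_integral (hf₀ : f₀ ∈ testSpace (Fin 4)) (η : Fin (l - S.card) → R3)
    (hη : component Φ ((l - S.card) + Sᶜ.card)
        (Fin.append η (fun i => ξ (Sᶜ.orderEmbOfFin rfl i))) =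
      sourceState m c f y ((l - S.card) + Sᶜ.card)
        (Fin.append η (fun i => ξ (Sᶜ.orderEmbOfFin rfl i)))) :
    wickIntegrand m l f₀ Φ S ξ η = ((2 * (Real.pi : ℂ)) ^ 2)⁻¹ *
      ((Real.sqrt ((l - S.card) + Sᶜ.card).factorial)⁻¹ : ℝ) *
      ∫ q, createdPart m c f y f₀ y₀ S ξ q * annihilatedPart m c y y₀ η q
        ∂(volume.prod (sourceMeasures n)) := by
  rw [wickIntegrand, hη, fourier4_eq_integral_timeShift _ hf₀ y₀, sourceState, mul_assoc,
    ← integral_prod_mul, mul_assoc,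
    ← integral_const_mul _ (fun q => createdPart m c f y f₀ y₀ S ξ q * _)]
  congr 2
  funext q
  rw [exp_neg_minkowski_sub, Fin.prod_univ_add]
  simp only [Fin.append_left, Fin.append_right]
  rw [prod_comp_orderEmbOfFin Sᶜ (fun k => sourceField m c y q.2 (ξ k)), createdPart,
    annihilatedPart, Finset.prod_mul_distrib]
  ring

lemma integrable_wickIntegrand_and_integral_eq (h : Admissible C L c y)
    (hy : ∀ i, L ≤ y i - y₀) (hf : ∀ i, f i ∈ testSpace (Fin 4)) (hf₀ : f₀ ∈ testSpace (Fin 4))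
    (hξ : ∀ᵐ η ∂(shellMeasures m (l - S.card)), component Φ ((l - S.card) + Sᶜ.card)
        (Fin.append η (fun i => ξ (Sᶜ.orderEmbOfFin rfl i))) =
      sourceState m c f y ((l - S.card) + Sᶜ.card)
        (Fin.append η (fun i => ξ (Sᶜ.orderEmbOfFin rfl i)))) :
    Integrable (wickIntegrand m l f₀ Φ S ξ) (shellMeasures m (l - S.card)) ∧
    ∫ η, wickIntegrand m l f₀ Φ S ξ η ∂(shellMeasures m (l - S.card)) =
      ((2 * (Real.pi : ℂ)) ^ 2)⁻¹ *
      ((Real.sqrt ((l - S.card) + Sᶜ.card).factorial)⁻¹ : ℝ) *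
      ∫ q, createdPart m c f y f₀ y₀ S ξ q *
        ((fieldConst : ℂ)⁻¹ * contraction m c y q.2 (timeShift y₀ q.1)) ^ (l - S.card)
        ∂(volume.prod (sourceMeasures n)) := by
  have ae_eq : wickIntegrand m l f₀ Φ S ξ =ᵐ[shellMeasures m (l - S.card)] fun η =>
      ((2 * (Real.pi : ℂ)) ^ 2)⁻¹ *
      ((Real.sqrt ((l - S.card) + Sᶜ.card).factorial)⁻¹ : ℝ) *
      ∫ q, createdPart m c f y f₀ y₀ S ξ q * annihilatedPart m c y y₀ η q
        ∂(volume.prod (sourceMeasures n)) :=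
    hξ.mono fun η => wickIntegrand_eq_integral S ξ hf₀ η
  have integrable_pair := integrable_createdPart_mul_annihilatedPart (m := m) h hy hf hf₀ S ξ
    (l - S.card)
  refine ⟨(integrable_pair.integral_prod_left.const_mul _).congr ae_eq.symm, ?_⟩
  rw [integral_congr_ae ae_eq, integral_const_mul, integral_integral_swap integrable_pair]
  simp only [integral_const_mul, integral_annihilatedPart (h.lt_of_gap_le hy)]

omit S in
lemma wickState_integrand_eq_sum (q : (Fin 4 → ℝ) × (Fin n → Source)) :
    f₀ (timeShift y₀ q.1) * sourceWeight m c f y q.2 * (((Real.sqrt N.factorial)⁻¹ : ℝ) *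
      wickPoly l (contraction m c y q.2 (timeShift y₀ q.1))
        (fun a => fieldConst * planeWave m (ξ a) (timeShift y₀ q.1))
        (fun a => sourceField m c y q.2 (ξ a))) =
    ∑ S : Finset (Fin N) with S.card ≤ l, (((Real.sqrt N.factorial)⁻¹ : ℝ) * fieldConst ^ l /
      ((l - S.card).factorial : ℂ)) * (createdPart m c f y f₀ y₀ S ξ q *
        ((fieldConst : ℂ)⁻¹ * contraction m c y q.2 (timeShift y₀ q.1)) ^ (l - S.card)) := by
  rw [wickPoly, Finset.mul_sum, Finset.mul_sum]
  refine Finset.sum_congr rfl fun S hS => ?_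
  have split_power : (fieldConst : ℂ) ^ l = fieldConst ^ (l - S.card) * fieldConst ^ S.card := by
    rw [← pow_add, Nat.sub_add_cancel (Finset.mem_filter.1 hS).2]
  have fieldConst_ne_zero : (fieldConst : ℂ) ≠ 0 := by
    unfold fieldConst
    exact_mod_cast (by positivity : √Real.pi / (2 * Real.pi) ^ 2 ≠ 0)
  rw [createdPart, Finset.prod_mul_distrib, Finset.prod_const, mul_pow, inv_pow, split_power]
  field_simp

end WickPower

lemma wick_normalization (l : ℕ) :
    ((Real.sqrt Real.pi ^ l * (2 * Real.pi) ^ 2 / (2 * Real.pi) ^ (2 * l) : ℝ) : ℂ) =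
      (fieldConst : ℂ) ^ l * (2 * (Real.pi : ℂ)) ^ 2 := by
  rw [fieldConst, ← Complex.ofReal_pow, div_pow, ← pow_mul]
  push_cast
  ring

lemma ae_wickFormula_eq_wickState {m : ℝ} {n : ℕ} {c : Fin n → ℂ} {f : Fin n → (Fin 4 → ℂ) → ℂ}
    {y : Fin n → ℝ} {C L y₀ : ℝ} {f₀ : (Fin 4 → ℂ) → ℂ} (h : Admissible C L c y)
    (hy : ∀ i, L ≤ y i - y₀) (hf : ∀ i, f i ∈ testSpace (Fin 4)) (hf₀ : f₀ ∈ testSpace (Fin 4))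
    {Φ : Fock m} (hΦ : ∀ N, component Φ N =ᵐ[shellMeasures m N] sourceState m c f y N)
    (l N : ℕ) :
    ∀ᵐ ξ ∂(shellMeasures m N),
      (∀ S : Finset (Fin N), S.card ≤ l →
        Integrable (wickIntegrand m l f₀ Φ S ξ) (shellMeasures m (l - S.card))) ∧
      wickFormula m l f₀ Φ N ξ = l.factorial * wickState m c f y f₀ y₀ l N ξ := by
  have ae_component : ∀ᵐ ξ ∂(shellMeasures m N), ∀ S : Finset (Fin N),
      ∀ᵐ η ∂(shellMeasures m (l - S.card)), component Φ ((l - S.card) + Sᶜ.card)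
        (Fin.append η (fun i => ξ (Sᶜ.orderEmbOfFin rfl i))) =
      sourceState m c f y ((l - S.card) + Sᶜ.card)
        (Fin.append η (fun i => ξ (Sᶜ.orderEmbOfFin rfl i))) :=
    ae_all_iff.2 fun S =>
      ae_ae_append_of_ae (shellMeasure m) (Sᶜ.orderEmbOfFin rfl).injective (hΦ _)
  filter_upwards [ae_component] with ξ hξ
  have term := fun S : Finset (Fin N) =>
    integrable_wickIntegrand_and_integral_eq S ξ h hy hf hf₀ (hξ S)
  refine ⟨fun S _ => (term S).1, ?_⟩
  rw [wickFormula, wickState]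
  simp only [wickState_integrand_eq_sum]
  rw [integral_finsetSum _ fun S _ =>
    (integrable_createdPart_mul_contraction h hy hf hf₀ S ξ _).const_mul _,
    wick_normalization, Finset.mul_sum, Finset.mul_sum]
  refine Finset.sum_congr rfl fun S _ => ?_
  rw [integral_const_mul, (term S).2, Real.sqrt_div (Nat.cast_nonneg _)]
  have sqrt_ne_zero : (Real.sqrt ((l - S.card) + Sᶜ.card).factorial : ℂ) ≠ 0 := by
    exact_mod_cast (Real.sqrt_pos.2 (by positivity)).ne'
  have pi_ne_zero : (Real.pi : ℂ) ≠ 0 := by exact_mod_cast Real.pi_ne_zero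
  push_cast
  field_simp

/-! ### The exponential series -/

@[fun_prop]
lemma measurable_wickPoly {α ι 𝕜 : Type*} [MeasurableSpace α] [RCLike 𝕜] [Fintype ι]
    [DecidableEq ι] (l : ℕ) {X : α → 𝕜} {a b : α → ι → 𝕜} (hX : Measurable X) (ha : Measurable a)
    (hb : Measurable b) : Measurable (fun u => wickPoly l (X u) (a u) (b u)) := by
  unfold wickPoly
  fun_prop

@[fun_prop]
lemma measurable_tail {α : Type*} [MeasurableSpace α] {n : ℕ} :
    Measurable (Fin.tail : (Fin (n + 1) → α) → Fin n → α) :=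
  measurable_pi_lambda _ fun i => measurable_pi_apply i.succ

section Exponential

variable (m : ℝ) {n : ℕ} (c : Fin (n + 1) → ℂ) (f : Fin (n + 1) → (Fin 4 → ℂ) → ℂ)
  (y : Fin (n + 1) → ℝ) (C L : ℝ) (l N : ℕ)

/-- The integrand of the contribution of order `l` to the Wick exponential of the first source,
applied to the superposition of coherent vectors of the remaining sources. -/
def expIntegrand (ξ : Fin N → R3) (w : Fin (n + 1) → Source) : ℂ :=
  f 0 (timeShift (y 0) (w 0).2) *
    sourceWeight m (Fin.tail c) (Fin.tail f) (Fin.tail y) (Fin.tail w) *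
    (((Real.sqrt N.factorial)⁻¹ : ℝ) * wickPoly l
      (c 0 * (w 0).1 *
        contraction m (Fin.tail c) (Fin.tail y) (Fin.tail w) (timeShift (y 0) (w 0).2))
      (fun a => c 0 * (w 0).1 * (fieldConst * planeWave m (ξ a) (timeShift (y 0) (w 0).2)))
      (fun a => sourceField m (Fin.tail c) (Fin.tail y) (Fin.tail w) (ξ a)))

/-- The contribution of order `l` to the Wick exponential. -/
def expState (ξ : Fin N → R3) : ℂ :=
  ∫ w, expIntegrand m c f y l N ξ w ∂(sourceMeasures (n + 1))

/-- The bound of `expIntegrand`, up to the exponential decay in the momenta. The subtracted term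
leaves room for the contractions, so that the sum over `l` depends on `totalAmp w` only. -/
def expBound (w : Fin (n + 1) → Source) : ℝ :=
  testBound f y w *
    Real.exp (pairBound C L * (totalAmp w ^ 2 - |(w 0).1| * totalAmp (Fin.tail w))) *
    ((Real.sqrt N.factorial)⁻¹ * wickPoly l (pairBound C L * (|(w 0).1| * totalAmp (Fin.tail w)))
      (fun _ : Fin N => fieldConst * C * |(w 0).1|)
      (fun _ => fieldConst * C * totalAmp (Fin.tail w)))

lemma hasSum_expBound (w : Fin (n + 1) → Source) :
    HasSum (fun l => expBound f y C L l N w)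
      (testBound f y w * Real.exp (pairBound C L * totalAmp w ^ 2) *
        ((Real.sqrt N.factorial)⁻¹ * (fieldConst * C * totalAmp w) ^ N)) := by
  have sum_wickPoly := hasSum_wickPoly (pairBound C L * (|(w 0).1| * totalAmp (Fin.tail w)))
    (fun _ : Fin N => fieldConst * C * |(w 0).1|)
    (fun _ => fieldConst * C * totalAmp (Fin.tail w))
  rw [← Real.exp_eq_exp_ℝ, Fin.prod_const, ← mul_add, ← totalAmp_succ] at sum_wickPoly
  have exp_split : Real.exp (pairBound C L * totalAmp w ^ 2) =
      Real.exp (pairBound C L * (totalAmp w ^ 2 - |(w 0).1| * totalAmp (Fin.tail w))) *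
        Real.exp (pairBound C L * (|(w 0).1| * totalAmp (Fin.tail w))) := by
    rw [← Real.exp_add, ← mul_add, sub_add_cancel]
  rw [exp_split, ← mul_assoc (testBound f y w), mul_assoc (testBound f y w * _),
    mul_left_comm (Real.exp _)]
  exact (sum_wickPoly.mul_left _).mul_left _

variable {m c f y C L}

lemma expBound_nonneg (hC : 0 ≤ C) (w : Fin (n + 1) → Source) :
    0 ≤ expBound f y C L l N w := by
  have tail_nonneg := totalAmp_nonneg (Fin.tail w)
  have pair_nonneg := pairBound_nonneg C L
  have const_nonneg := fieldConst_nonneg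
  have weight_nonneg := testBound_nonneg f y w
  have wick_nonneg : 0 ≤ wickPoly l (pairBound C L * (|(w 0).1| * totalAmp (Fin.tail w)))
      (fun _ : Fin N => fieldConst * C * |(w 0).1|)
      (fun _ => fieldConst * C * totalAmp (Fin.tail w)) :=
    wickPoly_nonneg l (by positivity) (fun _ => by positivity) fun _ => by positivity
  unfold expBound
  positivity

lemma measurable_expBound (hf : ∀ i, f i ∈ testSpace (Fin 4)) :
    Measurable (expBound f y C L l N) := by
  have measurable_weight := measurable_testBound hf y
  unfold expBound
  fun_prop

lemma measurable_expIntegrand (hf : ∀ i, f i ∈ testSpace (Fin 4)) :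
    Measurable fun r : (Fin N → R3) × (Fin (n + 1) → Source) =>
      expIntegrand m c f y l N r.1 r.2 := by
  have measurable_head := (hf 0).1.continuous.measurable
  have measurable_weight := measurable_sourceWeight m (Fin.tail c) (f := Fin.tail f)
    (fun i => hf i.succ) (Fin.tail y)
  unfold expIntegrand
  fun_prop

lemma exp_totalAmp_tail_sq_le (w : Fin (n + 1) → Source) :
    Real.exp (pairBound C L * totalAmp (Fin.tail w) ^ 2) ≤
      Real.exp (pairBound C L * (totalAmp w ^ 2 - |(w 0).1| * totalAmp (Fin.tail w))) := by
  have cross_nonneg := mul_nonneg (abs_nonneg (w 0).1) (totalAmp_nonneg (Fin.tail w))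
  rw [totalAmp_succ]
  gcongr
  · exact pairBound_nonneg C L
  · linarith [sq_nonneg |(w 0).1|, add_sq |(w 0).1| (totalAmp (Fin.tail w))]

lemma norm_expIntegrand_le (h : Admissible C L c y) (ξ : Fin N → R3)
    (w : Fin (n + 1) → Source) :
    ‖expIntegrand m c f y l N ξ w‖ ≤ momentumDecay m (y 0) ξ * expBound f y C L l N w := by
  have field_le : ∀ a, ‖c 0 * (w 0).1 * (fieldConst * planeWave m (ξ a)
      (timeShift (y 0) (w 0).2))‖ ≤
      Real.exp (-(y 0 * energy m (ξ a))) * (fieldConst * C * |(w 0).1|) := fun a => by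
    have const_nonneg := fieldConst_nonneg
    rw [norm_mul, norm_mul, norm_mul, norm_planeWave_timeShift, Complex.norm_real,
      Complex.norm_real, Real.norm_of_nonneg const_nonneg, Real.norm_eq_abs]
    calc _ ≤ C * |(w 0).1| * (fieldConst * Real.exp (-(y 0 * energy m (ξ a)))) := by
          gcongr
          exact h.norm_le 0
      _ = _ := by ring
  have wickPoly_le := norm_wickPoly_le l
    (norm_mul_contraction_le m (h.norm_le 0) h.tail.norm_le h.gap_pos h.gap_le_tail
      (w 0) (Fin.tail w)) field_le
    fun a => norm_sourceField_le m h.tail.norm_le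
      (fun i => (h.tail.lt_of_gap_le h.gap_le_tail i).le) (Fin.tail w) (ξ a)
  have weight_le := (norm_sourceWeight_le m h.tail.norm_le h.gap_pos h.tail.gap_le (Fin.tail f)
    (Fin.tail w)).trans (mul_le_mul_of_nonneg_left (exp_totalAmp_tail_sq_le w)
      (testBound_nonneg _ _ _))
  rw [wickPoly_prod_mul] at wickPoly_le
  rw [expIntegrand, norm_mul, norm_mul, norm_mul, Complex.norm_real,
    Real.norm_of_nonneg (by positivity : 0 ≤ (Real.sqrt N.factorial)⁻¹)]
  calc _ ≤ _ := mul_le_mul (mul_le_mul_of_nonneg_left weight_le (norm_nonneg _))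
        (mul_le_mul_of_nonneg_left wickPoly_le (by positivity)) (by positivity)
        (mul_nonneg (norm_nonneg _) ((norm_nonneg _).trans weight_le))
    _ = _ := by
        rw [expBound, testBound_succ, momentumDecay]
        ring

lemma integrable_sum_expBound (h : Admissible C L c y) (hf : ∀ i, f i ∈ testSpace (Fin 4)) :
    Integrable (fun w => testBound f y w * Real.exp (pairBound C L * totalAmp w ^ 2) *
        ((Real.sqrt N.factorial)⁻¹ * (fieldConst * C * totalAmp w) ^ N))
      (sourceMeasures (n + 1)) := by
  convert (integrable_testBound_mul_exp_mul_pow hf y (pairBound_nonneg C L) h.card_mul_lt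
    N).const_mul ((Real.sqrt N.factorial)⁻¹ * (fieldConst * C) ^ N) using 2 with w
  ring

lemma hasSum_expState (h : Admissible C L c y) (hf : ∀ i, f i ∈ testSpace (Fin 4))
    (ξ : Fin N → R3) :
    HasSum (fun l => expState m c f y l N ξ) (sourceState m c f y N ξ) := by
  have sum_bound := fun w => (hasSum_expBound f y C L N w).mul_left (momentumDecay m (y 0) ξ)
  refine hasSum_integral_of_dominated_convergence
    (fun l w => momentumDecay m (y 0) ξ * expBound f y C L l N w)
    (fun l => ((measurable_expIntegrand l N hf).comp measurable_prodMk_left).aestronglyMeasurable)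
    (fun l => ae_of_all _ fun w => norm_expIntegrand_le l N h ξ w)
    (ae_of_all _ fun w => (sum_bound w).summable) ?_ (ae_of_all _ fun w => ?_)
  · simp only [(sum_bound _).tsum_eq]
    exact (integrable_sum_expBound N h hf).const_mul _
  · have sum_wickPoly := hasSum_wickPoly (c 0 * (w 0).1 *
        contraction m (Fin.tail c) (Fin.tail y) (Fin.tail w) (timeShift (y 0) (w 0).2))
      (fun a => c 0 * (w 0).1 * (fieldConst * planeWave m (ξ a) (timeShift (y 0) (w 0).2)))
      (fun a => sourceField m (Fin.tail c) (Fin.tail y) (Fin.tail w) (ξ a))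
    rw [← Complex.exp_eq_exp_ℂ] at sum_wickPoly
    simp only [sourceWeight_succ, sourceField_succ m c y w]
    rw [mul_assoc, mul_assoc, mul_left_comm (Complex.exp _), ← mul_assoc]
    exact (sum_wickPoly.mul_left _).mul_left _

lemma expState_eq (ξ : Fin N → R3) :
    expState m c f y l N ξ = c 0 ^ l * (∫ t : ℝ, (t : ℂ) ^ l ∂stdGauss) *
      wickState m (Fin.tail c) (Fin.tail f) (Fin.tail y) (f 0) (y 0) l N ξ := by
  have assoc := measurePreserving_prodAssoc stdGauss (volume : Measure (Fin 4 → ℝ))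
    (sourceMeasures n)
  rw [mul_assoc, wickState, ← integral_prod_mul, ← integral_const_mul, ← assoc.integral_comp',
    expState, integral_pi_fin_succ]
  refine integral_congr_ae (ae_of_all _ fun p => ?_)
  simp only [expIntegrand, Fin.cons_zero, Fin.tail_cons, wickPoly_mul, mul_pow,
    MeasurableEquiv.prodAssoc, MeasurableEquiv.coe_mk, Equiv.prodAssoc_apply]
  ring

lemma hasSum_wickState (h : Admissible C L c y) (hf : ∀ i, f i ∈ testSpace (Fin 4))
    (ξ : Fin N → R3) :
    HasSum (fun k : ℕ => (c 0 ^ 2 / 2) ^ k / (k.factorial : ℂ) * (((2 * k).factorial : ℂ) *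
        wickState m (Fin.tail c) (Fin.tail f) (Fin.tail y) (f 0) (y 0) (2 * k) N ξ))
      (sourceState m c f y N ξ) := by
  have even_terms := (mul_right_injective₀ two_ne_zero).hasSum_iff
    (f := fun l => expState m c f y l N ξ) (a := sourceState m c f y N ξ) fun l hl => ?_
  · convert even_terms.2 (hasSum_expState N h hf ξ) using 2 with k
    simp only [Function.comp_apply]
    rw [expState_eq, integral_ofReal_pow_two_mul_stdGauss, pow_mul, div_pow]
    field_simp
  · have odd : Odd l := by
      rw [← Nat.not_even_iff_odd, even_iff_exists_two_mul]
      exact fun ⟨k, hk⟩ => hl ⟨k, hk.symm⟩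
    rw [expState_eq, integral_pow_odd_stdGauss odd, mul_zero, zero_mul]

end Exponential

/-! ### Components of Fock vectors -/

/-- The `N`-particle component as a continuous linear map to the `L²` space on the mass shell. -/
def componentCLM (m : ℝ) (N : ℕ) : Fock m →L[ℂ] Lp ℂ 2 (shellMeasures m N) :=
  (particleSpace m N).subtypeL.comp (lp.evalCLM ℂ (fun n : ℕ => particleSpace m n) 2 N)

lemma component_eq_componentCLM {m : ℝ} (Φ : Fock m) (N : ℕ) :
    component Φ N = componentCLM m N Φ := rfl

lemma component_add_ae {m : ℝ} (Φ Ψ : Fock m) (N : ℕ) :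
    component (Φ + Ψ) N =ᵐ[shellMeasures m N] component Φ N + component Ψ N := by
  simp only [component_eq_componentCLM, map_add]
  exact Lp.coeFn_add _ _

lemma component_smul_ae {m : ℝ} (a : ℂ) (Φ : Fock m) (N : ℕ) :
    component (a • Φ) N =ᵐ[shellMeasures m N] a • component Φ N := by
  simp only [component_eq_componentCLM, map_smul]
  exact Lp.coeFn_smul _ _

lemma component_sum_ae {ι : Type*} {m : ℝ} (s : Finset ι) (a : ι → ℂ) (χ : ι → Fock m) (N : ℕ) :
    component (∑ k ∈ s, a k • χ k) N =ᵐ[shellMeasures m N]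
      fun ξ => ∑ k ∈ s, a k * component (χ k) N ξ := by
  classical
  induction s using Finset.induction_on with
  | empty =>
    simp only [Finset.sum_empty, component_eq_componentCLM, map_zero]
    exact Lp.coeFn_zero _ _ _
  | insert k s hk ih =>
    rw [Finset.sum_insert hk]
    filter_upwards [component_add_ae (a k • χ k) (∑ k ∈ s, a k • χ k) N,
      component_smul_ae (a k) (χ k) N, ih] with ξ add_eq smul_eq sum_eq
    rw [add_eq, Pi.add_apply, smul_eq, sum_eq, Finset.sum_insert hk, Pi.smul_apply, smul_eq_mul]

lemma component_ae_eq_of_tendsto {m : ℝ} {Φ : ℕ → Fock m} {Ψ : Fock m}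
    (hΦ : Tendsto Φ atTop (𝓝 Ψ)) {N : ℕ} {g : ℕ → (Fin N → R3) → ℂ} {g' : (Fin N → R3) → ℂ}
    (hg : ∀ K, component (Φ K) N =ᵐ[shellMeasures m N] g K)
    (hlim : ∀ ξ, Tendsto (fun K => g K ξ) atTop (𝓝 (g' ξ))) :
    component Ψ N =ᵐ[shellMeasures m N] g' := by
  have component_tendsto : Tendsto (fun K => componentCLM m N (Φ K)) atTop
      (𝓝 (componentCLM m N Ψ)) := ((componentCLM m N).continuous.tendsto Ψ).comp hΦ
  obtain ⟨ns, ns_mono, ae_tendsto⟩ :=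
    (tendstoInMeasure_of_tendsto_Lp component_tendsto).exists_seq_tendsto_ae
  filter_upwards [ae_tendsto, ae_all_iff.2 hg] with ξ subseq_tendsto component_eq
  refine tendsto_nhds_unique subseq_tendsto ?_
  exact ((hlim ξ).comp ns_mono.tendsto_atTop).congr fun i => (component_eq (ns i)).symm

lemma eq_of_component_ae_eq {m : ℝ} {Φ Ψ : Fock m}
    (h : ∀ N, component Φ N =ᵐ[shellMeasures m N] component Ψ N) : Φ = Ψ :=
  lp.ext (funext fun N => Subtype.ext (Lp.ext (h N)))

lemma component_of_isWickExpSqApply {m : ℝ} {n : ℕ} {c : Fin (n + 1) → ℂ}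
    {f : Fin (n + 1) → (Fin 4 → ℂ) → ℂ} {y : Fin (n + 1) → ℝ} {C L : ℝ} (h : Admissible C L c y)
    (hf : ∀ i, f i ∈ testSpace (Fin 4)) {Φ Ψ : Fock m}
    (hΦ : ∀ N, component Φ N =ᵐ[shellMeasures m N]
      sourceState m (Fin.tail c) (Fin.tail f) (Fin.tail y) N)
    (hΨ : IsWickExpSqApply m (c 0 ^ 2 / 2) (f 0) Φ Ψ) (N : ℕ) :
    component Ψ N =ᵐ[shellMeasures m N] sourceState m c f y N := by
  obtain ⟨χ, hχ, hlim⟩ := hΨ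
  refine component_ae_eq_of_tendsto hlim (fun K => ?_)
    fun ξ => (hasSum_wickState N h hf ξ).tendsto_sum_nat
  have wick_power_eq : ∀ᵐ ξ ∂(shellMeasures m N), ∀ k, component (χ k) N ξ =
      ((2 * k).factorial : ℂ) *
        wickState m (Fin.tail c) (Fin.tail f) (Fin.tail y) (f 0) (y 0) (2 * k) N ξ := by
    refine ae_all_iff.2 fun k => ?_
    filter_upwards [hχ k N, ae_wickFormula_eq_wickState (f := Fin.tail f) h.tail h.gap_le_tail
      (fun i => hf i.succ) (hf 0) hΦ (2 * k) N] with ξ apply_eq formula_eq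
    rw [apply_eq.2, formula_eq.2]
  filter_upwards [component_sum_ae (Finset.range K)
    (fun k => (c 0 ^ 2 / 2) ^ k / (k.factorial : ℂ)) χ N, wick_power_eq] with ξ sum_eq term_eq
  simp only [sum_eq, term_eq]

/-! ### Products of Wick exponentials -/

lemma isWickExpSqProduct_zero_iff {m : ℝ} {g : Fin 0 → ℂ} {f : Fin 0 → (Fin 4 → ℂ) → ℂ}
    {Ψ : Fock m} : IsWickExpSqProduct m g f Ψ ↔ Ψ = vacuum m := by
  constructor
  · rintro ⟨V, last_eq, head_eq, -⟩
    exact head_eq.symm.trans last_eq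
  · rintro rfl
    exact ⟨fun _ => vacuum m, rfl, rfl, fun j => j.elim0⟩

lemma isWickExpSqProduct_succ_iff {m : ℝ} {n : ℕ} {g : Fin (n + 1) → ℂ}
    {f : Fin (n + 1) → (Fin 4 → ℂ) → ℂ} {Ψ : Fock m} :
    IsWickExpSqProduct m g f Ψ ↔ ∃ Φ : Fock m,
      IsWickExpSqProduct m (Fin.tail g) (Fin.tail f) Φ ∧
        IsWickExpSqApply m (g 0) (f 0) Φ Ψ := by
  constructor
  · rintro ⟨V, last_eq, rfl, apply_step⟩
    exact ⟨V 1, ⟨Fin.tail V, last_eq, rfl, fun j => apply_step j.succ⟩, apply_step 0⟩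
  · rintro ⟨Φ, ⟨V, last_eq, rfl, apply_step⟩, apply_head⟩
    exact ⟨Fin.cons Ψ V, last_eq, rfl, Fin.cases apply_head apply_step⟩

lemma isWickExpSqApply_unique {m : ℝ} {g : ℂ} {f : (Fin 4 → ℂ) → ℂ} {Φ Ψ Ψ' : Fock m}
    (h : IsWickExpSqApply m g f Φ Ψ) (h' : IsWickExpSqApply m g f Φ Ψ') : Ψ = Ψ' := by
  obtain ⟨χ, hχ, hlim⟩ := h
  obtain ⟨χ', hχ', hlim'⟩ := h'
  obtain rfl : χ = χ' := funext fun k => eq_of_component_ae_eq fun N => by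
    filter_upwards [hχ k N, hχ' k N] with ξ power_eq power_eq'
    rw [power_eq.2, power_eq'.2]
  exact tendsto_nhds_unique hlim hlim'

lemma isWickExpSqProduct_unique {m : ℝ} {n : ℕ} {g : Fin n → ℂ} {f : Fin n → (Fin 4 → ℂ) → ℂ}
    {Ψ Ψ' : Fock m} (h : IsWickExpSqProduct m g f Ψ) (h' : IsWickExpSqProduct m g f Ψ') :
    Ψ = Ψ' := by
  induction n generalizing Ψ Ψ' with
  | zero => rw [isWickExpSqProduct_zero_iff.1 h, isWickExpSqProduct_zero_iff.1 h']
  | succ n ih =>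
    obtain ⟨Φ, product, step⟩ := isWickExpSqProduct_succ_iff.1 h
    obtain ⟨Φ', product', step'⟩ := isWickExpSqProduct_succ_iff.1 h'
    obtain rfl := ih product product'
    exact isWickExpSqApply_unique step step'

lemma component_vacuum_ae (m : ℝ) (c : Fin 0 → ℂ) (f : Fin 0 → (Fin 4 → ℂ) → ℂ)
    (y : Fin 0 → ℝ) (N : ℕ) :
    component (vacuum m) N =ᵐ[shellMeasures m N] sourceState m c f y N := by
  cases N with
  | zero =>
    have component_eq : component (vacuum m) 0 = (memLp_one_zero m).toLp := by
      rw [component, vacuum, lp.single_apply_self]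
    rw [component_eq]
    filter_upwards [(memLp_one_zero m).coeFn_toLp] with ξ hξ
    rw [hξ]
    simp [sourceState, sourceWeight, interaction, sourceMeasures, Measure.real]
  | succ N =>
    have component_eq : component (vacuum m) (N + 1) =
        ((0 : Lp ℂ 2 (shellMeasures m (N + 1))) : (Fin (N + 1) → R3) → ℂ) := by
      rw [component, vacuum, lp.single_apply_ne _ _ _ (Nat.succ_ne_zero N)]
      rfl
    rw [component_eq]
    filter_upwards [Lp.coeFn_zero ℂ 2 (shellMeasures m (N + 1))] with ξ hξ
    rw [hξ]
    simp [sourceState, sourceField]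

lemma component_of_isWickExpSqProduct {m : ℝ} {n : ℕ} {c : Fin n → ℂ}
    {f : Fin n → (Fin 4 → ℂ) → ℂ} {y : Fin n → ℝ} {C L : ℝ} (h : Admissible C L c y)
    (hf : ∀ i, f i ∈ testSpace (Fin 4)) {Ψ : Fock m}
    (hΨ : IsWickExpSqProduct m (fun i => c i ^ 2 / 2) f Ψ) (N : ℕ) :
    component Ψ N =ᵐ[shellMeasures m N] sourceState m c f y N := by
  induction n generalizing Ψ N with
  | zero =>
    rw [isWickExpSqProduct_zero_iff.1 hΨ]
    exact component_vacuum_ae m c f y N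
  | succ n ih =>
    obtain ⟨Φ, product, step⟩ := isWickExpSqProduct_succ_iff.1 hΨ
    exact component_of_isWickExpSqApply h hf (ih h.tail (fun i => hf i.succ) product) step N

/-! ### Existence of the products -/

lemma isClosed_particleSpace (m : ℝ) (N : ℕ) :
    IsClosed (particleSpace m N : Set (Lp ℂ 2 (shellMeasures m N))) := by
  have eq_iInter : (particleSpace m N : Set (Lp ℂ 2 (shellMeasures m N))) =
      ⋂ σ : Equiv.Perm (Fin N), {g | Lp.compMeasurePreservingₗᵢ ℂ (fun ξ : Fin N → R3 => ξ ∘ σ)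
        (measurePreserving_perm m σ) g = g} := by
    ext g
    rw [Set.mem_iInter]
    refine forall_congr' fun σ => ?_
    have comp_eq := Lp.coeFn_compMeasurePreserving g (measurePreserving_perm m σ)
    refine ⟨fun hg => Lp.ext (comp_eq.trans hg), fun hg => ?_⟩
    rw [show Lp.compMeasurePreserving (fun ξ : Fin N → R3 => ξ ∘ σ)
      (measurePreserving_perm m σ) g = g from hg] at comp_eq
    exact comp_eq.symm
  rw [eq_iInter]
  exact isClosed_iInter fun σ => isClosed_eq (LinearIsometry.continuous _) continuous_id

instance (m : ℝ) (N : ℕ) : CompleteSpace (particleSpace m N) :=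
  (isClosed_particleSpace m N).completeSpace_coe

/-- A bound, uniform in the mass, for the norm of `exp (-y₀ ω)` in the one-particle space. -/
def decayNorm (y₀ : ℝ) : ℝ := Real.sqrt (shellConst / (2 * y₀) ^ 2)

lemma decayNorm_nonneg (y₀ : ℝ) : 0 ≤ decayNorm y₀ := Real.sqrt_nonneg _

lemma decayNorm_sq (y₀ : ℝ) : decayNorm y₀ ^ 2 = shellConst / (2 * y₀) ^ 2 :=
  Real.sq_sqrt (div_nonneg shellConst_nonneg (sq_nonneg _))

lemma momentumDecay_sq (m y₀ : ℝ) {N : ℕ} (ξ : Fin N → R3) :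
    momentumDecay m y₀ ξ ^ 2 = momentumDecay m (2 * y₀) ξ := by
  simp only [momentumDecay, ← Finset.prod_pow, ← Real.exp_nat_mul]
  refine Finset.prod_congr rfl fun a _ => congrArg Real.exp ?_
  push_cast
  ring

section Decay

variable (m : ℝ) {y₀ : ℝ} (hy₀ : 0 < y₀)

include hy₀

lemma integral_momentumDecay_le (N : ℕ) :
    ∫ ξ, momentumDecay m y₀ ξ ∂(shellMeasures m N) ≤ (shellConst / y₀ ^ 2) ^ N := by
  calc ∫ ξ, momentumDecay m y₀ ξ ∂(shellMeasures m N)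
      = (∫ p, Real.exp (-(y₀ * energy m p)) ∂(shellMeasure m)) ^ N := by
        refine (integral_fintype_prod_eq_pow (𝕜 := ℝ) (ι := Fin N) (μ := shellMeasure m)
          fun p => Real.exp (-(y₀ * energy m p))).trans ?_
        rw [Fintype.card_fin]
    _ ≤ _ := pow_le_pow_left₀ (integral_nonneg fun _ => (Real.exp_pos _).le)
        (integral_exp_neg_energy_le m hy₀) N

lemma memLp_momentumDecay (N : ℕ) :
    MemLp (momentumDecay m y₀) 2 (shellMeasures m N) := by
  refine (memLp_two_iff_integrable_sq
    (integrable_momentumDecay m hy₀ N).aestronglyMeasurable).2 ?_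
  simp only [momentumDecay_sq]
  exact integrable_momentumDecay m (by positivity) N

lemma norm_toLp_momentumDecay_le (N : ℕ) :
    ‖(memLp_momentumDecay m hy₀ N).toLp‖ ≤ decayNorm y₀ ^ N := by
  have norm_sq_eq : ‖(memLp_momentumDecay m hy₀ N).toLp‖ ^ 2 =
      ∫ ξ, momentumDecay m (2 * y₀) ξ ∂(shellMeasures m N) := by
    rw [← real_inner_self_eq_norm_sq, L2.inner_def]
    refine integral_congr_ae ?_
    filter_upwards [(memLp_momentumDecay m hy₀ N).coeFn_toLp] with ξ hξ
    rw [hξ, real_inner_self_eq_norm_sq, Real.norm_eq_abs, sq_abs, momentumDecay_sq]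
  refine le_of_sq_le_sq ?_ (pow_nonneg (decayNorm_nonneg y₀) N)
  rw [norm_sq_eq, pow_right_comm, decayNorm_sq]
  exact integral_momentumDecay_le m (by positivity) N

lemma exists_particleSpace_of_bound {N : ℕ} {g : (Fin N → R3) → ℂ}
    (hg : AEStronglyMeasurable g (shellMeasures m N))
    (hsymm : ∀ (σ : Equiv.Perm (Fin N)) ξ, g (ξ ∘ σ) = g ξ) {D : ℝ} (hD : 0 ≤ D)
    (hbound : ∀ ξ, ‖g ξ‖ ≤ D * momentumDecay m y₀ ξ) :
    ∃ v : particleSpace m N, ((v : Lp ℂ 2 (shellMeasures m N)) : (Fin N → R3) → ℂ)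
      =ᵐ[shellMeasures m N] g ∧ ‖v‖ ≤ D * decayNorm y₀ ^ N := by
  have norm_le : ∀ ξ, ‖g ξ‖ ≤ D * ‖momentumDecay m y₀ ξ‖ := fun ξ => by
    rw [Real.norm_of_nonneg (momentumDecay_nonneg m y₀ ξ)]
    exact hbound ξ
  have memLp : MemLp g 2 (shellMeasures m N) :=
    (memLp_momentumDecay m hy₀ N).of_le_mul hg (ae_of_all _ norm_le)
  refine ⟨⟨memLp.toLp, fun σ => ?_⟩, memLp.coeFn_toLp, ?_⟩
  · filter_upwards [memLp.coeFn_toLp, (measurePreserving_perm m σ).quasiMeasurePreserving.ae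
      memLp.coeFn_toLp] with ξ toLp_eq toLp_perm_eq
    rw [toLp_perm_eq, toLp_eq, hsymm]
  · calc ‖memLp.toLp‖ ≤ D * ‖(memLp_momentumDecay m hy₀ N).toLp‖ := by
          refine Lp.norm_le_mul_norm_of_ae_le_mul ?_
          filter_upwards [memLp.coeFn_toLp, (memLp_momentumDecay m hy₀ N).coeFn_toLp]
            with ξ toLp_eq decay_eq
          rw [toLp_eq, decay_eq]
          exact norm_le ξ
      _ ≤ _ := mul_le_mul_of_nonneg_left (norm_toLp_momentumDecay_le m hy₀ N) hD

end Decay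

lemma exists_fock_of_summable {m : ℝ} (v : ∀ N, particleSpace m N) {a : ℕ → ℝ}
    (ha : Summable a) (hv : ∀ N, ‖v N‖ ≤ a N) :
    ∃ Φ : Fock m, (∀ N, Φ N = v N) ∧ ‖Φ‖ ≤ ∑' N, a N := by
  have nonneg : ∀ N, 0 ≤ a N := fun N => (norm_nonneg _).trans (hv N)
  have sum_le : ∀ s : Finset ℕ, ∑ N ∈ s, ‖v N‖ ^ (2 : ENNReal).toReal ≤
      (∑' N, a N) ^ (2 : ENNReal).toReal := fun s => by
    simp only [ENNReal.toReal_ofNat, Real.rpow_two]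
    calc ∑ N ∈ s, ‖v N‖ ^ 2 ≤ ∑ N ∈ s, a N ^ 2 :=
          Finset.sum_le_sum fun N _ => pow_le_pow_left₀ (norm_nonneg _) (hv N) 2
      _ ≤ (∑ N ∈ s, a N) ^ 2 := Finset.sum_sq_le_sq_sum_of_nonneg fun N _ => nonneg N
      _ ≤ _ := pow_le_pow_left₀ (Finset.sum_nonneg fun N _ => nonneg N)
          (ha.sum_le_tsum s fun N _ => nonneg N) 2
  exact ⟨⟨v, memℓp_gen' sum_le⟩, fun N => rfl,
    lp.norm_le_of_forall_sum_le (by simp) (tsum_nonneg nonneg) sum_le⟩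

lemma sum_pow_div_sqrt_factorial_le (s : Finset ℕ) (a : ℝ) :
    ∑ N ∈ s, (Real.sqrt N.factorial)⁻¹ * a ^ N ≤ 3 * Real.exp (2 * a ^ 2) := by
  have term_le : ∀ N : ℕ, (Real.sqrt N.factorial)⁻¹ * a ^ N ≤
      (2 * a ^ 2) ^ N / N.factorial + (1 / 2) ^ N := fun N => by
    have term_sq : ((Real.sqrt N.factorial)⁻¹ * a ^ N) ^ 2 =
        ((2 * a ^ 2) ^ N / N.factorial) * (1 / 2) ^ N := by
      rw [mul_pow, inv_pow, Real.sq_sqrt N.factorial.cast_nonneg, div_mul_eq_mul_div, ← mul_pow,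
        pow_right_comm, div_eq_inv_mul]
      congr 2
      ring
    refine (abs_le_of_sq_le_sq' ?_ (by positivity)).2
    rw [term_sq]
    have exp_term_nonneg : 0 ≤ (2 * a ^ 2) ^ N / (N.factorial : ℝ) := by positivity
    have geometric_term_nonneg : (0 : ℝ) ≤ (1 / 2) ^ N := by positivity
    nlinarith
  have exp_series : HasSum (fun N : ℕ => (2 * a ^ 2) ^ N / N.factorial)
      (Real.exp (2 * a ^ 2)) := by
    rw [Real.exp_eq_exp_ℝ]
    exact NormedSpace.expSeries_div_hasSum_exp _
  have one_le_exp : 1 ≤ Real.exp (2 * a ^ 2) := Real.one_le_exp (by positivity)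
  calc _ ≤ ∑ N ∈ s, ((2 * a ^ 2) ^ N / N.factorial + (1 / 2) ^ N) :=
        Finset.sum_le_sum fun N _ => term_le N
    _ ≤ Real.exp (2 * a ^ 2) + 2 :=
        sum_le_hasSum s (fun N _ => by positivity) (exp_series.add hasSum_geometric_two)
    _ ≤ _ := by linarith

section Existence

variable {m : ℝ} {n : ℕ} {c : Fin (n + 1) → ℂ} {f : Fin (n + 1) → (Fin 4 → ℂ) → ℂ}
  {y : Fin (n + 1) → ℝ} {C L : ℝ} (l N : ℕ)

lemma integrable_expBound (h : Admissible C L c y) (hf : ∀ i, f i ∈ testSpace (Fin 4)) :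
    Integrable (expBound f y C L l N) (sourceMeasures (n + 1)) := by
  have nonneg := fun j w => expBound_nonneg (f := f) (y := y) (L := L) j N h.bound_pos.le w
  refine (integrable_sum_expBound N h hf).mono' (measurable_expBound l N hf).aestronglyMeasurable
    (ae_of_all _ fun w => ?_)
  rw [Real.norm_of_nonneg (nonneg l w)]
  exact le_hasSum (hasSum_expBound f y C L N w) l fun j _ => nonneg j w

lemma norm_expState_le (h : Admissible C L c y) (hf : ∀ i, f i ∈ testSpace (Fin 4))
    (ξ : Fin N → R3) :
    ‖expState m c f y l N ξ‖ ≤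
      (∫ w, expBound f y C L l N w ∂(sourceMeasures (n + 1))) * momentumDecay m (y 0) ξ := by
  rw [mul_comm, ← integral_const_mul]
  exact norm_integral_le_of_norm_le ((integrable_expBound l N h hf).const_mul _)
    (ae_of_all _ (norm_expIntegrand_le l N h ξ))

lemma stronglyMeasurable_expState (hf : ∀ i, f i ∈ testSpace (Fin 4)) :
    StronglyMeasurable (expState m c f y l N) :=
  (measurable_expIntegrand l N hf).stronglyMeasurable.integral_prod_right

lemma expState_comp_perm (σ : Equiv.Perm (Fin N)) (ξ : Fin N → R3) :
    expState m c f y l N (ξ ∘ σ) = expState m c f y l N ξ := by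
  refine integral_congr_ae (ae_of_all _ fun w => ?_)
  have wickPoly_eq := wickPoly_comp_perm l (c 0 * (w 0).1 *
    contraction m (Fin.tail c) (Fin.tail y) (Fin.tail w) (timeShift (y 0) (w 0).2))
    (fun a => c 0 * (w 0).1 * (fieldConst * planeWave m (ξ a) (timeShift (y 0) (w 0).2)))
    (fun a => sourceField m (Fin.tail c) (Fin.tail y) (Fin.tail w) (ξ a)) σ
  simp only [expIntegrand, Function.comp_def] at wickPoly_eq ⊢
  rw [wickPoly_eq]

lemma two_mul_sq_mul_decayNorm_le (hL : 0 < L) {y₀ : ℝ} (hy₀ : L ≤ y₀) (τ : ℝ) :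
    2 * (fieldConst * C * τ * decayNorm y₀) ^ 2 ≤ pairBound C L * τ ^ 2 := by
  have shell_nonneg := shellConst_nonneg
  have decay_le : decayNorm y₀ ^ 2 ≤ shellConst / L ^ 2 / 2 := by
    rw [decayNorm_sq, div_div]
    gcongr
    nlinarith
  calc 2 * (fieldConst * C * τ * decayNorm y₀) ^ 2 =
      2 * (C ^ 2 * fieldConst ^ 2 * τ ^ 2) * decayNorm y₀ ^ 2 := by ring
    _ ≤ 2 * (C ^ 2 * fieldConst ^ 2 * τ ^ 2) * (shellConst / L ^ 2 / 2) := by gcongr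
    _ = _ := by
      rw [pairBound]
      ring

lemma sum_expBound_mul_decayNorm_le (hC : 0 ≤ C) (hL : 0 < L) (hy : L ≤ y 0)
    (s : Finset (ℕ × ℕ)) (w : Fin (n + 1) → Source) :
    ∑ q ∈ s, expBound f y C L q.1 q.2 w * decayNorm (y 0) ^ q.2 ≤
      3 * (testBound f y w * Real.exp (2 * pairBound C L * totalAmp w ^ 2)) := by
  have weight_nonneg := testBound_nonneg f y w
  have norm_nonneg := decayNorm_nonneg (y 0)
  have bound_nonneg := fun l N => expBound_nonneg (f := f) (y := y) (L := L) l N hC w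
  calc ∑ q ∈ s, expBound f y C L q.1 q.2 w * decayNorm (y 0) ^ q.2
      ≤ ∑ N ∈ s.image Prod.snd, ∑ l ∈ s.image Prod.fst,
          expBound f y C L l N w * decayNorm (y 0) ^ N := by
        rw [← Finset.sum_product_right (f := fun q : ℕ × ℕ =>
          expBound f y C L q.1 q.2 w * decayNorm (y 0) ^ q.2)]
        exact Finset.sum_le_sum_of_subset_of_nonneg Finset.subset_product fun q _ _ =>
          mul_nonneg (bound_nonneg _ _) (by positivity)
    _ ≤ ∑ N ∈ s.image Prod.snd, testBound f y w * Real.exp (pairBound C L * totalAmp w ^ 2) *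
          ((Real.sqrt N.factorial)⁻¹ * (fieldConst * C * totalAmp w) ^ N) *
            decayNorm (y 0) ^ N := by
        simp only [← Finset.sum_mul]
        gcongr with N
        exact sum_le_hasSum _ (fun l _ => bound_nonneg l N) (hasSum_expBound f y C L N w)
    _ = testBound f y w * Real.exp (pairBound C L * totalAmp w ^ 2) *
          ∑ N ∈ s.image Prod.snd, (Real.sqrt N.factorial)⁻¹ *
            (fieldConst * C * totalAmp w * decayNorm (y 0)) ^ N := by
        rw [Finset.mul_sum]
        refine Finset.sum_congr rfl fun N _ => ?_
        rw [mul_pow _ (decayNorm (y 0))]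
        ring
    _ ≤ testBound f y w * Real.exp (pairBound C L * totalAmp w ^ 2) *
          (3 * Real.exp (pairBound C L * totalAmp w ^ 2)) := by
        gcongr
        refine (sum_pow_div_sqrt_factorial_le _ _).trans
          (mul_le_mul_of_nonneg_left (Real.exp_le_exp.2 ?_) zero_le_three)
        exact two_mul_sq_mul_decayNorm_le hL hy _
    _ = _ := by
        rw [mul_assoc 2, two_mul, Real.exp_add]
        ring

lemma summable_integral_expBound (h : Admissible C L c y) (hy : L ≤ y 0)
    (hf : ∀ i, f i ∈ testSpace (Fin 4)) :
    Summable fun q : ℕ × ℕ =>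
      (∫ w, expBound f y C L q.1 q.2 w ∂(sourceMeasures (n + 1))) * decayNorm (y 0) ^ q.2 := by
  have integrable_term := fun q : ℕ × ℕ =>
    (integrable_expBound q.1 q.2 h hf).mul_const (decayNorm (y 0) ^ q.2)
  have integrable_total := (integrable_testBound_mul_exp hf y
    (b := 2 * pairBound C L) (mul_nonneg zero_le_two (pairBound_nonneg C L)) (by
      rw [Fintype.card_fin]
      linarith [h.small])).const_mul 3
  refine summable_of_sum_le (c := ∫ w, 3 * (testBound f y w *
    Real.exp (2 * pairBound C L * totalAmp w ^ 2)) ∂(sourceMeasures (n + 1))) (fun q => mul_nonneg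
    (integral_nonneg fun w => expBound_nonneg _ _ h.bound_pos.le w)
    (pow_nonneg (decayNorm_nonneg _) _)) fun s => ?_
  simp only [← integral_mul_const]
  rw [← integral_finsetSum _ fun q _ => integrable_term q]
  exact integral_mono (integrable_finsetSum _ fun q _ => integrable_term q) integrable_total
    (sum_expBound_mul_decayNorm_le h.bound_pos.le h.gap_pos hy s)

lemma exists_fock_expState (h : Admissible C L c y) (hy : L ≤ y 0)
    (hf : ∀ i, f i ∈ testSpace (Fin 4)) :
    ∃ X : ℕ → Fock m, (∀ l N, component (X l) N =ᵐ[shellMeasures m N] expState m c f y l N) ∧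
      Summable fun l => ‖X l‖ := by
  have summable_bound := summable_integral_expBound h hy hf
  choose v v_eq norm_v_le using fun l N => exists_particleSpace_of_bound m
    (h.gap_pos.trans_le hy) (stronglyMeasurable_expState (m := m) l N hf).aestronglyMeasurable
    (expState_comp_perm l N) (integral_nonneg fun w => expBound_nonneg l N h.bound_pos.le w)
    (norm_expState_le l N h hf)
  choose X X_eq norm_X_le using fun l =>
    exists_fock_of_summable (v l) (summable_bound.prod_factor l) (norm_v_le l)
  refine ⟨X, fun l N => ?_,
    Summable.of_nonneg_of_le (fun l => norm_nonneg _) norm_X_le summable_bound.prod⟩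
  rw [component, X_eq]
  exact v_eq l N

lemma exists_fock_wickState (h : Admissible C L c y) (hy : L ≤ y 0)
    (hf : ∀ i, f i ∈ testSpace (Fin 4)) :
    ∃ χ : ℕ → Fock m, (∀ k N, component (χ k) N =ᵐ[shellMeasures m N] fun ξ =>
      (2 * k).factorial *
        wickState m (Fin.tail c) (Fin.tail f) (Fin.tail y) (f 0) (y 0) (2 * k) N ξ) ∧
      Summable fun k => (C ^ 2 / 2) ^ k / k.factorial * ‖χ k‖ := by
  have C_pos := h.bound_pos
  have C_ne : (C : ℂ) ≠ 0 := by exact_mod_cast C_pos.ne'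
  have max_admissible : Admissible C L (Function.update c 0 (C : ℂ)) y := { h with
    norm_le := fun i => by
      rcases eq_or_ne i 0 with rfl | hi
      · rw [Function.update_self, Complex.norm_real, Real.norm_of_nonneg C_pos.le]
      · rw [Function.update_of_ne hi]
        exact h.norm_le i }
  obtain ⟨X, X_eq, summable_X⟩ := exists_fock_expState (m := m) max_admissible hy hf
  refine ⟨fun k => (2 ^ k * (k.factorial : ℂ) / (C : ℂ) ^ (2 * k)) • X (2 * k), fun k N => ?_, ?_⟩
  · filter_upwards [component_smul_ae (2 ^ k * (k.factorial : ℂ) / (C : ℂ) ^ (2 * k))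
      (X (2 * k)) N, X_eq (2 * k) N] with ξ smul_eq state_eq
    rw [smul_eq, Pi.smul_apply, state_eq, expState_eq, Function.update_self, Fin.tail_update_zero,
      integral_ofReal_pow_two_mul_stdGauss, smul_eq_mul]
    have factorial_ne : (k.factorial : ℂ) ≠ 0 := by exact_mod_cast k.factorial_ne_zero
    field_simp
  · refine (summable_X.comp_injective (mul_right_injective₀ (two_ne_zero (α := ℕ)))).congr
      fun k => ?_
    rw [norm_smul, norm_div, norm_mul, norm_pow, norm_pow, Complex.norm_natCast, Complex.norm_real,
      Real.norm_of_nonneg C_pos.le, Complex.norm_ofNat, div_pow, ← pow_mul]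
    simp only [Function.comp_apply]
    field_simp

lemma exists_isWickExpSqApply (h : Admissible C L c y) (hy : L ≤ y 0)
    (hf : ∀ i, f i ∈ testSpace (Fin 4)) {Φ : Fock m}
    (hΦ : ∀ N, component Φ N =ᵐ[shellMeasures m N]
      sourceState m (Fin.tail c) (Fin.tail f) (Fin.tail y) N) :
    ∃ Ψ : Fock m, IsWickExpSqApply m (c 0 ^ 2 / 2) (f 0) Φ Ψ := by
  obtain ⟨χ, χ_eq, summable_χ⟩ := exists_fock_wickState (m := m) h hy hf
  have summable_terms :
      Summable fun k => ((c 0 ^ 2 / 2) ^ k / (k.factorial : ℂ)) • χ k := by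
    refine Summable.of_norm_bounded summable_χ fun k => ?_
    rw [norm_smul, norm_div, norm_pow, norm_div, norm_pow, Complex.norm_natCast,
      Complex.norm_ofNat]
    gcongr
    exact h.norm_le 0
  refine ⟨_, χ, fun k N => ?_, summable_terms.hasSum.tendsto_sum_nat⟩
  filter_upwards [χ_eq k N, ae_wickFormula_eq_wickState (f := Fin.tail f) h.tail h.gap_le_tail
    (fun i => hf i.succ) (hf 0) hΦ (2 * k) N] with ξ state_eq formula_eq
  exact ⟨formula_eq.1, state_eq.trans formula_eq.2.symm⟩

end Existence

lemma exists_isWickExpSqProduct {m : ℝ} {n : ℕ} {c : Fin n → ℂ} {f : Fin n → (Fin 4 → ℂ) → ℂ}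
    {y : Fin n → ℝ} {C L : ℝ} (h : Admissible C L c y) (hy : ∀ i, L ≤ y i)
    (hf : ∀ i, f i ∈ testSpace (Fin 4)) :
    ∃ Ψ : Fock m, IsWickExpSqProduct m (fun i => c i ^ 2 / 2) f Ψ := by
  induction n with
  | zero => exact ⟨vacuum m, isWickExpSqProduct_zero_iff.2 rfl⟩
  | succ n ih =>
    have tail_mem : ∀ i, Fin.tail f i ∈ testSpace (Fin 4) := fun i => hf i.succ
    obtain ⟨Φ, hΦ⟩ := ih h.tail (fun i => hy i.succ) tail_mem
    obtain ⟨Ψ, hΨ⟩ := exists_isWickExpSqApply h (hy 0) hf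
      (component_of_isWickExpSqProduct h.tail tail_mem hΦ)
    exact ⟨Ψ, isWickExpSqProduct_succ_iff.2 ⟨Φ, hΦ, hΨ⟩⟩

/-! ### Functionals with a bounded kernel on the contours -/

/-- The functional `F ↦ ∫_{∏ Γ_j} K(z) F(z) dz`, with the kernel `K` given as a function of the real
parts of the points of the contour. -/
def contourFunctional {n : ℕ} (K : (Fin n → Fin 4 → ℝ) → ℂ) (y : Fin n → ℝ)
    (F : (Fin n × Fin 4 → ℂ) → ℂ) : ℂ :=
  ∫ x, K x * F (fun a => contour y x a.1 a.2)

lemma contour_apply {n : ℕ} (y : Fin n → ℝ) (x : Fin n → Fin 4 → ℝ) (j : Fin n) :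
    contour y x j = timeShift (y j) (x j) := rfl

section BoundedKernel

variable {n : ℕ} {y : Fin n → ℝ} {K : (Fin n → Fin 4 → ℝ) → ℂ} {D : ℝ}

lemma continuous_contour (y : Fin n → ℝ) :
    Continuous fun (x : Fin n → Fin 4 → ℝ) (a : Fin n × Fin 4) => contour y x a.1 a.2 := by
  unfold contour
  fun_prop

lemma norm_le_norm_contour (y : Fin n → ℝ) (x : Fin n → Fin 4 → ℝ) :
    ‖x‖ ≤ ‖fun a : Fin n × Fin 4 => contour y x a.1 a.2‖ := by
  refine (pi_norm_le_iff_of_nonneg (norm_nonneg _)).2 fun j =>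
    (pi_norm_le_iff_of_nonneg (norm_nonneg _)).2 fun μ => ?_
  calc ‖x j μ‖ = |(contour y x j μ).re| := by rw [contour_apply, re_timeShift, Real.norm_eq_abs]
    _ ≤ ‖contour y x j μ‖ := Complex.abs_re_le_norm _
    _ ≤ _ := norm_le_pi_norm (fun a : Fin n × Fin 4 => contour y x a.1 a.2) (j, μ)

lemma exists_order_contour (y : Fin n → ℝ) :
    ∃ k : ℕ, n * 4 < k ∧ ∀ (x : Fin n → Fin 4 → ℝ) (a : Fin n × Fin 4),
      |(contour y x a.1 a.2).im| ≤ k := by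
  obtain ⟨k, hk⟩ := exists_nat_ge ‖y‖
  refine ⟨max k (n * 4 + 1), (Nat.lt_succ_self _).trans_le (le_max_right _ _), fun x a => ?_⟩
  calc |(contour y x a.1 a.2).im| ≤ ‖y a.1‖ := abs_im_timeShift_le _ _ _
    _ ≤ ‖y‖ := norm_le_pi_norm y a.1
    _ ≤ _ := hk.trans (by exact_mod_cast le_max_left _ _)

lemma integrable_inv_one_add_norm_pow_contour {k : ℕ} (hk : n * 4 < k) :
    Integrable fun x : Fin n → Fin 4 → ℝ => ((1 + ‖x‖) ^ k)⁻¹ :=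
  integrable_inv_one_add_norm_pow volume (by simpa [Module.finrank_pi_fintype] using hk)

lemma norm_mul_comp_contour_le (hK : ∀ x, ‖K x‖ ≤ D) {k : ℕ}
    (hk : ∀ (x : Fin n → Fin 4 → ℝ) (a : Fin n × Fin 4), |(contour y x a.1 a.2).im| ≤ k)
    {F : (Fin n × Fin 4 → ℂ) → ℂ} {B : ℝ} (hF : SeminormLE k B F) (x : Fin n → Fin 4 → ℝ) :
    ‖K x * F (fun a => contour y x a.1 a.2)‖ ≤ D * B * ((1 + ‖x‖) ^ k)⁻¹ := by
  rw [norm_mul, mul_assoc]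
  exact mul_le_mul (hK x) (hF.norm_le (hk x) (norm_nonneg x) (norm_le_norm_contour y x))
    (norm_nonneg _) ((norm_nonneg _).trans (hK x))

lemma integrable_mul_comp_contour (hK : ∀ x, ‖K x‖ ≤ D) (hKm : Measurable K)
    {F : (Fin n × Fin 4 → ℂ) → ℂ} (hF : F ∈ testSpace (Fin n × Fin 4)) :
    Integrable fun x => K x * F (fun a => contour y x a.1 a.2) := by
  obtain ⟨k, order_gt, im_le⟩ := exists_order_contour y
  obtain ⟨B, hB⟩ := hF.2 k
  exact ((integrable_inv_one_add_norm_pow_contour order_gt).const_mul _).mono'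
    (hKm.mul (hF.1.continuous.comp (continuous_contour y)).measurable).aestronglyMeasurable
    (ae_of_all _ (norm_mul_comp_contour_le hK im_le hB))

lemma isTemperedUltrahyperfunction_contourFunctional (hK : ∀ x, ‖K x‖ ≤ D) (hKm : Measurable K) :
    IsTemperedUltrahyperfunction (contourFunctional K y) := by
  refine ⟨⟨fun F G => ?_, fun a F => ?_⟩, ?_⟩
  · simp only [contourFunctional, Submodule.coe_add, Pi.add_apply, mul_add]
    exact integral_add (integrable_mul_comp_contour hK hKm F.2)
      (integrable_mul_comp_contour hK hKm G.2)
  · simp only [contourFunctional, Submodule.coe_smul, Pi.smul_apply, smul_eq_mul,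
      mul_left_comm _ a]
    exact integral_const_mul _ _
  · obtain ⟨k, order_gt, im_le⟩ := exists_order_contour y
    refine ⟨k, D * ∫ x : Fin n → Fin 4 → ℝ, ((1 + ‖x‖) ^ k)⁻¹, fun F _ B hB => ?_⟩
    calc ‖contourFunctional K y F‖
        ≤ ∫ x : Fin n → Fin 4 → ℝ, D * B * ((1 + ‖x‖) ^ k)⁻¹ :=
          norm_integral_le_of_norm_le
            ((integrable_inv_one_add_norm_pow_contour order_gt).const_mul _)
            (ae_of_all _ (norm_mul_comp_contour_le hK im_le hB))
      _ = D * (∫ x : Fin n → Fin 4 → ℝ, ((1 + ‖x‖) ^ k)⁻¹) * B := by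
          rw [integral_const_mul]
          ring

end BoundedKernel

/-! ### The matrix of pair contractions -/

/-- The matrix of the contractions `c_j c_k D_m^{(-)}(z_j - z_k)`, `j < k`, of the fields at the
points `z`, symmetric and with zero diagonal. The matrix `A` of the determinant formula is
`1 - pairMatrix`. -/
def pairMatrix (m : ℝ) {n : ℕ} (c : Fin n → ℂ) (z : Fin n → Fin 4 → ℂ) :
    Matrix (Fin n) (Fin n) ℂ :=
  Matrix.of fun j k => if j = k then 0 else c j * c k * twoPoint m (z (min j k) - z (max j k))

/-- The function `(det (1 - B))^{-1/2}` (principal branch) on the contour, where `B` is the matrix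
of pair contractions. -/
def pairKernel (m : ℝ) {n : ℕ} (c : Fin n → ℂ) (y : Fin n → ℝ) (x : Fin n → Fin 4 → ℝ) : ℂ :=
  (1 - pairMatrix m c (contour y x)).det ^ (-(1 / 2) : ℂ)

section PairMatrix

variable (m : ℝ) {n : ℕ} (c : Fin n → ℂ)

lemma pairMatrix_diag (z : Fin n → Fin 4 → ℂ) (j : Fin n) : pairMatrix m c z j j = 0 :=
  if_pos rfl

lemma pairMatrix_of_lt (z : Fin n → Fin 4 → ℂ) {j k : Fin n} (h : j < k) :
    pairMatrix m c z j k = c j * c k * twoPoint m (z j - z k) := by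
  simp only [pairMatrix, Matrix.of_apply, if_neg h.ne, min_eq_left h.le, max_eq_right h.le]

lemma isSymm_pairMatrix (z : Fin n → Fin 4 → ℂ) : (pairMatrix m c z).IsSymm := by
  refine Matrix.IsSymm.ext fun i j => ?_
  simp only [pairMatrix, Matrix.of_apply, eq_comm (a := j), min_comm j, max_comm j, mul_comm (c j)]

lemma measurable_pairKernel (y : Fin n → ℝ) : Measurable (pairKernel m c y) := by
  refine Measurable.pow_const ?_ _
  simp only [Matrix.det_apply, Matrix.sub_apply]
  refine Finset.measurable_sum _ fun σ _ => Measurable.const_smul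
    (Finset.measurable_prod _ fun i _ => measurable_const.sub ?_) _
  simp only [pairMatrix, Matrix.of_apply, contour_apply]
  split_ifs <;> fun_prop

end PairMatrix

lemma sum_sum_eq_two_mul_sum_sum_lt {ι : Type*} [Fintype ι] [LinearOrder ι] {B : ι → ι → ℂ}
    (hB : ∀ i j, B j i = B i j) (hdiag : ∀ i, B i i = 0) :
    ∑ i, ∑ j, B i j = 2 * ∑ i, ∑ j, if i < j then B i j else 0 := by
  have split : ∀ i j, B i j = (if i < j then B i j else 0) + if j < i then B j i else 0 :=
    fun i j => by
      rcases lt_trichotomy i j with h | rfl | h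
      · simp [h, h.not_gt]
      · simp [hdiag]
      · simp [h, h.not_gt, hB]
  calc ∑ i, ∑ j, B i j
      = ∑ i, ∑ j, ((if i < j then B i j else 0) + if j < i then B j i else 0) :=
        Finset.sum_congr rfl fun i _ => Finset.sum_congr rfl fun j _ => split i j
    _ = (∑ i, ∑ j, if i < j then B i j else 0) + ∑ i, ∑ j, if j < i then B j i else 0 := by
        simp only [Finset.sum_add_distrib]
    _ = 2 * ∑ i, ∑ j, if i < j then B i j else 0 := by
        rw [Finset.sum_comm (f := fun i j => if j < i then B j i else 0), two_mul]

lemma interaction_eq_quadForm (m : ℝ) {n : ℕ} (c : Fin n → ℂ) (y : Fin n → ℝ) (t : Fin n → ℝ)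
    (x : Fin n → Fin 4 → ℝ) :
    interaction m c y (fun j => (t j, x j)) = quadForm (pairMatrix m c (contour y x)) t / 2 := by
  rw [quadForm, sum_sum_eq_two_mul_sum_sum_lt (fun i j => ?symm) fun i => ?diag,
    mul_div_cancel_left₀ _ two_ne_zero, interaction]
  case symm =>
    rw [(isSymm_pairMatrix m c (contour y x)).apply i j]
    ring
  case diag => rw [pairMatrix_diag, zero_mul, zero_mul]
  refine Finset.sum_congr rfl fun i _ => Finset.sum_congr rfl fun j _ => ?_
  split_ifs with h
  · rw [pairMatrix_of_lt m c _ h, contour_apply, contour_apply]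
    ring
  · rfl

lemma pairBound_le_one {n : ℕ} {C L : ℝ} (h : n.factorial * pairBound C L ≤ 1 / 2) :
    pairBound C L ≤ 1 :=
  calc pairBound C L ≤ n.factorial * pairBound C L :=
        le_mul_of_one_le_left (pairBound_nonneg C L) (by exact_mod_cast n.factorial_pos)
    _ ≤ 1 := h.trans one_half_lt_one.le

lemma norm_cpow_neg_half_le {d : ℂ} (h : ‖d - 1‖ ≤ 1 / 2) :
    ‖d ^ (-(1 / 2) : ℂ)‖ ≤ (1 / 2 : ℝ) ^ (-(1 / 2) : ℝ) := by
  have half_le : 1 / 2 ≤ ‖d‖ := by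
    have := norm_sub_norm_le (1 : ℂ) d
    rw [norm_sub_rev, norm_one] at this
    linarith
  rw [show (-(1 / 2) : ℂ) = ((-(1 / 2) : ℝ) : ℂ) by norm_num, Complex.norm_cpow_real]
  exact Real.rpow_le_rpow_of_nonpos one_half_pos half_le (by norm_num)

namespace Admissible

variable {m : ℝ} {n : ℕ} {c : Fin n → ℂ} {y : Fin n → ℝ} {C L : ℝ}

lemma norm_pairMatrix_le (h : Admissible C L c y) (x : Fin n → Fin 4 → ℝ) (j k : Fin n) :
    ‖pairMatrix m c (contour y x) j k‖ ≤ pairBound C L := by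
  wlog hjk : j < k generalizing j k
  · rcases (not_lt.1 hjk).eq_or_lt with rfl | hkj
    · simpa [pairMatrix_diag] using pairBound_nonneg C L
    · rw [(isSymm_pairMatrix m c (contour y x)).apply k j]
      exact this k j hkj
  have := h.bound_pos
  calc ‖pairMatrix m c (contour y x) j k‖
      = ‖c j‖ * ‖c k‖ * ‖twoPoint m (timeShift (y j) (x j) - timeShift (y k) (x k))‖ := by
        rw [pairMatrix_of_lt m c _ hjk, norm_mul, norm_mul, contour_apply, contour_apply]
    _ ≤ C * C * (fieldConst ^ 2 * (shellConst / L ^ 2)) := by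
        gcongr
        exacts [h.norm_le j, h.norm_le k,
          norm_twoPoint_le m h.gap_pos (h.gap_le j k hjk) (x j) (x k)]
    _ = pairBound C L := by
        rw [pairBound]
        ring

lemma norm_det_one_sub_pairMatrix_sub_one_le (h : Admissible C L c y)
    (hdet : n.factorial * pairBound C L ≤ 1 / 2) (x : Fin n → Fin 4 → ℝ) :
    ‖(1 - pairMatrix m c (contour y x)).det - 1‖ ≤ 1 / 2 := by
  refine (norm_det_one_sub_sub_one_le (pairBound_nonneg C L) (pairBound_le_one hdet)
    (pairMatrix_diag m c _) (h.norm_pairMatrix_le x)).trans ?_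
  rwa [Fintype.card_fin]

lemma norm_pairKernel_le (h : Admissible C L c y) (hdet : n.factorial * pairBound C L ≤ 1 / 2)
    (x : Fin n → Fin 4 → ℝ) : ‖pairKernel m c y x‖ ≤ (1 / 2 : ℝ) ^ (-(1 / 2) : ℝ) :=
  norm_cpow_neg_half_le (h.norm_det_one_sub_pairMatrix_sub_one_le hdet x)

lemma integral_cexp_interaction (h : Admissible C L c y)
    (hdet : n.factorial * pairBound C L ≤ 1 / 2) (x : Fin n → Fin 4 → ℝ) :
    ∫ t, Complex.exp (interaction m c y fun j => (t j, x j))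
      ∂(Measure.pi fun _ : Fin n => stdGauss) = pairKernel m c y x := by
  simp only [interaction_eq_quadForm]
  exact integral_cexp_quadForm_of_small (isSymm_pairMatrix m c _) (pairMatrix_diag m c _)
    (pairBound_nonneg C L) (pairBound_le_one hdet) (h.small.trans (by norm_num))
    (hdet.trans_lt (by norm_num)) (h.norm_pairMatrix_le x)

end Admissible

/-! ### The vacuum expectation value -/

lemma inner_vacuum_eq {m : ℝ} {g : (Fin 0 → R3) → ℂ} {Ψ : Fock m}
    (hΨ : component Ψ 0 =ᵐ[shellMeasures m 0] g) (ξ : Fin 0 → R3) :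
    inner ℂ (vacuum m) Ψ = g ξ := by
  rw [vacuum, lp.inner_single_left, Submodule.coe_inner, L2.inner_def]
  have integrand_eq : ∀ᵐ ζ ∂(shellMeasures m 0), inner ℂ
      (MemLp.toLp _ (memLp_one_zero m) ζ) ((Ψ 0 : Lp ℂ 2 (shellMeasures m 0)) ζ) = g ξ := by
    filter_upwards [(memLp_one_zero m).coeFn_toLp, hΨ] with ζ one_eq Ψ_eq
    rw [component] at Ψ_eq
    rw [one_eq, Ψ_eq, Subsingleton.elim ζ ξ, RCLike.inner_apply, map_one, mul_one]
  rw [integral_congr_ae integrand_eq]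
  simp [Measure.real]

lemma integral_sourceMeasures_eq {n : ℕ} {W : (Fin n → Source) → ℂ}
    (hW : Integrable W (sourceMeasures n)) :
    ∫ w, W w ∂(sourceMeasures n) = ∫ x : Fin n → Fin 4 → ℝ, ∫ t, W (fun j => (t j, x j))
      ∂(Measure.pi fun _ : Fin n => stdGauss) := by
  have preserving := (measurePreserving_arrowProdEquivProdArrow ℝ (Fin 4 → ℝ) (Fin n)
    (fun _ => stdGauss) (fun _ => (volume : Measure (Fin 4 → ℝ)))).symm
  have integrable_comp := (preserving.integrable_comp_emb
    (MeasurableEquiv.measurableEmbedding _)).2 hW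
  exact (preserving.integral_comp' W).symm.trans (integral_prod_symm _ integrable_comp)

lemma Admissible.sourceState_zero_eq {m : ℝ} {n : ℕ} {c : Fin n → ℂ} {y : Fin n → ℝ} {C L : ℝ}
    {f : Fin n → (Fin 4 → ℂ) → ℂ} (h : Admissible C L c y)
    (hdet : n.factorial * pairBound C L ≤ 1 / 2) (hf : ∀ j, f j ∈ testSpace (Fin 4))
    (ξ : Fin 0 → R3) :
    sourceState m c f y 0 ξ = contourFunctional (pairKernel m c y) y (tensorFun f) := by
  have integrable_weight : Integrable (sourceWeight m c f y) (sourceMeasures n) :=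
    (integrable_testBound_mul_exp hf y (pairBound_nonneg C L) h.card_mul_lt).mono'
      (measurable_sourceWeight m c hf y).aestronglyMeasurable
      (ae_of_all _ fun w => norm_sourceWeight_le m h.norm_le h.gap_pos h.gap_le f w)
  calc sourceState m c f y 0 ξ = ∫ w, sourceWeight m c f y w ∂(sourceMeasures n) := by
        simp [sourceState]
    _ = ∫ x : Fin n → Fin 4 → ℝ, ∫ t, sourceWeight m c f y (fun j => (t j, x j))
          ∂(Measure.pi fun _ : Fin n => stdGauss) := integral_sourceMeasures_eq integrable_weight
    _ = contourFunctional (pairKernel m c y) y (tensorFun f) := by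
        simp only [sourceWeight, integral_const_mul, h.integral_cexp_interaction hdet,
          contourFunctional, mul_comm (pairKernel m c y _)]
        rfl

lemma tendsto_pairBound_atTop (C : ℝ) : Tendsto (pairBound C) atTop (𝓝 0) := by
  unfold pairBound
  simpa only [mul_zero] using ((tendsto_const_nhds.div_atTop
    (tendsto_pow_atTop two_ne_zero)).const_mul (fieldConst ^ 2)).const_mul (C ^ 2)

lemma exists_pairBound_small (n : ℕ) (C : ℝ) :
    ∃ L : ℝ, 0 < L ∧ n * pairBound C L < 1 / 4 ∧ n.factorial * pairBound C L ≤ 1 / 2 := by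
  have eventually_lt : ∀ a ε : ℝ, 0 < ε → ∀ᶠ L in atTop, a * pairBound C L < ε := fun a ε hε => by
    have tendsto_zero := (tendsto_pairBound_atTop C).const_mul a
    rw [mul_zero] at tendsto_zero
    exact tendsto_zero.eventually_lt_const hε
  exact ((eventually_gt_atTop 0).and ((eventually_lt n (1 / 4) (by norm_num)).and
    ((eventually_lt n.factorial (1 / 2) one_half_pos).mono fun _ => le_of_lt))).exists

/-! ### The couplings of the theorem -/

/-- The coupling `c` with `c² / 2 = -r i l²`, for `r = ±1`. -/
def coupling (l : ℝ) (r : ℤ) : ℂ := Complex.I * (Real.sqrt 2 : ℝ) * l * phase r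

lemma phase_sq {r : ℤ} (hr : r = 1 ∨ r = -1) : phase r ^ 2 = Complex.I * r := by
  rw [phase, ← Complex.exp_nat_mul]
  rcases hr with rfl | rfl
  · rw [show ((2 : ℕ) : ℂ) * (Complex.I * ((1 : ℤ) : ℂ) * Real.pi / 4) =
      Real.pi / 2 * Complex.I by push_cast; ring, Complex.exp_pi_div_two_mul_I]
    simp
  · rw [show ((2 : ℕ) : ℂ) * (Complex.I * ((-1 : ℤ) : ℂ) * Real.pi / 4) =
      -Real.pi / 2 * Complex.I by push_cast; ring, Complex.exp_neg_pi_div_two_mul_I]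
    simp

lemma norm_phase (r : ℤ) : ‖phase r‖ = 1 := by
  rw [phase, show Complex.I * (r : ℂ) * Real.pi / 4 = ((r * Real.pi / 4 : ℝ) : ℂ) * Complex.I by
    push_cast; ring]
  exact Complex.norm_exp_ofReal_mul_I _

lemma ofReal_sqrt_two_sq : ((Real.sqrt 2 : ℝ) : ℂ) ^ 2 = 2 := by
  rw [← Complex.ofReal_pow, Real.sq_sqrt two_pos.le, Complex.ofReal_ofNat]

lemma coupling_sq_div_two (l : ℝ) {r : ℤ} (hr : r = 1 ∨ r = -1) :
    coupling l r ^ 2 / 2 = -(r : ℂ) * Complex.I * (l : ℂ) ^ 2 := by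
  rw [coupling, mul_pow, mul_pow, mul_pow, phase_sq hr, Complex.I_sq, ofReal_sqrt_two_sq]
  ring

lemma coupling_mul_coupling (l : ℝ) (r s : ℤ) :
    coupling l r * coupling l s = -(2 * phase r * phase s * (l : ℂ) ^ 2) := by
  rw [coupling, coupling]
  linear_combination (Complex.I ^ 2 * (l : ℂ) ^ 2 * phase r * phase s) * ofReal_sqrt_two_sq +
    2 * (l : ℂ) ^ 2 * phase r * phase s * Complex.I_sq

lemma norm_coupling (l : ℝ) (r : ℤ) : ‖coupling l r‖ = Real.sqrt 2 * |l| := by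
  simp [coupling, norm_phase, abs_of_nonneg (Real.sqrt_nonneg 2)]

lemma vevMatrix_eq_one_sub_pairMatrix (m l : ℝ) {n : ℕ} (r : Fin n → ℤ) (z : Fin n → Fin 4 → ℂ) :
    vevMatrix m l r z = 1 - pairMatrix m (fun j => coupling l (r j)) z := by
  ext j k
  rcases eq_or_ne j k with rfl | hjk
  · simp [vevMatrix, pairMatrix_diag]
  · simp [vevMatrix, pairMatrix, hjk, coupling_mul_coupling]

lemma detIntegrand_eq (m l : ℝ) {n : ℕ} (r : Fin n → ℤ) (y : Fin n → ℝ)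
    (F : (Fin n × Fin 4 → ℂ) → ℂ) :
    detIntegrand m l r y F = fun x =>
      pairKernel m (fun j => coupling l (r j)) y x * F (fun a => contour y x a.1 a.2) := by
  funext x
  rw [detIntegrand, vevMatrix_eq_one_sub_pairMatrix, pairKernel]

lemma detFunctional_eq (m l : ℝ) {n : ℕ} (r : Fin n → ℤ) (y : Fin n → ℝ) :
    detFunctional m l r y =
      contourFunctional (pairKernel m (fun j => coupling l (r j)) y) y := by
  funext F
  rw [detFunctional, detIntegrand_eq, contourFunctional]

end WickField

end

open WickField in
theorem proposition3p3_general (n : ℕ) (C : ℝ) :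
    ∃ L : ℝ, 0 < L ∧ ∀ (m : ℝ) (c : Fin n → ℂ), (∀ j, ‖c j‖ ≤ C) →
      (∀ f : Fin n → (Fin 4 → ℂ) → ℂ, (∀ j, f j ∈ testSpace (Fin 4)) →
        ∃! Ψ : Fock m, IsWickExpSqProduct m (fun j => c j ^ 2 / 2) f Ψ) ∧
      ∀ y : Fin n → ℝ, (∀ j k, j < k → L < y k - y j) →
        (∀ x, ‖(1 - pairMatrix m c (contour y x)).det - 1‖ < 1) ∧
        (∀ F ∈ testSpace (Fin n × Fin 4),
          Integrable fun x => pairKernel m c y x * F (fun a => contour y x a.1 a.2)) ∧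
        IsTemperedUltrahyperfunction (contourFunctional (pairKernel m c y) y) ∧
        ∀ f : Fin n → (Fin 4 → ℂ) → ℂ, (∀ j, f j ∈ testSpace (Fin 4)) →
          ∀ Ψ : Fock m, IsWickExpSqProduct m (fun j => c j ^ 2 / 2) f Ψ →
            inner ℂ (vacuum m) Ψ = contourFunctional (pairKernel m c y) y (tensorFun f) := by
  obtain ⟨L, hL, hn, hdet⟩ := exists_pairBound_small n (max C 1)
  refine ⟨L, hL, fun m c hc => ?_⟩
  have admissible : ∀ y : Fin n → ℝ, (∀ j k, j < k → L ≤ y k - y j) →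
      Admissible (max C 1) L c y := fun y hy =>
    ⟨zero_lt_one.trans_le (le_max_right _ _), hL, fun j => (hc j).trans (le_max_left _ _), hy, hn⟩
  refine ⟨fun f hf => ?_, fun y hy => ?_⟩
  · have h := admissible (fun j => L * (j + 1)) fun j k hjk => by
      have : (j : ℝ) + 1 ≤ k := by exact_mod_cast hjk
      nlinarith
    obtain ⟨Ψ, hΨ⟩ :=
      exists_isWickExpSqProduct h (fun j => le_mul_of_one_le_right hL.le (by simp)) hf
    exact ⟨Ψ, hΨ, fun Ψ' hΨ' => isWickExpSqProduct_unique hΨ' hΨ⟩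
  · have h := admissible y fun j k hjk => (hy j k hjk).le
    have bounded := h.norm_pairKernel_le (m := m) hdet
    have measurable := measurable_pairKernel m c y
    refine ⟨fun x => (h.norm_det_one_sub_pairMatrix_sub_one_le hdet x).trans_lt one_half_lt_one,
      fun F hF => integrable_mul_comp_contour bounded measurable hF,
      isTemperedUltrahyperfunction_contourFunctional bounded measurable, fun f hf Ψ hΨ => ?_⟩
    rw [inner_vacuum_eq (component_of_isWickExpSqProduct h hf hΨ 0) isEmptyElim,
      h.sourceState_zero_eq hdet hf]

open WickField in
theorem proposition3p3 (n : ℕ) (l : ℝ) :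
    ∃ L : ℝ, 0 < L ∧
      ∀ (m : ℝ), 0 ≤ m → ∀ r : Fin n → ℤ, (∀ j, r j = 1 ∨ r j = -1) →
        -- all products `ρ⁽¹⁾(f₁) ⋯ ρ⁽ⁿ⁾(f_n) Φ₀` are well defined
        (∀ f : Fin n → (Fin 4 → ℂ) → ℂ, (∀ j, f j ∈ testSpace (Fin 4)) →
          ∃! Ψ : Fock m,
            IsWickExpSqProduct m (fun j => -(r j : ℂ) * Complex.I * (l : ℂ) ^ 2) f Ψ) ∧
        ∀ y : Fin n → ℝ, (∀ j k, j < k → L < y k - y j) →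
          -- `(det A)^{-1/2}` is well defined on the contour and as a generalized function
          (∀ x, ‖(vevMatrix m l r (contour y x)).det - 1‖ < 1) ∧
          (∀ F ∈ testSpace (Fin n × Fin 4), MeasureTheory.Integrable (detIntegrand m l r y F)) ∧
          IsTemperedUltrahyperfunction (detFunctional m l r y) ∧
          -- the vacuum expectation value
          ∀ f : Fin n → (Fin 4 → ℂ) → ℂ, (∀ j, f j ∈ testSpace (Fin 4)) →
            ∀ Ψ : Fock m,
              IsWickExpSqProduct m (fun j => -(r j : ℂ) * Complex.I * (l : ℂ) ^ 2) f Ψ →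
              inner ℂ (vacuum m) Ψ = detFunctional m l r y (tensorFun f) := by
  obtain ⟨L, hL, main⟩ := proposition3p3_general n (Real.sqrt 2 * |l|)
  refine ⟨L, hL, fun m _ r hr => ?_⟩
  simpa only [← coupling_sq_div_two l (hr _), vevMatrix_eq_one_sub_pairMatrix, detIntegrand_eq,
    detFunctional_eq] using main m (fun j => coupling l (r j)) fun j => (norm_coupling l (r j)).le
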